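/- Let $V$ be a finite-dimensional complex vector space, let $G\subset \mathrm{GL}(V)$ be a complex reflection group (a finite subgroup generated by reflections, i.e. elements of finite order fixing a hyperplane pointwise), let $N\trianglelefteq G$ be a normal subgroup generated by reflections, and let $M$ be a finite-dimensional complex representation of $G$, of dimension $m$. Let $H=G/N$. It acts on $E=V/N$, regarded as a vector space as follows: $E^*\subset S(V^*)^N$ is any $G$-stable subspace spanned by $\dim V$ algebraically independent homogeneous polynomials that generate the algebra $S(V^*)^N$, and $E$ is the dual of $E^*$, so that $S(E^*)=S(V^*)^N$. For a finite group $\Gamma$ acting linearly on a space $W$ as a reflection group (below: $\Gamma=G$ or $N$ acting on $W=V$, or $\Gamma=H$ acting on $W=E$), let $\mathcal{C}_\Gamma\subset S(W^*)$ be the space of $\Gamma$-harmonic polynomials, i.e. those annihilated by all $\Gamma$-invariant polynomial differential operators without constant term, and let $(\mathcal{C}_\Gamma)_d$ be its homogeneous part of degree $d$. For a representation $P$ of $\Gamma$ of finite dimension $p$, the $P$-exponents $e_1^\Gamma(P),\dots,e_p^\Gamma(P)$ are the integers given by $$\sum_{d\ge 0}\dim\bigl((\mathcal{C}_\Gamma)_d\otimes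 P^*\bigr)^{\Gamma}\,q^d=\sum_{i=1}^{p}q^{e_i^\Gamma(P)},$$ and $P$ is called amenable as a $\Gamma$-module if $\sum_{i=1}^p e_i^\Gamma(P)=e_1^\Gamma(\bigwedge^p P)$. The Orlik–Solomon space $U_M^N$ is the dual of $(U_M^N)^*=(\mathcal{C}_N\otimes M^*)^N$; since $\mathcal{C}_N$ is $G$-stable, it is a $G$-module on which $N$ acts trivially, and hence also an $H$-module. Then: (i) If $M$ is amenable as a $G$-module, then $U_M^N$ is amenable as a $G$-module and, for every choice of $E^*$ as above, amenable as an $H$-module. (ii) If $M$ is amenable as an $N$-module, and $U_M^N$ is amenable as a $G$-module or, for some choice of $E^*$ as above, amenable as an $H$-module, then $M$ is amenable as a $G$-module. -/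

import Mathlib

open scoped TensorProduct
open Module

noncomputable section

namespace ReflectionInvariants

/-! ### Reflection groups -/

section ReflectionGroups

variable {V : Type*} [AddCommGroup V] [Module ℂ V]

/-- A reflection: an element of `GL(V)` of finite order that fixes some hyperplane pointwise. -/
def IsReflection (g : LinearMap.GeneralLinearGroup ℂ V) : Prop :=
  IsOfFinOrder g ∧
    ∃ W : Submodule ℂ V, finrank ℂ W + 1 = finrank ℂ V ∧ ∀ w ∈ W, (g : V →ₗ[ℂ] V) w = w

/-- A complex reflection group: a finite subgroup of `GL(V)` generated by reflections. -/
def IsComplexReflectionGroup (G : Subgroup (LinearMap.GeneralLinearGroup ℂ V)) : Prop :=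
  Finite G ∧ Subgroup.closure {g | g ∈ G ∧ IsReflection g} = G

/-- A reflection subgroup of `G`: a subgroup of `G` generated by reflections. -/
def IsReflectionSubgroup {G : Subgroup (LinearMap.GeneralLinearGroup ℂ V)}
    (N : Subgroup G) : Prop :=
  Subgroup.closure {n : G | n ∈ N ∧ IsReflection (n : LinearMap.GeneralLinearGroup ℂ V)} = N

/-- The tautological representation on `V` of a subgroup `G` of `GL(V)`. -/
def naturalRep (G : Subgroup (LinearMap.GeneralLinearGroup ℂ V)) : Representation ℂ G V :=
  (Units.coeHom (Module.End ℂ V)).comp G.subtype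

end ReflectionGroups

/-! ### The polynomial ring `S(V*)` -/

section Polynomials

variable (V : Type*) [AddCommGroup V] [Module ℂ V]

/-- `S(V*)`, the symmetric algebra on the dual space of `V`. -/
abbrev PolyRing : Type _ := SymmetricAlgebra ℂ (Dual ℂ V)

/-- The homogeneous component of degree `d` of `S(V*)`, spanned by the products of `d` linear
forms. -/
def homogeneousPart (d : ℕ) : Submodule ℂ (PolyRing V) :=
  LinearMap.range (SymmetricAlgebra.ι ℂ (Dual ℂ V)) ^ d

variable {V}

/-- Taylor expansion to first order: the algebra map `S(V*) → S(V*)[ε]` sending a linear form `ξ`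
to `ξ + ξ(v) ε`. -/
def shift (v : V) : PolyRing V →ₐ[ℂ] DualNumber (PolyRing V) :=
  SymmetricAlgebra.lift
    ((TrivSqZeroExt.inlAlgHom ℂ (PolyRing V) (PolyRing V)).toLinearMap ∘ₗ SymmetricAlgebra.ι ℂ (Dual ℂ V) +
      (TrivSqZeroExt.inrHom (PolyRing V) (PolyRing V)).restrictScalars ℂ ∘ₗ
        Algebra.linearMap ℂ (PolyRing V) ∘ₗ Dual.eval ℂ V v)

theorem shift_ι (v : V) (ξ : Dual ℂ V) :
    shift v (SymmetricAlgebra.ι ℂ (Dual ℂ V) ξ) =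
      TrivSqZeroExt.inl (SymmetricAlgebra.ι ℂ (Dual ℂ V) ξ) +
        TrivSqZeroExt.inr (algebraMap ℂ (PolyRing V) (ξ v)) := by
  simp [shift]

theorem fst_shift (v : V) (f : PolyRing V) : (shift v f).fst = f := by
  have : (TrivSqZeroExt.fstHom ℂ (PolyRing V) (PolyRing V)).comp (shift v) = AlgHom.id ℂ (PolyRing V) := by
    apply SymmetricAlgebra.algHom_ext
    ext ξ
    simp [shift_ι]
  exact congrArg (fun φ => φ f) this

/-- The directional derivative `∂_v` on `S(V*)`: the derivation with `∂_v ξ = ξ(v)` for every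
linear form `ξ`. -/
def dirDeriv (v : V) : Derivation ℂ (PolyRing V) (PolyRing V) where
  toFun f := (shift v f).snd
  map_add' f g := by simp
  map_smul' c f := by simp
  map_one_eq_zero' := by simp
  leibniz' f g := by simp [fst_shift, TrivSqZeroExt.snd_mul, mul_comm]

theorem dirDeriv_ι (v : V) (ξ : Dual ℂ V) :
    dirDeriv v (SymmetricAlgebra.ι ℂ (Dual ℂ V) ξ) = algebraMap ℂ (PolyRing V) (ξ v) := by
  change (shift v _).snd = _
  rw [shift_ι]
  simp [Algebra.algebraMap_eq_smul_one]

variable (V) in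
/-- The algebra of polynomial (constant coefficient) differential operators on `S(V*)`: all
polynomials in the directional derivatives. -/
def diffOps : Subalgebra ℂ (Module.End ℂ (PolyRing V)) :=
  Algebra.adjoin ℂ (Set.range fun v : V => (dirDeriv v : PolyRing V →ₗ[ℂ] PolyRing V))

variable {Γ : Type*} [Group Γ] (ρ : Representation ℂ Γ V)

/-- The action of a group element on `S(V*)`, as an algebra map; on linear forms it is the dual
action. -/
def polyAct (g : Γ) : PolyRing V →ₐ[ℂ] PolyRing V :=
  SymmetricAlgebra.lift (SymmetricAlgebra.ι ℂ (Dual ℂ V) ∘ₗ ρ.dual g)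

@[simp]
theorem polyAct_ι (g : Γ) (ξ : Dual ℂ V) :
    polyAct ρ g (SymmetricAlgebra.ι ℂ (Dual ℂ V) ξ) =
      SymmetricAlgebra.ι ℂ (Dual ℂ V) (ρ.dual g ξ) := by
  simp [polyAct]

theorem polyAct_one : polyAct ρ 1 = AlgHom.id ℂ (PolyRing V) := by
  apply SymmetricAlgebra.algHom_ext
  refine LinearMap.ext fun ξ => ?_
  change polyAct ρ 1 (SymmetricAlgebra.ι ℂ (Dual ℂ V) ξ) = SymmetricAlgebra.ι ℂ (Dual ℂ V) ξ
  rw [polyAct_ι, map_one]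
  rfl

theorem polyAct_mul (g h : Γ) : polyAct ρ (g * h) = (polyAct ρ g).comp (polyAct ρ h) := by
  apply SymmetricAlgebra.algHom_ext
  refine LinearMap.ext fun ξ => ?_
  change polyAct ρ (g * h) (SymmetricAlgebra.ι ℂ (Dual ℂ V) ξ) =
    polyAct ρ g (polyAct ρ h (SymmetricAlgebra.ι ℂ (Dual ℂ V) ξ))
  rw [polyAct_ι, polyAct_ι, polyAct_ι, map_mul]
  rfl

/-- The representation on `S(V*)` induced by a representation on `V`. -/
def polyRep : Representation ℂ Γ (PolyRing V) where
  toFun g := (polyAct ρ g).toLinearMap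
  map_one' := by rw [polyAct_one]; rfl
  map_mul' g h := by rw [polyAct_mul]; rfl

theorem polyRep_apply (g : Γ) (f : PolyRing V) : polyRep ρ g f = polyAct ρ g f := rfl

theorem polyRep_inv_self (g : Γ) (f : PolyRing V) : polyRep ρ g⁻¹ (polyRep ρ g f) = f := by
  simp [← Module.End.mul_apply, ← map_mul]

theorem polyRep_self_inv (g : Γ) (f : PolyRing V) : polyRep ρ g (polyRep ρ g⁻¹ f) = f := by
  simp [← Module.End.mul_apply, ← map_mul]

theorem homogeneousPart_stable (d : ℕ) (g : Γ) :
    homogeneousPart V d ≤ (homogeneousPart V d).comap (polyRep ρ g) := by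
  rw [← Submodule.map_le_iff_le_comap]
  change Submodule.map (polyAct ρ g).toLinearMap (_ ^ d) ≤ _
  rw [Submodule.map_pow]
  refine pow_le_pow_left' ?_ d
  rintro _ ⟨_, ⟨ξ, rfl⟩, rfl⟩
  exact ⟨ρ.dual g ξ, by simp⟩

/-- The harmonic polynomials of a group acting on `V`: the elements of `S(V*)` annihilated by all
invariant polynomial differential operators without constant term. (The constant term of a
polynomial differential operator `D` is `D 1`, and `D` is invariant when it commutes with the
action of the group on `S(V*)`.) -/
def harmonics : Submodule ℂ (PolyRing V) where
  carrier := {f | ∀ D ∈ diffOps V, (∀ g : Γ, D * polyRep ρ g = polyRep ρ g * D) →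
    D 1 = 0 → D f = 0}
  zero_mem' D _ _ _ := map_zero D
  add_mem' hf hg D h₁ h₂ h₃ := by rw [map_add, hf D h₁ h₂ h₃, hg D h₁ h₂ h₃, add_zero]
  smul_mem' c f hf D h₁ h₂ h₃ := by rw [map_smul, hf D h₁ h₂ h₃, smul_zero]

theorem conj_dirDeriv (g : Γ) (v : V) (f : PolyRing V) :
    polyRep ρ g (dirDeriv v (polyRep ρ g⁻¹ f)) = dirDeriv (ρ g v) f := by
  induction f using SymmetricAlgebra.induction with
  | algebraMap r => simp [polyRep_apply]
  | ι ξ => simp [polyRep_apply, dirDeriv_ι, Dual.transpose_apply]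
  | mul a b ha hb =>
    have hm : ∀ (h : Γ) (x y : PolyRing V), polyRep ρ h (x * y) = polyRep ρ h x * polyRep ρ h y :=
      fun h x y => map_mul (polyAct ρ h) x y
    rw [hm, Derivation.leibniz, Derivation.leibniz, map_add, smul_eq_mul, smul_eq_mul, hm, hm, ha,
      hb, polyRep_self_inv, polyRep_self_inv, smul_eq_mul, smul_eq_mul]
  | add a b ha hb => simp only [map_add, ha, hb]

theorem conj_mem_diffOps (g : Γ) {D : Module.End ℂ (PolyRing V)} (hD : D ∈ diffOps V) :
    polyRep ρ g * D * polyRep ρ g⁻¹ ∈ diffOps V := by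
  have hinv : polyRep ρ g⁻¹ * polyRep ρ g = 1 := by rw [← map_mul]; simp
  have hinv' : polyRep ρ g * polyRep ρ g⁻¹ = 1 := by rw [← map_mul]; simp
  induction hD using Algebra.adjoin_induction with
  | mem x hx =>
    obtain ⟨v, rfl⟩ := hx
    refine Algebra.subset_adjoin ⟨ρ g v, ?_⟩
    ext f : 1
    exact (conj_dirDeriv ρ g v f).symm
  | algebraMap r =>
    rw [← Algebra.commutes, mul_assoc, hinv', mul_one]
    exact Subalgebra.algebraMap_mem _ r
  | add x y _ _ hx hy => rw [mul_add, add_mul]; exact add_mem hx hy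
  | mul x y _ _ hx hy =>
    have : polyRep ρ g * (x * y) * polyRep ρ g⁻¹ =
        (polyRep ρ g * x * polyRep ρ g⁻¹) * (polyRep ρ g * y * polyRep ρ g⁻¹) := by
      calc polyRep ρ g * (x * y) * polyRep ρ g⁻¹
          = polyRep ρ g * x * 1 * y * polyRep ρ g⁻¹ := by noncomm_ring
        _ = polyRep ρ g * x * (polyRep ρ g⁻¹ * polyRep ρ g) * y * polyRep ρ g⁻¹ := by rw [hinv]
        _ = _ := by noncomm_ring
    rw [this]
    exact mul_mem hx hy

/-- The harmonic polynomials of a normal subgroup `N` are stable under the whole group. -/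
theorem harmonics_stable (N : Subgroup Γ) [hN : N.Normal] (g : Γ) :
    harmonics (ρ.comp N.subtype) ≤ (harmonics (ρ.comp N.subtype)).comap (polyRep ρ g) := by
  intro f hf D hD hinv hone
  have hres : ∀ n : N, polyRep (ρ.comp N.subtype) n = polyRep ρ (n : Γ) := fun _ => rfl
  have hD' := conj_mem_diffOps ρ g⁻¹ hD
  rw [inv_inv] at hD'
  have key := hf _ hD' ?_ ?_
  · have := congrArg (polyRep ρ g) key
    rw [map_zero] at this
    rw [← this]
    simp only [Module.End.mul_apply]
    rw [polyRep_self_inv]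
  · intro n
    have h := hinv ⟨g * n * g⁻¹, hN.conj_mem n n.2 g⟩
    rw [hres] at h ⊢
    have e₁ : polyRep ρ g * polyRep ρ (n : Γ) = polyRep ρ (g * n * g⁻¹) * polyRep ρ g := by
      rw [← map_mul, ← map_mul]; simp
    have e₂ : polyRep ρ g⁻¹ * polyRep ρ (g * n * g⁻¹) = polyRep ρ (n : Γ) * polyRep ρ g⁻¹ := by
      rw [← map_mul, ← map_mul]; simp [mul_assoc]
    calc polyRep ρ g⁻¹ * D * polyRep ρ g * polyRep ρ (n : Γ)
        = polyRep ρ g⁻¹ * D * (polyRep ρ g * polyRep ρ (n : Γ)) := by rw [mul_assoc]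
      _ = polyRep ρ g⁻¹ * (D * polyRep ρ (g * n * g⁻¹)) * polyRep ρ g := by
          rw [e₁]; noncomm_ring
      _ = polyRep ρ g⁻¹ * polyRep ρ (g * n * g⁻¹) * D * polyRep ρ g := by
          rw [h]; noncomm_ring
      _ = polyRep ρ (n : Γ) * (polyRep ρ g⁻¹ * D * polyRep ρ g) := by
          rw [e₂]; noncomm_ring
  · simp only [Module.End.mul_apply]
    have : polyRep ρ g (1 : PolyRing V) = 1 := map_one (polyAct ρ g)
    rw [this, hone, map_zero]

/-- The `Γ`-representation on the space `C_N` of harmonic polynomials of a normal subgroup `N`. -/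
def harmonicRep (N : Subgroup Γ) [N.Normal] :
    Representation ℂ Γ (harmonics (ρ.comp N.subtype)) :=
  (polyRep ρ).subrepresentation _ (harmonics_stable ρ N)

/-- The space `(C_Γ)_d` of homogeneous harmonic polynomials of degree `d`. -/
def harmonicPart (d : ℕ) : Submodule ℂ (PolyRing V) :=
  harmonics ρ ⊓ homogeneousPart V d

theorem harmonicPart_stable (d : ℕ) (g : Γ) :
    harmonicPart ρ d ≤ (harmonicPart ρ d).comap (polyRep ρ g) := by
  rintro f ⟨hf, hd⟩
  refine ⟨fun D hD hinv hone => ?_, homogeneousPart_stable ρ d g hd⟩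
  have h : D (polyRep ρ g f) = polyRep ρ g (D f) := congrArg (fun φ => φ f) (hinv g)
  rw [h, hf D hD hinv hone, map_zero]

/-- The representation on the homogeneous harmonic polynomials of degree `d`. -/
def harmonicPartRep (d : ℕ) : Representation ℂ Γ (harmonicPart ρ d) :=
  (polyRep ρ).subrepresentation _ (harmonicPart_stable ρ d)

end Polynomials

/-! ### Exponents and amenability -/

section Amenability

variable {Γ : Type*} [Group Γ] {V : Type*} [AddCommGroup V] [Module ℂ V]
  {M : Type*} [AddCommGroup M] [Module ℂ M]

/-- The fake degree `∑_d ((C_Γ)_d, M) q^d` of a module `M`, as a formal power series in `q`; the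
coefficient `((C_Γ)_d, M)` is the dimension of `((C_Γ)_d ⊗ M*)^Γ ≅ Hom_Γ(M, (C_Γ)_d)`. -/
def fakeDegree (ρ : Representation ℂ Γ V) (τ : Representation ℂ Γ M) : PowerSeries ℕ :=
  PowerSeries.mk fun d => finrank ℂ
    (Representation.invariants (V := harmonicPart ρ d ⊗[ℂ] Dual ℂ M)
      ((harmonicPartRep ρ d).tprod τ.dual))

/-- `e` lists the `M`-exponents of the group acting on `V` through `ρ`, with multiplicity: the
fake degree of `M` is `∑ i, q ^ e i`. -/
def AreExponents {ι : Type*} [Fintype ι] (ρ : Representation ℂ Γ V) (τ : Representation ℂ Γ M)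
    (e : ι → ℕ) : Prop :=
  fakeDegree ρ τ = ∑ i, (PowerSeries.X : PowerSeries ℕ) ^ e i

/-- The `n`-th exterior power of a representation. -/
def extPow (n : ℕ) (τ : Representation ℂ Γ M) : Representation ℂ Γ (⋀[ℂ]^n M) where
  toFun g := exteriorPower.map n (τ g)
  map_one' := by rw [map_one]; exact exteriorPower.map_id (R := ℂ) (M := M) (n := n)
  map_mul' g h := by
    rw [map_mul]
    exact (exteriorPower.map_comp (n := n) (τ h) (τ g))

/-- With respect to a group acting on `V` through `ρ`, the `m`-dimensional module `M` is amenable: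
its `m` exponents `e i` add up to the exponent `e'` of the one-dimensional module `⋀^m M`. -/
def IsAmenable (ρ : Representation ℂ Γ V) (τ : Representation ℂ Γ M) : Prop :=
  ∃ (e : Fin (finrank ℂ M) → ℕ) (e' : ℕ),
    AreExponents ρ τ e ∧
    AreExponents ρ (extPow (finrank ℂ M) τ) (fun _ : Fin 1 => e') ∧
    ∑ i, e i = e'

end Amenability

/-! ### The Orlik-Solomon space and the quotient `V/N` -/

section TensorInvariants

variable {G : Type*} [Group G] {A B : Type*} [AddCommGroup A] [Module ℂ A] [AddCommGroup B]
  [Module ℂ B] (α : Representation ℂ G A) (β : Representation ℂ G B) (N : Subgroup G)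

/-- The `N`-invariants `(A ⊗ B)^N` of the tensor product of two `G`-modules. -/
def tensorInvariants : Submodule ℂ (A ⊗[ℂ] B) :=
  Representation.invariants (k := ℂ) (V := A ⊗[ℂ] B) ((α.tprod β).comp N.subtype)

variable [N.Normal]

/-- For `N` normal in `G`, the `G`-module structure on `(A ⊗ B)^N`. -/
def tensorInvariantsRep : Representation ℂ G (tensorInvariants α β N) :=
  Representation.toInvariants (k := ℂ) (V := A ⊗[ℂ] B) (α.tprod β) N

/-- For `N` normal in `G`, the `G/N`-module structure on `(A ⊗ B)^N`. -/
def tensorInvariantsRepQuotient : Representation ℂ (G ⧸ N) (tensorInvariants α β N) :=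
  Representation.quotientToInvariants (k := ℂ) (V := A ⊗[ℂ] B) (α.tprod β) N

end TensorInvariants

section Quotient

variable {G : Type*} [Group G] {V : Type*} [AddCommGroup V] [Module ℂ V]
  {M : Type*} [AddCommGroup M] [Module ℂ M]
  (ρ : Representation ℂ G V) (N : Subgroup G) [N.Normal] (τ : Representation ℂ G M)

/-- The dual Orlik-Solomon space `(U_M^N)* = (C_N ⊗ M*)^N`. -/
abbrev OSDual : Type _ := tensorInvariants (harmonicRep ρ N) τ.dual N

/-- The Orlik-Solomon space `U_M^N`, the dual of `(C_N ⊗ M*)^N`. -/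
abbrev OSSpace : Type _ := Dual ℂ (OSDual ρ N τ)

/-- The `G`-module structure on the Orlik-Solomon space `U_M^N`. -/
def osRep : Representation ℂ G (OSSpace ρ N τ) :=
  (tensorInvariantsRep (harmonicRep ρ N) τ.dual N).dual

/-- The `G/N`-module structure on the Orlik-Solomon space `U_M^N`. -/
def osRepQuotient : Representation ℂ (G ⧸ N) (OSSpace ρ N τ) :=
  (tensorInvariantsRepQuotient (harmonicRep ρ N) τ.dual N).dual

end Quotient

section LinearQuotient

variable {G : Type*} [Group G] {V : Type*} [AddCommGroup V] [Module ℂ V]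
  (ρ : Representation ℂ G V) (N : Subgroup G)

/-- A realization of the quotient `E = V/N` as a vector space: a `G`-stable space `E*` of
polynomials that is spanned by `dim V` algebraically independent homogeneous generators of the
invariant ring `S(V*)^N`, so that `S(V*)^N = S(E*)`. -/
structure LinearQuotient where
  /-- the space `E*` of linear forms on `E` -/
  coords : Submodule ℂ (PolyRing V)
  stable : ∀ g : G, coords ≤ coords.comap (polyRep ρ g)
  exists_generators : ∃ f : Fin (finrank ℂ V) → PolyRing V,
    (∀ i, ∃ d, f i ∈ homogeneousPart V d) ∧
    AlgebraicIndependent ℂ f ∧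
    Subalgebra.toSubmodule (Algebra.adjoin ℂ (Set.range f)) =
      Representation.invariants (k := ℂ) (V := PolyRing V) ((polyRep ρ).comp N.subtype) ∧
    Submodule.span ℂ (Set.range f) = coords

namespace LinearQuotient

variable {ρ N} (E : LinearQuotient ρ N)

theorem coords_le_invariants : E.coords ≤ Representation.invariants (k := ℂ) (V := PolyRing V) ((polyRep ρ).comp N.subtype) := by
  obtain ⟨f, -, -, h₁, h₂⟩ := E.exists_generators
  rw [← h₁, ← h₂]
  exact Algebra.span_le_adjoin ℂ _

instance : Representation.IsTrivial
    (((polyRep ρ).subrepresentation E.coords E.stable).comp N.subtype) where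
  out n := LinearMap.ext fun x => Subtype.ext (E.coords_le_invariants x.2 n)

variable [N.Normal]

/-- The action of `H = G/N` on `E*`, induced by the action of `G` on polynomials. -/
def coordsRep : Representation ℂ (G ⧸ N) E.coords :=
  ((polyRep ρ).subrepresentation E.coords E.stable).ofQuotient N

/-- The action of `H = G/N` on `E`, the dual of `E*`. -/
def rep : Representation ℂ (G ⧸ N) (Dual ℂ E.coords) := E.coordsRep.dual

end LinearQuotient

end LinearQuotient

end ReflectionInvariants

end

open scoped TensorProduct
open Module

noncomputable section

namespace ReflectionInvariants

/-! ### The grading of the polynomial ring -/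

section Grading

variable {V : Type*} [AddCommGroup V] [Module ℂ V]

/-! Write S for S(V*), R for the Γ-invariants of S, and m for dim M. The Γ-equivariant maps M → S
are generated over R by any ℂ-basis of those with harmonic values (`mem_span_of_basis`). For a
reflection group there are exactly m basis elements, and the degrees of a homogeneous basis are the
M-exponents. The determinant D of the values of such a family at a basis of M is nonzero, is a
semi-invariant of weight det_M, and has degree ∑ e_i. Applied to ⋀^m M, the same facts say that the
semi-invariants of weight det_M are the R-multiples of one w of degree e'. Hence D = r w with r in
R, and comparing degrees shows that M is amenable exactly when D generates these semi-invariants. In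
the form "some equivariant family has a determinant generating them over R" (`HasDetGenerator`,
`isAmenable_iff_hasDetGenerator`) the criterion mentions neither degrees nor harmonics.

Now let y_k be a basis of (U_M^N)*, seen as N-equivariant maps from M to the N-harmonics, and let J
be the determinant of their values. Every G-equivariant map M → S is N-equivariant, so it is ∑ a_k
y_k with N-invariant coefficients, and these coefficients form a G-equivariant map U → S. Conversely
every G-equivariant map U → S can be contracted with the y_k. Value matrices then multiply, D_M =
D_U J, and J has weight det_M / det_U (`polyAct_det_osMatrix`). For (i), multiply a
det_U-semi-invariant by J, use the generator for M, and cancel J (`HasDetGenerator.osRep`). For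
(ii), amenability over N says that every det_M-semi-invariant is J times an N-invariant, which then
has weight det_U (`HasDetGenerator.of_osRep`).

The H-statements follow because S(E*) is identified equivariantly with S^N, and everything in the
criterion for a module inflated from G/N already lies in S^N (`IsDescent.hasDetGenerator_iff`). The
number of generators is transported in the same way, so the reflection property of H on E is not
needed.

Three classical inputs carry this. The harmonics are the orthogonal complement of the Hilbert ideal
for the apolar form (`mem_harmonics_iff`). Chevalley's argument makes harmonics independent over R
(`mem_hilbertIdeal_of_relation`). Dedekind's independence of automorphisms bounds the rank from both
sides (`IsFaithfulOnPoly.eq_zero_of_sum`). -/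

theorem homogeneousPart_eq_comap {κ : Type*} (b : Basis κ ℂ (Dual ℂ V)) (d : ℕ) :
    homogeneousPart V d = (MvPolynomial.homogeneousSubmodule κ ℂ d).comap
      (SymmetricAlgebra.equivMvPolynomial b).toLinearMap := by
  have h1 : (LinearMap.range (SymmetricAlgebra.ι ℂ (Dual ℂ V))).map
      (SymmetricAlgebra.equivMvPolynomial b).toAlgHom.toLinearMap =
        MvPolynomial.homogeneousSubmodule κ ℂ 1 := by
    rw [MvPolynomial.homogeneousSubmodule_one_eq_span_X, ← LinearMap.range_comp]
    have hX : Set.range (MvPolynomial.X : κ → MvPolynomial κ ℂ) =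
        ((SymmetricAlgebra.equivMvPolynomial b).toAlgHom.toLinearMap ∘ₗ
          SymmetricAlgebra.ι ℂ (Dual ℂ V)) '' Set.range b := by
      rw [← Set.range_comp]
      congr 1
      funext i
      simp
    rw [hX, Submodule.span_image, b.span_eq, Submodule.map_top]
  have h2 : (homogeneousPart V d).map
      (SymmetricAlgebra.equivMvPolynomial b).toAlgHom.toLinearMap =
        MvPolynomial.homogeneousSubmodule κ ℂ d := by
    rw [homogeneousPart, Submodule.map_pow, h1, MvPolynomial.homogeneousSubmodule_one_pow]
  rw [← h2]
  exact (Submodule.comap_map_eq_of_injective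
    (SymmetricAlgebra.equivMvPolynomial b).injective _).symm

variable (V) in
/-- Coordinates on `S(V*)` in an arbitrarily chosen basis of `V*`. -/
def chosenCoordinates :
    PolyRing V ≃ₐ[ℂ] MvPolynomial (Basis.ofVectorSpaceIndex ℂ (Dual ℂ V)) ℂ :=
  SymmetricAlgebra.equivMvPolynomial (Basis.ofVectorSpace ℂ (Dual ℂ V))

theorem mem_homogeneousPart_iff {d : ℕ} {f : PolyRing V} :
    f ∈ homogeneousPart V d ↔ (chosenCoordinates V f).IsHomogeneous d := by
  rw [homogeneousPart_eq_comap (Basis.ofVectorSpace ℂ (Dual ℂ V))]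
  rfl

/-- The homogeneous component of degree `d` of a polynomial. -/
def homComp (d : ℕ) : PolyRing V →ₗ[ℂ] PolyRing V :=
  (chosenCoordinates V).symm.toLinearMap ∘ₗ MvPolynomial.homogeneousComponent d ∘ₗ
    (chosenCoordinates V).toLinearMap

theorem chosenCoordinates_homComp (d : ℕ) (f : PolyRing V) :
    chosenCoordinates V (homComp d f) =
      MvPolynomial.homogeneousComponent d (chosenCoordinates V f) := by
  simp [homComp]

theorem homComp_mem (d : ℕ) (f : PolyRing V) : homComp d f ∈ homogeneousPart V d := by
  rw [mem_homogeneousPart_iff, chosenCoordinates_homComp]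
  exact MvPolynomial.homogeneousComponent_isHomogeneous d _

theorem homComp_of_mem {d e : ℕ} {f : PolyRing V} (hf : f ∈ homogeneousPart V d) :
    homComp e f = if d = e then f else 0 := by
  apply (chosenCoordinates V).injective
  rw [mem_homogeneousPart_iff] at hf
  rw [chosenCoordinates_homComp, MvPolynomial.homogeneousComponent_of_mem hf]
  split_ifs with h1 h2 h2
  · rfl
  · exact absurd h1.symm h2
  · exact absurd h2.symm h1
  · rw [map_zero]

theorem homComp_self {d : ℕ} {f : PolyRing V} (hf : f ∈ homogeneousPart V d) :
    homComp d f = f := by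
  rw [homComp_of_mem hf, if_pos rfl]

theorem homComp_ne {d e : ℕ} {f : PolyRing V} (hf : f ∈ homogeneousPart V d) (h : d ≠ e) :
    homComp e f = 0 := by
  rw [homComp_of_mem hf, if_neg h]

theorem exists_sum_homComp (f : PolyRing V) :
    ∃ n, f = ∑ d ∈ Finset.range n, homComp d f := by
  refine ⟨(chosenCoordinates V f).totalDegree + 1, (chosenCoordinates V).injective ?_⟩
  rw [map_sum]
  simp_rw [chosenCoordinates_homComp]
  exact (MvPolynomial.sum_homogeneousComponent _).symm

theorem eq_zero_of_homComp {f : PolyRing V} (h : ∀ d, homComp d f = 0) : f = 0 := by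
  obtain ⟨n, hn⟩ := exists_sum_homComp f
  rw [hn]
  exact Finset.sum_eq_zero fun d _ => h d

theorem homogeneousPart_mul_mem {d e : ℕ} {f g : PolyRing V} (hf : f ∈ homogeneousPart V d)
    (hg : g ∈ homogeneousPart V e) : f * g ∈ homogeneousPart V (d + e) := by
  rw [homogeneousPart, pow_add]
  exact Submodule.mul_mem_mul hf hg

theorem homComp_mul {j d : ℕ} {r : PolyRing V} (hr : r ∈ homogeneousPart V j)
    (f : PolyRing V) : homComp (j + d) (r * f) = r * homComp d f := by
  obtain ⟨n, hn⟩ := exists_sum_homComp f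
  conv_lhs => rw [hn]
  conv_rhs => rw [hn]
  rw [Finset.mul_sum, map_sum, map_sum, Finset.mul_sum]
  refine Finset.sum_congr rfl fun i _ => ?_
  rw [homComp_of_mem (homogeneousPart_mul_mem hr (homComp_mem i f)),
    homComp_of_mem (homComp_mem i f)]
  by_cases h : i = d
  · simp [h]
  · simp [h]

theorem homComp_mul_of_lt {j d : ℕ} {r : PolyRing V} (hr : r ∈ homogeneousPart V j)
    (f : PolyRing V) (h : d < j) : homComp d (r * f) = 0 := by
  obtain ⟨n, hn⟩ := exists_sum_homComp f
  rw [hn, Finset.mul_sum, map_sum]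
  refine Finset.sum_eq_zero fun i _ => ?_
  exact homComp_ne (homogeneousPart_mul_mem hr (homComp_mem i f)) (by omega)

theorem homComp_comm (T : PolyRing V →ₗ[ℂ] PolyRing V)
    (hT : ∀ d, homogeneousPart V d ≤ (homogeneousPart V d).comap T) (d : ℕ) (f : PolyRing V) :
    homComp d (T f) = T (homComp d f) := by
  obtain ⟨n, hn⟩ := exists_sum_homComp f
  conv_lhs => rw [hn]
  conv_rhs => rw [hn]
  simp only [map_sum]
  refine Finset.sum_congr rfl fun i _ => ?_
  rw [homComp_of_mem (hT i (homComp_mem i f)), homComp_of_mem (homComp_mem i f)]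
  split_ifs <;> simp

theorem one_mem_homogeneousPart : (1 : PolyRing V) ∈ homogeneousPart V 0 := by
  rw [homogeneousPart, pow_zero]
  exact Submodule.one_le.mp le_rfl

theorem ι_mem_homogeneousPart (ξ : Dual ℂ V) :
    SymmetricAlgebra.ι ℂ (Dual ℂ V) ξ ∈ homogeneousPart V 1 := by
  rw [homogeneousPart, pow_one]
  exact ⟨ξ, rfl⟩

/-- The constant term of a polynomial. -/
abbrev constTerm : PolyRing V →ₐ[ℂ] ℂ := SymmetricAlgebra.algebraMapInv

theorem constTerm_of_mem {d : ℕ} {f : PolyRing V} (hf : f ∈ homogeneousPart V d) (hd : d ≠ 0) :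
    constTerm f = 0 := by
  obtain ⟨e, rfl⟩ := Nat.exists_eq_succ_of_ne_zero hd
  rw [homogeneousPart, pow_succ] at hf
  induction hf using Submodule.mul_induction_on' with
  | mem_mul_mem a ha b hb =>
    obtain ⟨ξ, rfl⟩ := hb
    rw [map_mul, SymmetricAlgebra.algebraMapInv_ι, mul_zero]
  | add a _ b _ ha hb => rw [map_add, ha, hb, add_zero]

theorem eq_algebraMap_of_mem {f : PolyRing V} (hf : f ∈ homogeneousPart V 0) :
    f = algebraMap ℂ (PolyRing V) (constTerm f) := by
  rw [homogeneousPart, pow_zero, Submodule.mem_one] at hf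
  obtain ⟨c, rfl⟩ := hf
  rw [SymmetricAlgebra.algebraMap_leftInverse (R := ℂ) (Dual ℂ V) c]

theorem constTerm_homComp_zero (f : PolyRing V) : constTerm (homComp 0 f) = constTerm f := by
  obtain ⟨n, hn⟩ := exists_sum_homComp f
  conv_rhs => rw [hn]
  rw [map_sum]
  rcases Nat.eq_zero_or_pos n with rfl | h
  · rw [Finset.range_zero, Finset.sum_empty] at hn
    simp [hn]
  · rw [Finset.sum_eq_single_of_mem 0 (Finset.mem_range.mpr h)]
    intro i _ hi
    exact constTerm_of_mem (homComp_mem i f) hi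

theorem homComp_zero_eq (f : PolyRing V) :
    homComp 0 f = algebraMap ℂ (PolyRing V) (constTerm f) := by
  rw [← constTerm_homComp_zero]
  exact eq_algebraMap_of_mem (homComp_mem 0 f)

/-- Positive-degree parts of r push f out of degree d. This is how two semi-invariants of equal
degree, one a multiple of the other, are seen to differ by a scalar. -/
theorem homComp_self_mul {d : ℕ} {f : PolyRing V} (hf : f ∈ homogeneousPart V d)
    (r : PolyRing V) : homComp d (r * f) = constTerm r • f := by
  have := homComp_mul (d := 0) hf r
  rw [add_zero, mul_comm f r] at this
  rw [this, homComp_zero_eq, Algebra.smul_def, mul_comm]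

theorem homogeneousPart_prod_mem {ι : Type*} (s : Finset ι) {f : ι → PolyRing V} {d : ι → ℕ}
    (h : ∀ i ∈ s, f i ∈ homogeneousPart V (d i)) :
    ∏ i ∈ s, f i ∈ homogeneousPart V (∑ i ∈ s, d i) := by
  classical
  induction s using Finset.induction_on with
  | empty => simpa using one_mem_homogeneousPart
  | insert a s ha ih =>
    rw [Finset.prod_insert ha, Finset.sum_insert ha]
    exact homogeneousPart_mul_mem (h a (Finset.mem_insert_self a s))
      (ih fun i hi => h i (Finset.mem_insert_of_mem hi))

instance [FiniteDimensional ℂ V] (d : ℕ) : FiniteDimensional ℂ (homogeneousPart V d) := by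
  refine Module.Finite.iff_fg.mpr (Submodule.FG.pow ?_ d)
  exact Module.Finite.iff_fg.mp inferInstance

end Grading

/-! ### Invariants and the Hilbert ideal -/

section Invariants

variable {Γ : Type*} [Group Γ] {V : Type*} [AddCommGroup V] [Module ℂ V]
  (ρ : Representation ℂ Γ V)

/-- The algebra of invariant polynomials. -/
def polyInvariants : Subalgebra ℂ (PolyRing V) where
  carrier := {f | ∀ g, polyAct ρ g f = f}
  mul_mem' ha hb g := by rw [map_mul, ha g, hb g]
  add_mem' ha hb g := by rw [map_add, ha g, hb g]
  algebraMap_mem' c g := AlgHom.commutes _ c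

theorem polyAct_inv_self (g : Γ) (f : PolyRing V) : polyAct ρ g⁻¹ (polyAct ρ g f) = f :=
  polyRep_inv_self ρ g f

theorem polyAct_self_inv (g : Γ) (f : PolyRing V) : polyAct ρ g (polyAct ρ g⁻¹ f) = f :=
  polyRep_self_inv ρ g f

theorem polyAct_mem_homogeneousPart {d : ℕ} (g : Γ) {f : PolyRing V}
    (hf : f ∈ homogeneousPart V d) : polyAct ρ g f ∈ homogeneousPart V d :=
  homogeneousPart_stable ρ d g hf

theorem homComp_polyAct (d : ℕ) (g : Γ) (f : PolyRing V) :
    homComp d (polyAct ρ g f) = polyAct ρ g (homComp d f) :=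
  homComp_comm (polyAct ρ g).toLinearMap (fun d => homogeneousPart_stable ρ d g) d f

theorem constTerm_polyAct (g : Γ) (f : PolyRing V) :
    constTerm (polyAct ρ g f) = constTerm f := by
  rw [← constTerm_homComp_zero, homComp_polyAct, homComp_zero_eq, AlgHom.commutes]
  exact SymmetricAlgebra.algebraMap_leftInverse (R := ℂ) (Dual ℂ V) _

theorem homComp_mem_polyInvariants {f : PolyRing V} (hf : f ∈ polyInvariants ρ) (d : ℕ) :
    homComp d f ∈ polyInvariants ρ := fun g => by
  rw [← homComp_polyAct, hf g]

/-- The ideal of `S(V*)` generated by the invariants without constant term. -/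
def hilbertIdeal : Ideal (PolyRing V) :=
  Ideal.span {r | r ∈ polyInvariants ρ ∧ constTerm r = 0}

variable {ρ} in
theorem mem_hilbertIdeal_of_mem {r : PolyRing V} (hr : r ∈ polyInvariants ρ)
    (h : constTerm r = 0) : r ∈ hilbertIdeal ρ := Ideal.subset_span ⟨hr, h⟩

/-- The homogeneous components of an invariant are invariant, so the Hilbert ideal has homogeneous
generators. -/
theorem homComp_mem_hilbertIdeal {f : PolyRing V} (hf : f ∈ hilbertIdeal ρ) (d : ℕ) :
    homComp d f ∈ hilbertIdeal ρ := by
  induction hf using Submodule.span_induction generalizing d with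
  | mem r hr =>
    by_cases hd : d = 0
    · rw [hd, homComp_zero_eq, hr.2, map_zero]
      exact zero_mem _
    · exact mem_hilbertIdeal_of_mem (homComp_mem_polyInvariants ρ hr.1 d)
        (constTerm_of_mem (homComp_mem d r) hd)
  | zero => simp
  | add a b _ _ ha hb => rw [map_add]; exact add_mem (ha d) (hb d)
  | smul a x hx ih =>
    obtain ⟨n, hn⟩ := exists_sum_homComp a
    rw [smul_eq_mul, hn, Finset.sum_mul, map_sum]
    refine sum_mem fun i _ => ?_
    rcases lt_or_ge d i with h | h
    · rw [homComp_mul_of_lt (homComp_mem i a) _ h]; exact zero_mem _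
    · obtain ⟨e, rfl⟩ := Nat.exists_eq_add_of_le h
      rw [homComp_mul (homComp_mem i a)]
      exact Ideal.mul_mem_left _ _ (ih e)

theorem polyAct_mem_hilbertIdeal (g : Γ) {f : PolyRing V} (hf : f ∈ hilbertIdeal ρ) :
    polyAct ρ g f ∈ hilbertIdeal ρ := by
  induction hf using Submodule.span_induction with
  | mem r hr => rw [hr.1 g]; exact Ideal.subset_span hr
  | zero => simp
  | add a b _ _ ha hb => rw [map_add]; exact add_mem ha hb
  | smul a x hx ih => rw [smul_eq_mul, map_mul]; exact Ideal.mul_mem_left _ _ ih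

variable [Finite Γ]

/-- The average of a polynomial over the group. -/
def polyAverage : PolyRing V →ₗ[ℂ] PolyRing V :=
  letI := Fintype.ofFinite Γ
  (Nat.card Γ : ℂ)⁻¹ • ∑ g : Γ, (polyAct ρ g).toLinearMap

theorem polyAverage_apply [Fintype Γ] (f : PolyRing V) :
    polyAverage ρ f = (Nat.card Γ : ℂ)⁻¹ • ∑ g : Γ, polyAct ρ g f := by
  simp only [polyAverage, LinearMap.smul_apply, LinearMap.sum_apply, AlgHom.toLinearMap_apply]
  congr!

theorem polyAverage_mem (f : PolyRing V) : polyAverage ρ f ∈ polyInvariants ρ := fun g => by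
  let _ := Fintype.ofFinite Γ
  rw [polyAverage_apply, map_smul, map_sum]
  congr 1
  refine Fintype.sum_equiv (Equiv.mulLeft g) _ _ fun h => ?_
  rw [Equiv.coe_mulLeft, polyAct_mul]
  rfl

theorem polyAverage_mul {r : PolyRing V} (hr : r ∈ polyInvariants ρ) (f : PolyRing V) :
    polyAverage ρ (r * f) = r * polyAverage ρ f := by
  let _ := Fintype.ofFinite Γ
  simp only [polyAverage_apply, map_mul, mul_smul_comm, Finset.mul_sum]
  congr 1
  exact Finset.sum_congr rfl fun g _ => by rw [hr g]

theorem polyAverage_of_mem {f : PolyRing V} (hf : f ∈ polyInvariants ρ) :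
    polyAverage ρ f = f := by
  let _ := Fintype.ofFinite Γ
  rw [polyAverage_apply, Finset.sum_congr rfl fun g _ => hf g, Finset.sum_const,
    Finset.card_univ, ← Nat.card_eq_fintype_card, ← Nat.cast_smul_eq_nsmul ℂ, smul_smul,
    inv_mul_cancel₀ (Nat.cast_ne_zero.mpr Nat.card_pos.ne'), one_smul]

theorem polyAverage_mem_homogeneousPart {d : ℕ} {f : PolyRing V}
    (hf : f ∈ homogeneousPart V d) : polyAverage ρ f ∈ homogeneousPart V d := by
  let _ := Fintype.ofFinite Γ
  rw [polyAverage_apply]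
  exact Submodule.smul_mem _ _ (sum_mem fun g _ => polyAct_mem_homogeneousPart ρ g hf)

end Invariants

/-! ### Positive definite sesquilinear forms -/

section HermitianForms

open scoped ComplexConjugate

variable {F : Type*} [AddCommGroup F] [Module ℂ F]

/-- A positive definite hermitian form. -/
structure IsPosDefHermitian (B : F →ₗ⋆[ℂ] F →ₗ[ℂ] ℂ) : Prop where
  conj_symm : ∀ x y, conj (B y x) = B x y
  re_nonneg : ∀ x, 0 ≤ (B x x).re
  definite : ∀ x, B x x = 0 → x = 0

namespace IsPosDefHermitian

variable {B : F →ₗ⋆[ℂ] F →ₗ[ℂ] ℂ} (hB : IsPosDefHermitian B)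
include hB

/-- Packages the form as an inner product, so that orthonormal bases and orthogonal projections
become available locally. -/
theorem core : Nonempty {c : InnerProductSpace.Core ℂ F // ∀ x y, c.inner x y = B x y} :=
  ⟨{  inner := fun x y => B x y
      conj_inner_symm := hB.conj_symm
      re_inner_nonneg := hB.re_nonneg
      add_left := fun x y z => by simp
      smul_left := fun x y r => by simp
      definite := hB.definite }, fun _ _ => rfl⟩

theorem exists_orthonormal_basis [FiniteDimensional ℂ F] :
    ∃ b : Basis (Fin (finrank ℂ F)) ℂ F, ∀ x y, B x y = ∑ i, conj (b.repr x i) * b.repr y i := by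
  obtain ⟨c, hc⟩ := hB.core
  let := c.toNormedAddCommGroup
  let : InnerProductSpace ℂ F := InnerProductSpace.ofCore c.toCore
  refine ⟨(stdOrthonormalBasis ℂ F).toBasis, fun x y => ?_⟩
  rw [← hc]
  change inner ℂ x y = _
  rw [← (stdOrthonormalBasis ℂ F).sum_inner_mul_inner x y]
  refine Finset.sum_congr rfl fun i _ => ?_
  simp [OrthonormalBasis.repr_apply_apply]

theorem exists_orthogonal_projection (K : Submodule ℂ F) [FiniteDimensional ℂ K] (f : F) :
    ∃ a ∈ K, ∀ k ∈ K, B k (f - a) = 0 := by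
  obtain ⟨c, hc⟩ := hB.core
  let := c.toNormedAddCommGroup
  let : InnerProductSpace ℂ F := InnerProductSpace.ofCore c.toCore
  obtain ⟨y, hy, z, hz, rfl⟩ := K.exists_add_mem_mem_orthogonal f
  refine ⟨y, hy, fun k hk => ?_⟩
  rw [← hc, add_sub_cancel_left]
  exact hz k hk

end IsPosDefHermitian

/-- A representation of a finite group on a finite-dimensional space is unitary in a suitable
basis. -/
theorem exists_unitary_basis {Γ : Type*} [Group Γ] [Finite Γ] [FiniteDimensional ℂ F]
    (σ : Representation ℂ Γ F) :
    ∃ b : Basis (Fin (finrank ℂ F)) ℂ F, ∀ g x y,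
      ∑ i, conj (b.repr (σ g x) i) * b.repr (σ g y) i = ∑ i, conj (b.repr x i) * b.repr y i := by
  let _ := Fintype.ofFinite Γ
  let c := finBasis ℂ F
  -- Weyl's unitary trick: the standard hermitian form of an arbitrary basis, averaged over the
  -- group; an orthonormal basis of it is the required one.
  let B : F →ₗ⋆[ℂ] F →ₗ[ℂ] ℂ := LinearMap.mk₂'ₛₗ (starRingEnd ℂ) (RingHom.id ℂ)
    (fun x y => ∑ g, ∑ i, conj (c.repr (σ g x) i) * c.repr (σ g y) i)
    (fun x y z => by simp [add_mul, Finset.sum_add_distrib])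
    (fun r x y => by simp [mul_assoc, Finset.mul_sum])
    (fun x y z => by simp [mul_add, Finset.sum_add_distrib])
    (fun r x y => by simp [mul_left_comm, Finset.mul_sum])
  have hBa : ∀ x y, B x y = ∑ g, ∑ i, conj (c.repr (σ g x) i) * c.repr (σ g y) i :=
    fun x y => rfl
  have hre : ∀ x, B x x = ((∑ g, ∑ i, ‖c.repr (σ g x) i‖ ^ 2 : ℝ) : ℂ) := fun x => by
    rw [hBa]
    push_cast
    exact Finset.sum_congr rfl fun g _ => Finset.sum_congr rfl fun i _ => Complex.conj_mul' _
  have hB : IsPosDefHermitian B := by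
    refine ⟨fun x y => ?_, fun x => ?_, fun x hx => ?_⟩
    · simp [hBa, mul_comm]
    · rw [hre, Complex.ofReal_re]
      positivity
    · rw [hre, Complex.ofReal_eq_zero, Finset.sum_eq_zero_iff_of_nonneg
        (fun g _ => by positivity)] at hx
      have h1 := hx 1 (Finset.mem_univ _)
      rw [Finset.sum_eq_zero_iff_of_nonneg (fun i _ => by positivity)] at h1
      apply c.ext_elem
      intro i
      simpa using h1 i (Finset.mem_univ _)
  obtain ⟨b, hb⟩ := hB.exists_orthonormal_basis
  refine ⟨b, fun g x y => ?_⟩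
  rw [← hb, ← hb, hBa, hBa]
  refine Fintype.sum_equiv (Equiv.mulRight g) _ _ fun h => ?_
  rw [Equiv.coe_mulRight, map_mul]
  rfl

end HermitianForms

/-! ### The apolar form -/

section Apolar

open scoped ComplexConjugate

variable {ι : Type*} [Fintype ι]

/-- The product `α!` of the factorials of the exponents of a monomial. -/
def multiFactorial (α : ι →₀ ℕ) : ℕ := ∏ i, (α i).factorial

theorem multiFactorial_add_single (α : ι →₀ ℕ) (i : ι) :
    multiFactorial (α + Finsupp.single i 1) = (α i + 1) * multiFactorial α := by
  classical
  rw [multiFactorial, multiFactorial, ← Finset.mul_prod_erase _ _ (Finset.mem_univ i),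
    ← Finset.mul_prod_erase (a := i) _ _ (Finset.mem_univ i), ← mul_assoc]
  congr 1
  · simp [Nat.factorial_succ]
  · refine Finset.prod_congr rfl fun j hj => ?_
    simp [Finsupp.single_eq_of_ne (Finset.ne_of_mem_erase hj)]

/-- The value `∑ conj(f_α) h_α α!` of the apolar form at two polynomials. -/
def apolarSum (f h : MvPolynomial ι ℂ) : ℂ :=
  ∑ α ∈ h.support, conj (f.coeff α) * h.coeff α * multiFactorial α

theorem apolarSum_eq {f h : MvPolynomial ι ℂ} {T : Finset (ι →₀ ℕ)}
    (hT : f.support ⊆ T ∨ h.support ⊆ T) :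
    apolarSum f h = ∑ α ∈ T, conj (f.coeff α) * h.coeff α * multiFactorial α := by
  classical
  rw [apolarSum]
  trans ∑ α ∈ h.support ∩ T, conj (f.coeff α) * h.coeff α * multiFactorial α
  · refine (Finset.sum_subset Finset.inter_subset_left fun α hα hα' => ?_).symm
    have : f.coeff α = 0 := by
      by_contra hc
      rcases hT with hT | hT
      · exact hα' (Finset.mem_inter.mpr ⟨hα, hT (MvPolynomial.mem_support_iff.mpr hc)⟩)
      · exact hα' (Finset.mem_inter.mpr ⟨hα, hT hα⟩)
    simp [this]
  · refine Finset.sum_subset Finset.inter_subset_right fun α hα hα' => ?_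
    have : h.coeff α = 0 := by
      by_contra hc
      exact hα' (Finset.mem_inter.mpr ⟨MvPolynomial.mem_support_iff.mpr hc, hα⟩)
    simp [this]

/-- The apolar form on polynomials, for which the monomials are orthogonal. -/
def apolarForm : MvPolynomial ι ℂ →ₗ⋆[ℂ] MvPolynomial ι ℂ →ₗ[ℂ] ℂ :=
  LinearMap.mk₂'ₛₗ (starRingEnd ℂ) (RingHom.id ℂ) apolarSum
    (fun f g h => by simp [apolarSum, add_mul, Finset.sum_add_distrib])
    (fun c f h => by simp [apolarSum, Finset.mul_sum, mul_assoc])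
    (fun f g h => by
      classical
      -- The support of the second argument varies with it, so all three sums are moved to the
      -- support of f.
      rw [apolarSum_eq (f := f) (h := g + h) (T := f.support) (Or.inl subset_rfl),
        apolarSum_eq (f := f) (h := g) (T := f.support) (Or.inl subset_rfl),
        apolarSum_eq (f := f) (h := h) (T := f.support) (Or.inl subset_rfl),
        ← Finset.sum_add_distrib]
      exact Finset.sum_congr rfl fun α _ => by rw [MvPolynomial.coeff_add]; ring)
    (fun c f h => by
      rw [apolarSum_eq (f := f) (h := c • h) (T := f.support) (Or.inl subset_rfl),
        apolarSum_eq (f := f) (h := h) (T := f.support) (Or.inl subset_rfl),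
        RingHom.id_apply, smul_eq_mul, Finset.mul_sum]
      exact Finset.sum_congr rfl fun α _ => by
        rw [MvPolynomial.coeff_smul, smul_eq_mul]; ring)

theorem apolarForm_apply (f h : MvPolynomial ι ℂ) :
    apolarForm f h = ∑ α ∈ h.support, conj (f.coeff α) * h.coeff α * multiFactorial α := rfl

theorem apolarForm_eq {f h : MvPolynomial ι ℂ} {T : Finset (ι →₀ ℕ)}
    (hT : f.support ⊆ T ∨ h.support ⊆ T) :
    apolarForm f h = ∑ α ∈ T, conj (f.coeff α) * h.coeff α * multiFactorial α :=
  apolarSum_eq hT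

theorem apolarForm_isPosDefHermitian : IsPosDefHermitian (apolarForm (ι := ι)) := by
  have hre : ∀ f : MvPolynomial ι ℂ, apolarForm f f =
      ((∑ α ∈ f.support, ‖f.coeff α‖ ^ 2 * multiFactorial α : ℝ) : ℂ) := fun f => by
    rw [apolarForm_apply]
    push_cast
    exact Finset.sum_congr rfl fun α _ => by rw [Complex.conj_mul']
  refine ⟨fun f h => ?_, fun f => ?_, fun f hf => ?_⟩
  · rw [apolarForm_apply, apolarForm_eq (T := f.support) (Or.inl subset_rfl), map_sum]
    refine Finset.sum_congr rfl fun α _ => ?_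
    rw [map_mul, map_mul, Complex.conj_conj, Complex.conj_natCast, mul_comm (h.coeff α)]
  · rw [hre, Complex.ofReal_re]
    positivity
  · rw [hre, Complex.ofReal_eq_zero,
      Finset.sum_eq_zero_iff_of_nonneg (fun α _ => by positivity)] at hf
    ext α
    by_cases hα : α ∈ f.support
    · have h1 : (multiFactorial α : ℝ) ≠ 0 := by
        rw [multiFactorial]
        exact_mod_cast (Finset.prod_pos fun i _ => Nat.factorial_pos _).ne'
      simpa [h1] using hf α hα
    · simpa using hα

theorem apolarForm_monomial (α : ι →₀ ℕ) (a : ℂ) (h : MvPolynomial ι ℂ) :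
    apolarForm (MvPolynomial.monomial α a) h = conj a * h.coeff α * multiFactorial α := by
  classical
  rw [apolarForm_eq (T := {α}) (Or.inl MvPolynomial.support_monomial_subset)]
  simp

/-- The weight α! is chosen for this adjunction: raising α_i by one multiplies α! by α_i + 1, which
is the factor produced by differentiation. -/
theorem apolarForm_X_mul (i : ι) (f h : MvPolynomial ι ℂ) :
    apolarForm (MvPolynomial.X i * f) h = apolarForm f (MvPolynomial.pderiv i h) := by
  induction f using MvPolynomial.induction_on' with
  | monomial α a =>
    have hX : MvPolynomial.X i * MvPolynomial.monomial α a =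
        MvPolynomial.monomial (α + Finsupp.single i 1) a := by
      rw [MvPolynomial.X, MvPolynomial.monomial_mul, one_mul, add_comm]
    rw [hX, apolarForm_monomial, apolarForm_monomial, MvPolynomial.coeff_pderiv,
      multiFactorial_add_single]
    push_cast
    ring
  | add p q hp hq =>
    rw [mul_add, map_add, map_add, LinearMap.add_apply, LinearMap.add_apply, hp, hq]

theorem apolarForm_homogeneous (f : MvPolynomial ι ℂ) {d : ℕ} {h : MvPolynomial ι ℂ}
    (hh : h.IsHomogeneous d) :
    apolarForm (MvPolynomial.homogeneousComponent d f) h = apolarForm f h := by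
  rw [apolarForm_apply, apolarForm_apply]
  refine Finset.sum_congr rfl fun α hα => ?_
  rw [MvPolynomial.coeff_homogeneousComponent, if_pos]
  by_contra hc
  exact MvPolynomial.mem_support_iff.mp hα (hh.coeff_eq_zero hc)

end Apolar

/-! ### Harmonic polynomials and the Hilbert ideal -/

section DirDeriv

variable {V : Type*} [AddCommGroup V] [Module ℂ V]

theorem dirDeriv_add (v w : V) (f : PolyRing V) :
    dirDeriv (v + w) f = dirDeriv v f + dirDeriv w f := by
  induction f using SymmetricAlgebra.induction with
  | algebraMap r => simp
  | ι ξ => simp [dirDeriv_ι]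
  | mul x y hx hy => simp only [Derivation.leibniz, hx, hy, smul_add]; abel
  | add x y hx hy => simp only [map_add, hx, hy]; abel

theorem dirDeriv_smul (c : ℂ) (v : V) (f : PolyRing V) :
    dirDeriv (c • v) f = c • dirDeriv v f := by
  induction f using SymmetricAlgebra.induction with
  | algebraMap r => simp
  | ι ξ => simp [dirDeriv_ι, Algebra.smul_def]
  | mul x y hx hy => simp only [Derivation.leibniz, hx, hy, smul_add, smul_comm c]
  | add x y hx hy => simp only [map_add, hx, hy, smul_add]

/-- Directional derivatives as a linear function of the direction. -/
def dirDerivLin (f : PolyRing V) : V →ₗ[ℂ] PolyRing V where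
  toFun v := dirDeriv v f
  map_add' v w := dirDeriv_add v w f
  map_smul' c v := dirDeriv_smul c v f

end DirDeriv

/-! ### The apolar form on S(V*), adjoint operators, and harmonics as an orthogonal complement -/

section UnitaryBasis

open scoped ComplexConjugate

variable {Γ : Type*} [Group Γ] {V : Type*} [AddCommGroup V] [Module ℂ V]
  [FiniteDimensional ℂ V] (ρ : Representation ℂ Γ V)
  {ι : Type*} [Fintype ι] (b : Basis ι ℂ (Dual ℂ V))

/-- The basis of `V` dual to a basis of `V*`. -/
def predualVector (i : ι) : V := (evalEquiv ℂ V).symm (b.coord i)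

omit [Fintype ι] in
theorem apply_predualVector (i : ι) (ξ : Dual ℂ V) : ξ (predualVector b i) = b.repr ξ i := by
  rw [predualVector, Module.apply_evalEquiv_symm_apply, Basis.coord_apply]

/-- The vector of `V` representing the linear form `ξ` for the hermitian form on `V*` in which
the basis `b` is orthonormal. -/
def rieszVector (ξ : Dual ℂ V) : V := ∑ i, conj (b.repr ξ i) • predualVector b i

theorem apply_rieszVector (ξ η : Dual ℂ V) :
    η (rieszVector b ξ) = ∑ i, conj (b.repr ξ i) * b.repr η i := by
  simp [rieszVector, apply_predualVector]

theorem rieszVector_surjective (v : V) : ∃ ξ, rieszVector b ξ = v := by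
  refine ⟨∑ i, conj (b i v) • b i, ?_⟩
  apply (evalEquiv ℂ V).injective
  ext η
  change η _ = η v
  rw [apply_rieszVector]
  simp_rw [b.repr_sum_self, Complex.conj_conj]
  conv_rhs => rw [← b.sum_repr η]
  rw [LinearMap.sum_apply]
  exact Finset.sum_congr rfl fun i _ => mul_comm _ _

/-- The basis `b` of `V*` is one in which the group acts by unitary matrices. -/
def IsUnitaryBasis : Prop := ∀ g x y,
  ∑ i, conj (b.repr (ρ.dual g x) i) * b.repr (ρ.dual g y) i = ∑ i, conj (b.repr x i) * b.repr y i

variable {ρ b} in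
-- The Riesz vector is determined by its pairing with linear forms, and that pairing is the
-- hermitian form preserved by the group.
theorem IsUnitaryBasis.rieszVector_dual (hb : IsUnitaryBasis ρ b) (g : Γ) (ξ : Dual ℂ V) :
    rieszVector b (ρ.dual g ξ) = ρ g (rieszVector b ξ) := by
  apply (evalEquiv ℂ V).injective
  ext η
  have h1 : η (ρ g (rieszVector b ξ)) = ρ.dual g⁻¹ η (rieszVector b ξ) := by
    simp [Dual.transpose_apply]
  have h2 : ρ.dual g (ρ.dual g⁻¹ η) = η := by
    rw [← Module.End.mul_apply, ← map_mul, mul_inv_cancel, map_one, Module.End.one_apply]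
  change η _ = η _
  rw [h1, apply_rieszVector, apply_rieszVector, ← hb g ξ, h2]

/-- The apolar form on `S(V*)` attached to a basis of `V*`. -/
def polyForm : PolyRing V →ₗ⋆[ℂ] PolyRing V →ₗ[ℂ] ℂ :=
  LinearMap.mk₂'ₛₗ (starRingEnd ℂ) (RingHom.id ℂ)
    (fun f h => apolarForm (SymmetricAlgebra.equivMvPolynomial b f)
      (SymmetricAlgebra.equivMvPolynomial b h))
    (fun f g h => by rw [map_add, map_add, LinearMap.add_apply])
    (fun c f h => by rw [map_smul, map_smulₛₗ, LinearMap.smul_apply])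
    (fun f g h => by rw [map_add, map_add])
    (fun c f h => by rw [map_smul, map_smul, RingHom.id_apply])

omit [FiniteDimensional ℂ V] in
theorem polyForm_apply (f h : PolyRing V) : polyForm b f h =
    apolarForm (SymmetricAlgebra.equivMvPolynomial b f)
      (SymmetricAlgebra.equivMvPolynomial b h) := rfl

omit [FiniteDimensional ℂ V] in
theorem polyForm_isPosDefHermitian : IsPosDefHermitian (polyForm b) where
  conj_symm x y := apolarForm_isPosDefHermitian.conj_symm _ _
  re_nonneg x := apolarForm_isPosDefHermitian.re_nonneg _
  definite x hx := by
    have := apolarForm_isPosDefHermitian.definite _ hx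
    simpa using this

omit [FiniteDimensional ℂ V] in
-- Polynomials of different degrees are orthogonal, having no monomial in common.
theorem polyForm_homComp (f : PolyRing V) {d : ℕ} {h : PolyRing V}
    (hh : h ∈ homogeneousPart V d) : polyForm b (homComp d f) h = polyForm b f h := by
  rw [homogeneousPart_eq_comap b] at hh
  replace hh : (SymmetricAlgebra.equivMvPolynomial b h).IsHomogeneous d := hh
  obtain ⟨n, hn⟩ := exists_sum_homComp f
  have key : ∀ i, polyForm b (homComp i f) h =
      if i = d then polyForm b (homComp d f) h else 0 := fun i => by
    split_ifs with hi
    · rw [hi]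
    · have hm := homComp_mem i f
      rw [homogeneousPart_eq_comap b] at hm
      replace hm : SymmetricAlgebra.equivMvPolynomial b (homComp i f) ∈
        MvPolynomial.homogeneousSubmodule ι ℂ i := hm
      rw [polyForm_apply, ← apolarForm_homogeneous _ hh,
        MvPolynomial.homogeneousComponent_of_mem hm, if_neg (Ne.symm hi), map_zero,
        LinearMap.zero_apply]
  by_cases hd : d < n
  · conv_rhs => rw [hn]
    rw [map_sum, LinearMap.sum_apply, Finset.sum_congr rfl fun i _ => key i,
      Finset.sum_ite_eq' (Finset.range n), if_pos (Finset.mem_range.mpr hd)]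
  · have h0 : homComp d f = 0 := by
      rw [hn, map_sum]
      exact Finset.sum_eq_zero fun i hi => homComp_ne (homComp_mem i f) (by
        have := Finset.mem_range.mp hi
        omega)
    conv_rhs => rw [hn]
    rw [map_sum, LinearMap.sum_apply, Finset.sum_congr rfl fun i _ => key i,
      Finset.sum_ite_eq' (Finset.range n), if_neg (by simpa using hd), h0]
    simp

theorem equivMvPolynomial_dirDeriv (i : ι) (f : PolyRing V) :
    SymmetricAlgebra.equivMvPolynomial b (dirDeriv (predualVector b i) f) =
      MvPolynomial.pderiv i (SymmetricAlgebra.equivMvPolynomial b f) := by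
  classical
  induction f using SymmetricAlgebra.induction with
  | algebraMap r => simp
  | ι ξ =>
    rw [dirDeriv_ι, apply_predualVector, AlgEquiv.commutes]
    conv_rhs => rw [← b.sum_repr ξ]
    simp only [map_sum, map_smul, Derivation.map_smul,
      SymmetricAlgebra.equivMvPolynomial_ι_apply,
      MvPolynomial.pderiv_X, Pi.single_apply, smul_ite, smul_zero]
    rw [Finset.sum_ite_eq' Finset.univ, if_pos (Finset.mem_univ i),
      Algebra.algebraMap_eq_smul_one]
  | mul x y hx hy => simp [Derivation.leibniz, hx, hy]
  | add x y hx hy => simp [hx, hy]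

/-- By semilinearity this reduces to the coordinates of the basis, where it is the adjunction of X_i
and the i-th partial derivative. The conjugates in `rieszVector` match the conjugate-linear first
slot of the form. -/
theorem polyForm_ι_mul (ξ : Dual ℂ V) (f h : PolyRing V) :
    polyForm b (SymmetricAlgebra.ι ℂ (Dual ℂ V) ξ * f) h =
      polyForm b f (dirDeriv (rieszVector b ξ) h) := by
  have h1 : dirDeriv (rieszVector b ξ) h =
      ∑ i, conj (b.repr ξ i) • dirDeriv (predualVector b i) h := by
    change dirDerivLin h (rieszVector b ξ) = _
    rw [rieszVector, map_sum]
    exact Finset.sum_congr rfl fun i _ => map_smul _ _ _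
  have h2 : SymmetricAlgebra.ι ℂ (Dual ℂ V) ξ =
      ∑ i, b.repr ξ i • SymmetricAlgebra.ι ℂ (Dual ℂ V) (b i) := by
    conv_lhs => rw [← b.sum_repr ξ]
    simp only [map_sum, map_smul]
  rw [h1, h2, Finset.sum_mul, map_sum, map_sum, LinearMap.sum_apply]
  refine Finset.sum_congr rfl fun i _ => ?_
  rw [smul_mul_assoc, map_smulₛₗ, LinearMap.smul_apply, map_smul, polyForm_apply, polyForm_apply,
    map_mul, SymmetricAlgebra.equivMvPolynomial_ι_apply, apolarForm_X_mul,
    equivMvPolynomial_dirDeriv]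

omit [FiniteDimensional ℂ V] in
theorem polyForm_one_right (f : PolyRing V) :
    polyForm b f 1 = conj (constTerm f) * polyForm b 1 1 := by
  rw [← polyForm_homComp b f one_mem_homogeneousPart, homComp_zero_eq,
    Algebra.algebraMap_eq_smul_one, map_smulₛₗ, LinearMap.smul_apply, smul_eq_mul]

omit [FiniteDimensional ℂ V] in
theorem polyForm_one_one_ne_zero : polyForm b (1 : PolyRing V) 1 ≠ 0 := fun h =>
  one_ne_zero ((polyForm_isPosDefHermitian b).definite 1 h)

variable {ρ b} in
-- Invariance of the form, set up for induction on f: the extra factor k carries the invariance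
-- already obtained, so that products are treated one factor at a time. Taking k = 1 gives
-- invariance in general.
theorem polyForm_mul_polyAct (hb : IsUnitaryBasis ρ b) (g : Γ) (f k : PolyRing V)
    (hk : ∀ h, polyForm b (polyAct ρ g k) (polyAct ρ g h) = polyForm b k h) (h : PolyRing V) :
    polyForm b (polyAct ρ g (f * k)) (polyAct ρ g h) = polyForm b (f * k) h := by
  induction f using SymmetricAlgebra.induction generalizing k h with
  | algebraMap r =>
    rw [← Algebra.smul_def, map_smul, map_smulₛₗ, map_smulₛₗ, LinearMap.smul_apply,
      LinearMap.smul_apply, hk]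
  | ι ξ =>
    have h1 := conj_dirDeriv ρ g (rieszVector b ξ) (polyAct ρ g h)
    rw [polyRep_apply, polyRep_apply, polyAct_inv_self] at h1
    rw [map_mul, polyAct_ι, polyForm_ι_mul, hb.rieszVector_dual, ← h1, hk, polyForm_ι_mul]
  | mul x y hx hy =>
    rw [mul_assoc]
    exact hx _ (hy _ hk) h
  | add x y hx hy =>
    rw [add_mul, map_add, map_add, map_add, LinearMap.add_apply, LinearMap.add_apply, hx _ hk,
      hy _ hk]

variable {ρ b} in
theorem IsUnitaryBasis.polyForm_polyAct (hb : IsUnitaryBasis ρ b) (g : Γ) (f h : PolyRing V) :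
    polyForm b (polyAct ρ g f) (polyAct ρ g h) = polyForm b f h := by
  rw [← mul_one f]
  refine polyForm_mul_polyAct hb g f 1 (fun h => ?_) h
  rw [map_one, ← (polyForm_isPosDefHermitian b).conj_symm, polyForm_one_right,
    constTerm_polyAct, ← polyForm_one_right, (polyForm_isPosDefHermitian b).conj_symm]

/-- `D` is the adjoint of multiplication by `f` for the apolar form. -/
def IsAdjointOp (f : PolyRing V) (D : Module.End ℂ (PolyRing V)) : Prop :=
  ∀ k h, polyForm b (f * k) h = polyForm b k (D h)

omit [FiniteDimensional ℂ V] in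
theorem polyForm_separating {f f' : PolyRing V}
    (h : ∀ k, polyForm b k f = polyForm b k f') : f = f' := by
  rw [← sub_eq_zero]
  apply (polyForm_isPosDefHermitian b).definite
  rw [map_sub (polyForm b (f - f')), h, sub_self]

variable {b}

/-- With `exists_isAdjointOp_of_mem`, this matches polynomials with constant-coefficient operators.
It holds on generators, since linear forms are adjoint to directional derivatives, and adjoints
compose. -/
theorem exists_adjointOp (f : PolyRing V) : ∃ D ∈ diffOps V, IsAdjointOp b f D := by
  induction f using SymmetricAlgebra.induction with
  | algebraMap r =>
    refine ⟨conj r • 1, Subalgebra.smul_mem _ (one_mem _) _, fun k h => ?_⟩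
    rw [← Algebra.smul_def, map_smulₛₗ, LinearMap.smul_apply, LinearMap.smul_apply, map_smul,
      Module.End.one_apply]
  | ι ξ => exact ⟨_, Algebra.subset_adjoin ⟨rieszVector b ξ, rfl⟩, polyForm_ι_mul b ξ⟩
  | mul x y hx hy =>
    obtain ⟨D, hD, h1⟩ := hx
    obtain ⟨D', hD', h2⟩ := hy
    refine ⟨D' * D, mul_mem hD' hD, fun k h => ?_⟩
    rw [mul_assoc, h1, h2]
    rfl
  | add x y hx hy =>
    obtain ⟨D, hD, h1⟩ := hx
    obtain ⟨D', hD', h2⟩ := hy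
    refine ⟨D + D', add_mem hD hD', fun k h => ?_⟩
    rw [add_mul, map_add, LinearMap.add_apply, h1, h2, LinearMap.add_apply, map_add]

theorem exists_isAdjointOp_of_mem {D : Module.End ℂ (PolyRing V)} (hD : D ∈ diffOps V) :
    ∃ f, IsAdjointOp b f D := by
  induction hD using Algebra.adjoin_induction with
  | mem x hx =>
    obtain ⟨v, rfl⟩ := hx
    obtain ⟨ξ, rfl⟩ := rieszVector_surjective b v
    exact ⟨_, polyForm_ι_mul b ξ⟩
  | algebraMap r =>
    refine ⟨algebraMap ℂ _ (conj r), fun k h => ?_⟩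
    rw [← Algebra.smul_def, map_smulₛₗ, LinearMap.smul_apply, Complex.conj_conj,
      Module.algebraMap_end_apply, map_smul]
  | add x y _ _ hx hy =>
    obtain ⟨f, hf⟩ := hx
    obtain ⟨f', hf'⟩ := hy
    refine ⟨f + f', fun k h => ?_⟩
    rw [add_mul, map_add, LinearMap.add_apply, hf, hf', LinearMap.add_apply, map_add]
  | mul x y _ _ hx hy =>
    obtain ⟨f, hf⟩ := hx
    obtain ⟨f', hf'⟩ := hy
    refine ⟨f' * f, fun k h => ?_⟩
    rw [mul_assoc, hf', hf]
    rfl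

namespace IsAdjointOp

variable {f f' : PolyRing V} {D D' : Module.End ℂ (PolyRing V)}

omit [FiniteDimensional ℂ V] in
theorem op_unique (h : IsAdjointOp b f D) (h' : IsAdjointOp b f D') : D = D' :=
  LinearMap.ext fun x => polyForm_separating b fun k => by rw [← h, ← h']

omit [FiniteDimensional ℂ V] in
theorem poly_unique (h : IsAdjointOp b f D) (h' : IsAdjointOp b f' D) : f = f' :=
  polyForm_separating b fun k => by
    rw [← (polyForm_isPosDefHermitian b).conj_symm, ← mul_one f, h, ← h', mul_one,
      (polyForm_isPosDefHermitian b).conj_symm]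

variable {ρ} in
theorem conjugate (hb : IsUnitaryBasis ρ b) (h : IsAdjointOp b f D) (g : Γ) :
    IsAdjointOp b (polyAct ρ g f) (polyRep ρ g * D * polyRep ρ g⁻¹) := fun k x => by
  have h1 : polyAct ρ g f * k = polyAct ρ g (f * polyAct ρ g⁻¹ k) := by
    rw [map_mul, polyAct_self_inv]
  have h2 : x = polyAct ρ g (polyAct ρ g⁻¹ x) := (polyAct_self_inv ρ g x).symm
  have h3 : polyForm b k (polyAct ρ g (D (polyAct ρ g⁻¹ x))) =
      polyForm b (polyAct ρ g⁻¹ k) (D (polyAct ρ g⁻¹ x)) := by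
    rw [← hb.polyForm_polyAct g (polyAct ρ g⁻¹ k), polyAct_self_inv]
  rw [h1]
  conv_lhs => rw [h2]
  rw [hb.polyForm_polyAct, h]
  exact h3.symm

omit [FiniteDimensional ℂ V] in
theorem apply_one_eq_zero_iff (h : IsAdjointOp b f D) : D 1 = 0 ↔ constTerm f = 0 := by
  constructor
  · intro h1
    have h2 := h 1 1
    rw [h1, map_zero, mul_one, polyForm_one_right] at h2
    simpa [polyForm_one_one_ne_zero] using h2
  · intro h1
    refine polyForm_separating b fun k => ?_
    rw [← h, polyForm_one_right, map_mul, h1]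
    simp

variable {ρ} in
-- Conjugating D by g gives the adjoint of g f, and the operator and the polynomial determine each
-- other.
theorem commutes_iff (hb : IsUnitaryBasis ρ b) (h : IsAdjointOp b f D) :
    (∀ g, D * polyRep ρ g = polyRep ρ g * D) ↔ f ∈ polyInvariants ρ := by
  have hinv : ∀ g, polyRep ρ g⁻¹ * polyRep ρ g = 1 := fun g => by
    rw [← map_mul, inv_mul_cancel, map_one]
  have hinv' : ∀ g, polyRep ρ g * polyRep ρ g⁻¹ = 1 := fun g => by
    rw [← map_mul, mul_inv_cancel, map_one]
  constructor
  · intro hD g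
    refine poly_unique (h.conjugate hb g) ?_
    rwa [← hD, mul_assoc, hinv', mul_one]
  · intro hf g
    have h1 := h.conjugate hb g
    rw [hf g] at h1
    conv_lhs => rw [op_unique h h1]
    rw [mul_assoc, hinv, mul_one]

end IsAdjointOp

variable {ρ} in
-- Invariant operators without constant term are exactly the adjoints of invariants r without
-- constant term. For such an adjoint D, D h = 0 says that h is orthogonal to every multiple of r.
theorem mem_harmonics_iff (hb : IsUnitaryBasis ρ b) {h : PolyRing V} :
    h ∈ harmonics ρ ↔ ∀ k ∈ hilbertIdeal ρ, polyForm b k h = 0 := by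
  constructor
  · intro hh k hk
    -- Quantifying over a multiplier c lets the span induction absorb the ideal coefficients.
    suffices ∀ c, polyForm b (c * k) h = 0 by simpa using this 1
    induction hk using Submodule.span_induction with
    | mem r hr =>
      intro c
      obtain ⟨D, hD, hrD⟩ := exists_adjointOp (b := b) r
      rw [mul_comm, hrD, hh D hD ((hrD.commutes_iff hb).mpr hr.1)
        (hrD.apply_one_eq_zero_iff.mpr hr.2), map_zero]
    | zero => simp
    | add x y _ _ hx hy =>
      intro c
      rw [mul_add, map_add, LinearMap.add_apply, hx, hy, add_zero]
    | smul a x hx ih =>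
      intro c
      rw [smul_eq_mul, ← mul_assoc]
      exact ih _
  · intro hh D hD hinv hone
    obtain ⟨f, hf⟩ := exists_isAdjointOp_of_mem (b := b) hD
    have hfI : f ∈ hilbertIdeal ρ := mem_hilbertIdeal_of_mem
      ((hf.commutes_iff hb).mp hinv) (hf.apply_one_eq_zero_iff.mp hone)
    refine polyForm_separating b fun k => ?_
    rw [← hf, map_zero]
    exact hh _ (Ideal.mul_mem_right _ _ hfI)

end UnitaryBasis

/-! ### Harmonics as a graded complement of the Hilbert ideal -/

section HarmonicDecomposition

variable {Γ : Type*} [Group Γ] [Finite Γ] {V : Type*} [AddCommGroup V] [Module ℂ V]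
  [FiniteDimensional ℂ V] (ρ : Representation ℂ Γ V)

theorem exists_isUnitaryBasis :
    ∃ b : Basis (Fin (finrank ℂ (Dual ℂ V))) ℂ (Dual ℂ V), IsUnitaryBasis ρ b :=
  exists_unitary_basis ρ.dual

variable {ρ} in
theorem eq_zero_of_mem_harmonics_of_mem_hilbertIdeal {f : PolyRing V} (h : f ∈ harmonics ρ)
    (h' : f ∈ hilbertIdeal ρ) : f = 0 := by
  obtain ⟨b, hb⟩ := exists_isUnitaryBasis ρ
  exact (polyForm_isPosDefHermitian b).definite f ((mem_harmonics_iff hb).mp h f h')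

/-- The projection is made onto the degree d part of the Hilbert ideal, which is finite-dimensional.
The remainder is homogeneous of degree d, so being orthogonal to that part it is orthogonal to the
whole ideal. -/
theorem exists_harmonicPart_sub_mem {d : ℕ} {f : PolyRing V} (hf : f ∈ homogeneousPart V d) :
    ∃ c ∈ harmonicPart ρ d, f - c ∈ hilbertIdeal ρ := by
  obtain ⟨b, hb⟩ := exists_isUnitaryBasis ρ
  let K : Submodule ℂ (PolyRing V) := (hilbertIdeal ρ).restrictScalars ℂ ⊓ homogeneousPart V d
  have : FiniteDimensional ℂ K :=
    Submodule.finiteDimensional_of_le (inf_le_right : K ≤ homogeneousPart V d)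
  obtain ⟨a, ha, hK⟩ := (polyForm_isPosDefHermitian b).exists_orthogonal_projection K f
  have hfa : f - a ∈ homogeneousPart V d := Submodule.sub_mem _ hf ha.2
  refine ⟨f - a, ⟨(mem_harmonics_iff hb).mpr fun k hk => ?_, hfa⟩, ?_⟩
  · rw [← polyForm_homComp b k hfa]
    exact hK _ ⟨homComp_mem_hilbertIdeal ρ hk d, homComp_mem d k⟩
  · rw [sub_sub_cancel]
    exact ha.1

theorem exists_harmonics_sub_mem (f : PolyRing V) :
    ∃ c : ℕ → PolyRing V, (∀ d, c d ∈ harmonicPart ρ d) ∧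
      ∃ n, f - ∑ d ∈ Finset.range n, c d ∈ hilbertIdeal ρ := by
  choose c hc hc' using fun d => exists_harmonicPart_sub_mem ρ (homComp_mem d f)
  obtain ⟨n, hn⟩ := exists_sum_homComp f
  refine ⟨c, hc, n, ?_⟩
  have h1 : f - ∑ d ∈ Finset.range n, c d = ∑ d ∈ Finset.range n, (homComp d f - c d) := by
    rw [Finset.sum_sub_distrib, ← hn]
  rw [h1]
  exact sum_mem fun d _ => hc' d

theorem exists_sum_harmonicPart {f : PolyRing V} (hf : f ∈ harmonics ρ) :
    ∃ c : ℕ → PolyRing V, (∀ d, c d ∈ harmonicPart ρ d) ∧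
      ∃ n, f = ∑ d ∈ Finset.range n, c d := by
  obtain ⟨c, hc, n, hn⟩ := exists_harmonics_sub_mem ρ f
  refine ⟨c, hc, n, ?_⟩
  rw [← sub_eq_zero]
  refine eq_zero_of_mem_harmonics_of_mem_hilbertIdeal (ρ := ρ) ?_ hn
  exact Submodule.sub_mem _ hf (Submodule.sum_mem _ fun d _ => (hc d).1)

variable {ρ} in
theorem homComp_mem_harmonics {f : PolyRing V} (hf : f ∈ harmonics ρ) (e : ℕ) :
    homComp e f ∈ harmonics ρ := by
  obtain ⟨c, hc, n, rfl⟩ := exists_sum_harmonicPart ρ hf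
  rw [map_sum]
  refine Submodule.sum_mem _ fun d _ => ?_
  rw [homComp_of_mem (hc d).2]
  split_ifs
  · exact (hc d).1
  · exact Submodule.zero_mem _

/-- Graded Nakayama: modulo the Hilbert ideal every polynomial is harmonic, and in degree d that
ideal consists of sums of s r with r an invariant of positive degree, so that s has smaller degree.
-/
theorem span_harmonics :
    Submodule.span (polyInvariants ρ) (harmonics ρ : Set (PolyRing V)) = ⊤ := by
  have key : ∀ d, ∀ f ∈ homogeneousPart V d,
      f ∈ Submodule.span (polyInvariants ρ) (harmonics ρ : Set (PolyRing V)) := by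
    intro d
    induction d using Nat.strong_induction_on with
    | _ d ih =>
      intro f hf
      obtain ⟨c, hc, hfc⟩ := exists_harmonicPart_sub_mem ρ hf
      suffices ∀ a ∈ hilbertIdeal ρ, homComp d a ∈
          Submodule.span (polyInvariants ρ) (harmonics ρ : Set (PolyRing V)) by
        have h1 := add_mem (this _ hfc) (Submodule.subset_span hc.1)
        rwa [homComp_self (Submodule.sub_mem _ hf hc.2), sub_add_cancel] at h1
      intro a ha
      -- The multiplier s absorbs ideal coefficients; taking degree d components restores the
      -- grading that span induction forgets.
      suffices ∀ s, homComp d (s * a) ∈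
          Submodule.span (polyInvariants ρ) (harmonics ρ : Set (PolyRing V)) by
        simpa using this 1
      induction ha using Submodule.span_induction with
      | mem r hr =>
        intro s
        obtain ⟨n, hn⟩ := exists_sum_homComp r
        rw [hn, Finset.mul_sum, map_sum]
        refine sum_mem fun j _ => ?_
        rw [mul_comm]
        rcases lt_or_ge d j with h | h
        · rw [homComp_mul_of_lt (homComp_mem j r) _ h]; exact zero_mem _
        · obtain ⟨e, rfl⟩ := Nat.exists_eq_add_of_le h
          rw [homComp_mul (homComp_mem j r)]
          rcases Nat.eq_zero_or_pos j with rfl | hj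
          · rw [homComp_zero_eq, hr.2, map_zero, zero_mul]; exact zero_mem _
          · exact Submodule.smul_mem _
              (⟨homComp j r, homComp_mem_polyInvariants ρ hr.1 j⟩ : polyInvariants ρ)
              (ih e (by omega) _ (homComp_mem e s))
      | zero => simp
      | add x y _ _ hx hy =>
        intro s
        rw [mul_add, map_add]
        exact add_mem (hx s) (hy s)
      | smul b x _ hx =>
        intro s
        rw [smul_eq_mul, ← mul_assoc]
        exact hx _
  rw [eq_top_iff]
  intro f _
  obtain ⟨n, hn⟩ := exists_sum_homComp f
  rw [hn]
  exact sum_mem fun d _ => key d _ (homComp_mem d f)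

end HarmonicDecomposition

/-! ### Freeness over the invariants of a reflection group -/

section Chevalley

variable {Γ : Type*} [Group Γ] {V : Type*} [AddCommGroup V] [Module ℂ V]
  (ρ : Representation ℂ Γ V)

/-- `g` fixes pointwise the kernel of some nonzero linear form. -/
def FixesHyperplane (g : Γ) : Prop :=
  ∃ l : Dual ℂ V, l ≠ 0 ∧ ∀ ξ, ∃ c : ℂ, ρ.dual g ξ = ξ + c • l

/-- The group is generated by elements that fix a hyperplane pointwise. -/
def GeneratedByReflections : Prop := Subgroup.closure {g | FixesHyperplane ρ g} = ⊤

variable {ρ}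

/-- True for linear forms by hypothesis, and the property is stable under sums and products: the
group acts trivially modulo l. -/
theorem exists_polyAct_sub_eq_mul {g : Γ} {l : Dual ℂ V}
    (hl : ∀ ξ, ∃ c : ℂ, ρ.dual g ξ = ξ + c • l) (f : PolyRing V) :
    ∃ q, polyAct ρ g f = f + SymmetricAlgebra.ι ℂ (Dual ℂ V) l * q := by
  induction f using SymmetricAlgebra.induction with
  | algebraMap r => exact ⟨0, by simp⟩
  | ι ξ =>
    obtain ⟨c, hc⟩ := hl ξ
    refine ⟨algebraMap ℂ _ c, ?_⟩
    rw [polyAct_ι, hc, map_add, map_smul, Algebra.smul_def, mul_comm]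
  | mul x y hx hy =>
    obtain ⟨q, hq⟩ := hx
    obtain ⟨q', hq'⟩ := hy
    refine ⟨q * y + x * q' + SymmetricAlgebra.ι ℂ (Dual ℂ V) l * (q * q'), ?_⟩
    rw [map_mul, hq, hq']
    ring
  | add x y hx hy =>
    obtain ⟨q, hq⟩ := hx
    obtain ⟨q', hq'⟩ := hy
    refine ⟨q + q', ?_⟩
    rw [map_add, hq, hq']
    ring

theorem ι_ne_zero {l : Dual ℂ V} (hl : l ≠ 0) : SymmetricAlgebra.ι ℂ (Dual ℂ V) l ≠ 0 := by
  intro h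
  obtain ⟨v, hv⟩ : ∃ v, l v ≠ 0 := by
    by_contra! hc
    exact hl (LinearMap.ext hc)
  have := dirDeriv_ι v l
  rw [h, map_zero] at this
  exact hv ((SymmetricAlgebra.algebraMap_eq_zero_iff (R := ℂ) (Dual ℂ V) _).mp this.symm)

variable [Finite Γ]

/-- Chevalley's lemma, by induction on the degree of p₀. For a reflection g with linear form l, the
quotients (g p - p)/l satisfy the same relation in one degree less, so p₀ is fixed by each
reflection, hence by the group, modulo the Hilbert ideal. Only p₀ has to be homogeneous. -/
theorem mem_hilbertIdeal_of_relation (hρ : GeneratedByReflections ρ) {κ : Type*} [Fintype κ]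
    {r₀ : PolyRing V} {r : κ → PolyRing V} (hr₀ : r₀ ∈ polyInvariants ρ)
    (hr : ∀ i, r i ∈ polyInvariants ρ)
    (hspan : r₀ ∉ Submodule.span (polyInvariants ρ) (Set.range r)) (d : ℕ) :
    ∀ (p₀ : PolyRing V) (p : κ → PolyRing V), p₀ ∈ homogeneousPart V d →
      r₀ * p₀ + ∑ i, r i * p i = 0 → p₀ ∈ hilbertIdeal ρ := by
  induction d with
  | zero =>
    intro p₀ p hp₀ h
    rw [eq_algebraMap_of_mem hp₀] at h ⊢
    set c := constTerm p₀
    by_cases hc : c = 0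
    · rw [hc, map_zero]; exact zero_mem _
    exfalso
    apply hspan
    -- If p₀ is a nonzero constant, averaging makes the other coefficients invariant and puts r₀ in
    -- the excluded span.
    have h1 := congrArg (polyAverage ρ) h
    rw [map_add, map_zero, map_sum, polyAverage_mul ρ hr₀,
      polyAverage_of_mem ρ (Subalgebra.algebraMap_mem _ c)] at h1
    have h2 : r₀ = ∑ i, (-(c⁻¹ • polyAverage ρ (p i))) * r i := by
      have h3 : r₀ * algebraMap ℂ _ c = - ∑ i, polyAverage ρ (r i * p i) :=
        eq_neg_of_add_eq_zero_left h1
      calc r₀ = c⁻¹ • (r₀ * algebraMap ℂ _ c) := by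
            rw [mul_comm, ← Algebra.smul_def, smul_smul, inv_mul_cancel₀ hc, one_smul]
        _ = _ := by
            rw [h3, smul_neg, Finset.smul_sum, ← Finset.sum_neg_distrib]
            refine Finset.sum_congr rfl fun i _ => ?_
            rw [polyAverage_mul ρ (hr i), neg_mul, smul_mul_assoc, mul_comm]
    rw [h2]
    exact sum_mem fun i _ => Submodule.smul_mem _
      (⟨_, neg_mem (Subalgebra.smul_mem _ (polyAverage_mem ρ (p i)) _)⟩ : polyInvariants ρ)
      (Submodule.subset_span ⟨i, rfl⟩)
  | succ d ih =>
    intro p₀ p hp₀ h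
    have step : ∀ g : Γ, polyAct ρ g p₀ - p₀ ∈ hilbertIdeal ρ := by
      intro g
      have hg : g ∈ Subgroup.closure {g | FixesHyperplane ρ g} := by
        rw [hρ]; exact Subgroup.mem_top g
      induction hg using Subgroup.closure_induction with
      | mem g hg =>
        obtain ⟨l, hl0, hl⟩ := hg
        obtain ⟨q₀, hq₀⟩ := exists_polyAct_sub_eq_mul hl p₀
        choose q hq using fun i => exists_polyAct_sub_eq_mul hl (p i)
        have hmul : SymmetricAlgebra.ι ℂ (Dual ℂ V) l * q₀ ∈ homogeneousPart V (d + 1) := by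
          rw [eq_sub_of_add_eq' hq₀.symm]
          exact Submodule.sub_mem _ (polyAct_mem_homogeneousPart ρ g hp₀) hp₀
        -- The quotient q₀ is homogeneous of degree d because l q₀ is homogeneous of degree d + 1
        -- and l can be cancelled.
        have hq₀d : homComp d q₀ = q₀ := by
          apply mul_left_cancel₀ (ι_ne_zero hl0)
          rw [← homComp_mul (ι_mem_homogeneousPart l), add_comm 1 d, homComp_self hmul]
        have hrel : r₀ * q₀ + ∑ i, r i * q i = 0 := by
          have h1 := congrArg (polyAct ρ g) h
          rw [map_add, map_mul, hr₀ g, hq₀, map_sum, map_zero] at h1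
          simp_rw [map_mul, hr _ g, hq, mul_add, Finset.sum_add_distrib] at h1
          apply mul_left_cancel₀ (ι_ne_zero hl0)
          rw [mul_zero, ← h1, ← sub_eq_zero, mul_add, Finset.mul_sum]
          simp_rw [mul_left_comm (SymmetricAlgebra.ι ℂ (Dual ℂ V) l)]
          linear_combination -h
        rw [hq₀, add_sub_cancel_left]
        refine Ideal.mul_mem_left _ _ (ih q₀ q ?_ hrel)
        rw [← hq₀d]
        exact homComp_mem d q₀
      | one => rw [polyAct_one, AlgHom.id_apply, sub_self]; exact zero_mem _
      | mul g g' _ _ hg hg' =>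
        have h1 := add_mem (polyAct_mem_hilbertIdeal ρ g hg') hg
        rwa [map_sub, sub_add_sub_cancel, ← AlgHom.comp_apply, ← polyAct_mul] at h1
      | inv g _ hg =>
        have h1 := neg_mem (polyAct_mem_hilbertIdeal ρ g⁻¹ hg)
        rwa [map_sub, polyAct_inv_self, neg_sub] at h1
    let _ := Fintype.ofFinite Γ
    -- Modulo the ideal p₀ equals its average, an invariant of positive degree, which lies in the
    -- ideal.
    have hav : polyAverage ρ p₀ - p₀ ∈ hilbertIdeal ρ := by
      have h1 : polyAverage ρ p₀ - p₀ =
          (Nat.card Γ : ℂ)⁻¹ • ∑ g : Γ, (polyAct ρ g p₀ - p₀) := by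
        rw [Finset.sum_sub_distrib, smul_sub, ← polyAverage_apply, Finset.sum_const,
          Finset.card_univ, ← Nat.card_eq_fintype_card, ← Nat.cast_smul_eq_nsmul ℂ, smul_smul,
          inv_mul_cancel₀ (Nat.cast_ne_zero.mpr Nat.card_pos.ne'), one_smul]
      rw [h1]
      exact Submodule.smul_of_tower_mem _ _ (sum_mem fun g _ => step g)
    have hmem : polyAverage ρ p₀ ∈ hilbertIdeal ρ :=
      mem_hilbertIdeal_of_mem (polyAverage_mem ρ p₀)
        (constTerm_of_mem (polyAverage_mem_homogeneousPart ρ hp₀) (Nat.succ_ne_zero d))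
    have := sub_mem hmem hav
    rwa [sub_sub_cancel] at this

variable [FiniteDimensional ℂ V]

/-- An r of minimal degree is outside the R-span of the others: in that degree such an expression
would have scalar coefficients, against linear independence. Chevalley's lemma then puts its
harmonic coefficient in the Hilbert ideal, so the coefficient is zero and the term can be dropped.
-/
theorem eq_zero_of_homogeneous_relation (hρ : GeneratedByReflections ρ) {κ : Type*}
    {r : κ → PolyRing V} {n m : κ → ℕ} (hr : ∀ i, r i ∈ polyInvariants ρ)
    (hrn : ∀ i, r i ∈ homogeneousPart V (n i)) (hli : LinearIndependent ℂ r)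
    (s : Finset κ) {p : κ → PolyRing V} (hp : ∀ i, p i ∈ harmonicPart ρ (m i))
    (h : ∑ i ∈ s, r i * p i = 0) : ∀ i ∈ s, p i = 0 := by
  classical
  induction s using Finset.strongInduction with
  | _ s ih =>
    rcases s.eq_empty_or_nonempty with rfl | hs
    · simp
    obtain ⟨i₀, hi₀, hmin⟩ := s.exists_min_image n hs
    have hnot : r i₀ ∉ Submodule.span (polyInvariants ρ)
        (Set.range fun i : s.erase i₀ => r i) := by
      intro hmem
      obtain ⟨c, hc⟩ := (Submodule.mem_span_range_iff_exists_fun _).mp hmem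
      have h1 := congrArg (homComp (n i₀)) hc
      rw [homComp_self (hrn i₀), map_sum] at h1
      have h2 : r i₀ ∈ Submodule.span ℂ (r '' (s.erase i₀ : Finset κ)) := by
        rw [← h1]
        refine sum_mem fun i _ => ?_
        have hi : (i : κ) ∈ s.erase i₀ := i.2
        rw [Subalgebra.smul_def, smul_eq_mul]
        rcases (hmin i (Finset.mem_of_mem_erase hi)).eq_or_lt with he | hlt
        · rw [he, homComp_self_mul (hrn i)]
          exact Submodule.smul_mem _ _ (Submodule.subset_span ⟨i, hi, rfl⟩)
        · rw [mul_comm, homComp_mul_of_lt (hrn i) _ hlt]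
          exact zero_mem _
      exact hli.notMem_span_image (by simp) h2
    have hsplit : r i₀ * p i₀ + ∑ i : s.erase i₀, r i * p i = 0 := by
      rw [Finset.sum_coe_sort (s.erase i₀) fun i => r i * p i,
        Finset.add_sum_erase s (fun i => r i * p i) hi₀, h]
    have hp0 : p i₀ = 0 := eq_zero_of_mem_harmonics_of_mem_hilbertIdeal (hp i₀).1
      (mem_hilbertIdeal_of_relation hρ (hr i₀) (fun i : s.erase i₀ => hr i) hnot (m i₀) (p i₀)
        (fun i => p i) (hp i₀).2 hsplit)
    have hrest : ∑ i ∈ s.erase i₀, r i * p i = 0 := by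
      rw [← h, ← Finset.add_sum_erase s (fun i => r i * p i) hi₀, hp0, mul_zero, zero_add]
    intro i hi
    by_cases hi' : i = i₀
    · rw [hi', hp0]
    · exact ih _ (Finset.erase_ssubset hi₀) hrest i (Finset.mem_erase.mpr ⟨hi', hi⟩)

theorem eq_zero_of_relation (hρ : GeneratedByReflections ρ) {κ : Type*}
    {r : κ → PolyRing V} {n : κ → ℕ} (hr : ∀ i, r i ∈ polyInvariants ρ)
    (hrn : ∀ i, r i ∈ homogeneousPart V (n i)) (hli : LinearIndependent ℂ r)
    (s : Finset κ) {p : κ → PolyRing V} (hp : ∀ i, p i ∈ harmonics ρ)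
    (h : ∑ i ∈ s, r i * p i = 0) : ∀ i ∈ s, p i = 0 := by
  intro i hi
  refine eq_zero_of_homComp fun e => ?_
  -- The degree n i + e part of the relation. Terms with n j > n i + e contribute nothing, and
  -- setting them to zero keeps the truncated subtraction harmless.
  let p' : κ → PolyRing V := fun j => if n j ≤ n i + e then homComp (n i + e - n j) (p j) else 0
  have hp' : ∀ j, p' j ∈ harmonicPart ρ (n i + e - n j) := fun j => by
    simp only [p']
    split_ifs
    · exact ⟨homComp_mem_harmonics (hp j) _, homComp_mem _ _⟩
    · exact Submodule.zero_mem _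
  have hsum : ∑ j ∈ s, r j * p' j = 0 := by
    have h1 := congrArg (homComp (n i + e)) h
    rw [map_zero, map_sum] at h1
    rw [← h1]
    refine Finset.sum_congr rfl fun j _ => ?_
    simp only [p']
    split_ifs with hle
    · obtain ⟨k, hk⟩ := Nat.exists_eq_add_of_le hle
      rw [hk, homComp_mul (hrn j), Nat.add_sub_cancel_left]
    · rw [homComp_mul_of_lt (hrn j) _ (not_le.mp hle), mul_zero]
  have := eq_zero_of_homogeneous_relation hρ hr hrn hli s hp' hsum i hi
  simpa [p'] using this

/-- Linearly independent families of harmonic-valued functions are linearly independent over the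
invariants of a reflection group. -/
theorem eq_zero_of_harmonic_relation (hρ : GeneratedByReflections ρ) {κ X : Type*} [Fintype κ]
    {u : κ → X → PolyRing V} (hu : ∀ i x, u i x ∈ harmonics ρ) (hli : LinearIndependent ℂ u)
    {s : κ → PolyRing V} (hs : ∀ i, s i ∈ polyInvariants ρ)
    (h : ∀ x, ∑ i, s i * u i x = 0) : s = 0 := by
  classical
  -- A ℂ-basis of the span of the homogeneous components of all s i consists of homogeneous
  -- invariants. Expanding the s i in it turns the relation into one whose harmonic coefficients are
  -- ℂ-combinations of the u i.
  obtain ⟨b, hbZ, hspan, hb⟩ := exists_linearIndependent ℂ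
    (Set.range fun q : κ × ℕ => homComp q.2 (s q.1))
  have hsb : ∀ i, s i ∈ Submodule.span ℂ (Set.range ((↑) : b → PolyRing V)) := fun i => by
    rw [Subtype.range_coe, hspan]
    obtain ⟨n, hn⟩ := exists_sum_homComp (s i)
    rw [hn]
    exact sum_mem fun d _ => Submodule.subset_span ⟨(i, d), rfl⟩
  choose c hc using fun i => Finsupp.mem_span_range_iff_exists_finsupp.mp (hsb i)
  choose q hq using fun a : b => hbZ a.2
  have hinv : ∀ a : b, (a : PolyRing V) ∈ polyInvariants ρ := fun a => by
    rw [← hq a]; exact homComp_mem_polyInvariants ρ (hs _) _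
  have hdeg : ∀ a : b, (a : PolyRing V) ∈ homogeneousPart V (q a).2 := fun a => by
    have h1 := homComp_mem (q a).2 (s (q a).1)
    rwa [show homComp (q a).2 (s (q a).1) = a from hq a] at h1
  let T : Finset b := Finset.univ.biUnion fun i => (c i).support
  have hcT : ∀ i, s i = ∑ a ∈ T, c i a • (a : PolyRing V) := fun i => by
    rw [← hc i]
    refine Finsupp.sum_of_support_subset _ ?_ _ (by simp)
    exact Finset.subset_biUnion_of_mem (fun i => (c i).support) (Finset.mem_univ i)
  have hzero : ∀ x, ∀ a ∈ T, ∑ i, c i a • u i x = 0 := fun x => by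
    refine eq_zero_of_relation hρ (n := fun a => (q a).2) hinv hdeg hb T
      (p := fun a => ∑ i, c i a • u i x)
      (fun a => Submodule.sum_mem _ fun i _ => Submodule.smul_mem _ _ (hu i x)) ?_
    rw [← h x]
    simp_rw [hcT, Finset.sum_mul, Finset.mul_sum]
    rw [Finset.sum_comm]
    refine Finset.sum_congr rfl fun i _ => Finset.sum_congr rfl fun a _ => ?_
    rw [mul_smul_comm, smul_mul_assoc]
  funext i
  rw [hcT i]
  refine Finset.sum_eq_zero fun a ha => ?_
  have h1 : ∑ i, c i a • u i = 0 := by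
    funext x
    simpa using hzero x a ha
  rw [Fintype.linearIndependent_iff.mp hli (fun i => c i a) h1 i, zero_smul]

end Chevalley

/-! ### Subspaces with bounded independent families -/

section BoundedSubspaces

/-- Finite-dimensionality of the harmonic equivariants is not known beforehand; a bound on
independent families supplies it along with the dimension bound. -/
theorem finite_of_card_le {F : Type*} [AddCommGroup F] [Module ℂ F] (K : Submodule ℂ F) (n : ℕ)
    (H : ∀ s : Finset K, LinearIndependent ℂ (fun i : s => ((i : K) : F)) → s.card ≤ n) :
    FiniteDimensional ℂ K ∧ finrank ℂ K ≤ n := by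
  have hcard : Module.rank ℂ K ≤ n :=
    rank_le fun s hs => H s (hs.map' K.subtype (Submodule.ker_subtype _))
  have hfd : FiniteDimensional ℂ K :=
    Module.rank_lt_aleph0_iff.mp (hcard.trans_lt Cardinal.natCast_lt_aleph0)
  refine ⟨hfd, ?_⟩
  rw [← finrank_eq_rank] at hcard
  exact_mod_cast hcard

/-- The instance is not found automatically, the additive structure of `S(V*)` being reached in
two ways. -/
instance {V P : Type*} [AddCommGroup V] [Module ℂ V] [AddCommGroup P] [Module ℂ P]
    (K : Submodule ℂ (P →ₗ[ℂ] PolyRing V)) : Module.Free ℂ K :=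
  @Module.Free.of_divisionRing ℂ K _ K.addCommGroup K.module

end BoundedSubspaces

/-! ### Equivariant polynomial maps -/

section Equivariants

variable {Γ : Type*} [Group Γ] {V : Type*} [AddCommGroup V] [Module ℂ V]
  {P : Type*} [AddCommGroup P] [Module ℂ P]
  (ρ : Representation ℂ Γ V) (τ : Representation ℂ Γ P)

/-- The space of equivariant linear maps from `P` to `S(V*)`. -/
def equivariants : Submodule ℂ (P →ₗ[ℂ] PolyRing V) where
  carrier := {φ | ∀ g x, φ (τ g x) = polyAct ρ g (φ x)}
  zero_mem' g x := by simp
  add_mem' ha hb g x := by simp [ha g x, hb g x]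
  smul_mem' c a ha g x := by simp [ha g x]

/-- The equivariant linear maps from `P` to the harmonic polynomials. -/
def harmonicEquivariants : Submodule ℂ (P →ₗ[ℂ] PolyRing V) where
  carrier := {φ | φ ∈ equivariants ρ τ ∧ ∀ x, φ x ∈ harmonics ρ}
  zero_mem' := ⟨zero_mem _, fun _ => Submodule.zero_mem _⟩
  add_mem' ha hb := ⟨add_mem ha.1 hb.1, fun x => Submodule.add_mem _ (ha.2 x) (hb.2 x)⟩
  smul_mem' c _ ha := ⟨Submodule.smul_mem _ c ha.1, fun x => Submodule.smul_mem _ c (ha.2 x)⟩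

variable {ρ τ}

section Average

variable [Finite Γ]

variable (ρ τ) in
/-- The average over the group of a linear map from `P` to `S(V*)`. -/
def homAverage : (P →ₗ[ℂ] PolyRing V) →ₗ[polyInvariants ρ] (P →ₗ[ℂ] PolyRing V) where
  toFun φ := letI := Fintype.ofFinite Γ
    (Nat.card Γ : ℂ)⁻¹ • ∑ g : Γ, (polyAct ρ g).toLinearMap ∘ₗ φ ∘ₗ τ g⁻¹
  map_add' φ ψ := by
    simp only [LinearMap.add_comp, LinearMap.comp_add, Finset.sum_add_distrib, smul_add]
  map_smul' r φ := by
    ext x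
    simp only [LinearMap.smul_apply, LinearMap.sum_apply, LinearMap.comp_apply,
      AlgHom.toLinearMap_apply, Subalgebra.smul_def, smul_eq_mul, map_mul, RingHom.id_apply,
      mul_smul_comm, Finset.mul_sum]
    congr 1
    exact Finset.sum_congr rfl fun g _ => by rw [r.2 g]

theorem homAverage_apply [Fintype Γ] (φ : P →ₗ[ℂ] PolyRing V) (x : P) :
    homAverage ρ τ φ x = (Nat.card Γ : ℂ)⁻¹ • ∑ g : Γ, polyAct ρ g (φ (τ g⁻¹ x)) := by
  simp only [homAverage, LinearMap.coe_mk, AddHom.coe_mk, LinearMap.smul_apply,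
    LinearMap.sum_apply, LinearMap.comp_apply, AlgHom.toLinearMap_apply]
  congr!

theorem homAverage_mem (φ : P →ₗ[ℂ] PolyRing V) : homAverage ρ τ φ ∈ equivariants ρ τ := by
  intro g x
  let _ := Fintype.ofFinite Γ
  rw [homAverage_apply, homAverage_apply, map_smul, map_sum]
  congr 1
  refine Fintype.sum_equiv (Equiv.mulLeft g⁻¹) _ _ fun h => ?_
  rw [Equiv.coe_mulLeft, ← AlgHom.comp_apply, ← polyAct_mul, mul_inv_cancel_left, mul_inv_rev,
    inv_inv, map_mul, Module.End.mul_apply]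

theorem homAverage_of_mem {φ : P →ₗ[ℂ] PolyRing V} (hφ : φ ∈ equivariants ρ τ) :
    homAverage ρ τ φ = φ := by
  ext x
  let _ := Fintype.ofFinite Γ
  rw [homAverage_apply, Finset.sum_congr rfl fun g _ => by rw [hφ g⁻¹ x, polyAct_self_inv],
    Finset.sum_const, Finset.card_univ, ← Nat.card_eq_fintype_card, ← Nat.cast_smul_eq_nsmul ℂ,
    smul_smul, inv_mul_cancel₀ (Nat.cast_ne_zero.mpr Nat.card_pos.ne'), one_smul]

theorem homAverage_mem_harmonicEquivariants {φ : P →ₗ[ℂ] PolyRing V}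
    (hφ : ∀ x, φ x ∈ harmonics ρ) : homAverage ρ τ φ ∈ harmonicEquivariants ρ τ := by
  refine ⟨homAverage_mem φ, fun x => ?_⟩
  let _ := Fintype.ofFinite Γ
  rw [homAverage_apply]
  refine Submodule.smul_mem _ _ (Submodule.sum_mem _ fun g _ => ?_)
  intro D hD hinv hone
  have h : D (polyRep ρ g (φ (τ g⁻¹ x))) = polyRep ρ g (D (φ (τ g⁻¹ x))) :=
    congrArg (fun ψ => ψ (φ (τ g⁻¹ x))) (hinv g)
  rw [polyRep_apply] at h
  rw [h, hφ _ D hD hinv hone, map_zero]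

end Average

/-! ### Independence of automorphisms and its consequences for value matrices -/

section Dedekind

variable (ρ) in
/-- The group acts faithfully on `S(V*)`. -/
def IsFaithfulOnPoly : Prop := Function.Injective (polyAct ρ)

/-- Dedekind's theorem on distinct multiplicative maps into a domain. -/
theorem IsFaithfulOnPoly.eq_zero_of_sum [Fintype Γ] (hf : IsFaithfulOnPoly ρ)
    {a : Γ → PolyRing V} (h : ∀ f, ∑ g, a g * polyAct ρ g f = 0) : a = 0 := by
  have hli := (linearIndependent_monoidHom (PolyRing V) (PolyRing V)).comp
    (fun g : Γ => ((polyAct ρ g : PolyRing V →ₐ[ℂ] PolyRing V) : PolyRing V →* PolyRing V))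
    (fun g g' hgg => hf (AlgHom.ext fun x => DFunLike.congr_fun hgg x))
  funext g
  refine Fintype.linearIndependent_iff.mp hli a ?_ g
  funext f
  simpa using h f

/-- Independence over invariants implies independence over S: multiplying a relation by any f and
averaging makes its coefficients invariant, so every f c_i has average zero, and Dedekind forces c_i
= 0. -/
theorem eq_zero_of_equivariant_relation [Finite Γ] (hf : IsFaithfulOnPoly ρ) {κ : Type*}
    [Fintype κ] {u : κ → P →ₗ[ℂ] PolyRing V} (hu : ∀ i, u i ∈ equivariants ρ τ)
    (hR : ∀ s : κ → PolyRing V, (∀ i, s i ∈ polyInvariants ρ) →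
      (∀ x, ∑ i, s i * u i x = 0) → s = 0)
    {c : κ → PolyRing V} (hc : ∀ x, ∑ i, c i * u i x = 0) : c = 0 := by
  let _ := Fintype.ofFinite Γ
  funext i
  have key : ∀ f, polyAverage ρ (f * c i) = 0 := fun f => by
    refine congrFun (hR (fun i => polyAverage ρ (f * c i)) (fun i => polyAverage_mem ρ _)
      fun x => ?_) i
    simp_rw [polyAverage_apply, smul_mul_assoc, Finset.sum_mul]
    rw [← Finset.smul_sum, Finset.sum_comm]
    refine smul_eq_zero_of_right _ (Finset.sum_eq_zero fun g _ => ?_)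
    have h1 := congrArg (polyAct ρ g) (hc (τ g⁻¹ x))
    rw [map_sum, map_zero] at h1
    simp_rw [map_mul, mul_assoc]
    rw [← Finset.mul_sum]
    refine mul_eq_zero_of_right _ ?_
    rw [← h1]
    refine Finset.sum_congr rfl fun j _ => ?_
    rw [map_mul, hu j g⁻¹ x, polyAct_self_inv]
  have h0 : (fun g => polyAct ρ g (c i)) = 0 := hf.eq_zero_of_sum fun f => by
    have h1 := key f
    rw [polyAverage_apply, smul_eq_zero_iff_right
      (inv_ne_zero (Nat.cast_ne_zero.mpr Nat.card_pos.ne'))] at h1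
    rw [← h1]
    exact Finset.sum_congr rfl fun g _ => by rw [map_mul, mul_comm]
  have h2 := congrFun h0 1
  simpa [polyAct_one] using h2

theorem card_le_of_independent {κ ι : Type*} [Fintype κ] [Fintype ι] (b : Basis ι ℂ P)
    {u : κ → P →ₗ[ℂ] PolyRing V}
    (h : ∀ c : κ → PolyRing V, (∀ x, ∑ i, c i * u i x = 0) → c = 0) :
    Fintype.card κ ≤ Fintype.card ι := by
  have hli : LinearIndependent (PolyRing V) (fun i j => u i (b j)) := by
    rw [Fintype.linearIndependent_iff]
    intro c hc
    refine congrFun (h c fun x => ?_)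
    rw [← b.sum_repr x]
    simp_rw [map_sum, map_smul, Finset.mul_sum, mul_smul_comm]
    rw [Finset.sum_comm]
    refine Finset.sum_eq_zero fun j _ => ?_
    rw [← Finset.smul_sum]
    have := congrFun hc j
    simp only [Finset.sum_apply, Pi.smul_apply, smul_eq_mul, Pi.zero_apply] at this
    rw [this, smul_zero]
  simpa using hli.fintype_card_le_finrank

/-- The matrix of values of a family of linear maps to `S(V*)` at a basis. -/
def valueMatrix {κ ι : Type*} (b : ι → P) (u : κ → P →ₗ[ℂ] PolyRing V) :
    Matrix κ ι (PolyRing V) := Matrix.of fun i j => u i (b j)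

/-- A vector v in the kernel of the matrix annihilates the values of every equivariant map, in
particular of the averages of f times a coordinate b_k*. Since f is arbitrary, Dedekind kills each
group element's coefficient, and the one at the identity is v_k. -/
theorem det_valueMatrix_ne_zero [Finite Γ] (hf : IsFaithfulOnPoly ρ) {ι : Type*} [Fintype ι]
    [DecidableEq ι] (b : Basis ι ℂ P) {u : ι → P →ₗ[ℂ] PolyRing V}
    (hspan : ∀ φ ∈ equivariants ρ τ, φ ∈ Submodule.span (polyInvariants ρ) (Set.range u)) :
    (valueMatrix b u).det ≠ 0 := by
  intro hdet
  obtain ⟨v, hv0, hv⟩ := Matrix.exists_mulVec_eq_zero_iff.mpr hdet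
  let _ := Fintype.ofFinite Γ
  have hker : ∀ φ ∈ equivariants ρ τ, ∑ j, φ (b j) * v j = 0 := by
    intro φ hφ
    have hφs := hspan φ hφ
    clear hφ
    induction hφs using Submodule.span_induction with
    | mem ψ hψ =>
      obtain ⟨i, rfl⟩ := hψ
      exact congrFun hv i
    | zero => simp
    | add x y _ _ hx hy => simp [add_mul, Finset.sum_add_distrib, hx, hy]
    | smul r x _ hx =>
      simp only [LinearMap.smul_apply, smul_mul_assoc]
      rw [← Finset.smul_sum, hx, smul_zero]
  apply hv0
  funext k
  have h0 : (fun g : Γ => ∑ j, b.coord k (τ g⁻¹ (b j)) • v j) = 0 := by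
    refine hf.eq_zero_of_sum fun f => ?_
    have h1 := hker _ (homAverage_mem (τ := τ) (ρ := ρ) ((b.coord k).smulRight f))
    simp_rw [homAverage_apply, smul_mul_assoc] at h1
    rw [← Finset.smul_sum, smul_eq_zero_iff_right
      (inv_ne_zero (Nat.cast_ne_zero.mpr Nat.card_pos.ne'))] at h1
    simp_rw [Finset.sum_mul] at h1 ⊢
    rw [Finset.sum_comm] at h1
    rw [← h1]
    refine Finset.sum_congr rfl fun g _ => Finset.sum_congr rfl fun j _ => ?_
    rw [LinearMap.smulRight_apply, map_smul, smul_mul_assoc, smul_mul_assoc, mul_comm]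
  have h1 := congrFun h0 1
  simpa [Finsupp.single_apply] using h1

end Dedekind

/-! ### The rank of the module of equivariants -/

section Rank

variable (ρ τ) in
/-- The equivariant maps from `P` to `S(V*)` are generated over the invariants by `dim P`
elements. -/
def HasRankGenerators : Prop :=
  ∃ v : Fin (finrank ℂ P) → P →ₗ[ℂ] PolyRing V, (∀ i, v i ∈ equivariants ρ τ) ∧
    ∀ φ ∈ equivariants ρ τ, φ ∈ Submodule.span (polyInvariants ρ) (Set.range v)

variable [Finite Γ] [FiniteDimensional ℂ V] [FiniteDimensional ℂ P]

/-- A linear map is a sum of polynomials times coordinates, and its polynomials lie in the R-span of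
the harmonics. Averaging is R-linear, fixes equivariant maps and preserves harmonic values. -/
theorem mem_span_harmonicEquivariants {φ : P →ₗ[ℂ] PolyRing V} (hφ : φ ∈ equivariants ρ τ) :
    φ ∈ Submodule.span (polyInvariants ρ) (harmonicEquivariants ρ τ : Set (P →ₗ[ℂ] _)) := by
  let b := finBasis ℂ P
  let L (j) : PolyRing V →ₗ[polyInvariants ρ] (P →ₗ[ℂ] PolyRing V) :=
    { toFun := fun f => (b.coord j).smulRight f
      map_add' := fun f f' => by ext; simp
      map_smul' := fun r f => by
        ext x
        simp only [LinearMap.smulRight_apply, LinearMap.smul_apply, RingHom.id_apply]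
        exact smul_comm _ _ _ }
  have h1 : ∀ j f, homAverage ρ τ (L j f) ∈
      Submodule.span (polyInvariants ρ) (harmonicEquivariants ρ τ : Set (P →ₗ[ℂ] _)) := by
    intro j f
    have hf : f ∈ Submodule.span (polyInvariants ρ) (harmonics ρ : Set (PolyRing V)) := by
      rw [span_harmonics]; trivial
    induction hf using Submodule.span_induction with
    | mem c hc =>
      exact Submodule.subset_span (homAverage_mem_harmonicEquivariants fun x =>
        Submodule.smul_mem _ _ hc)
    | zero => rw [map_zero, map_zero]; exact zero_mem _
    | add x y _ _ hx hy => rw [map_add, map_add]; exact add_mem hx hy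
    | smul r x _ hx => rw [map_smul, map_smul]; exact Submodule.smul_mem _ _ hx
  have h2 : φ = ∑ j, L j (φ (b j)) := by
    refine b.ext fun k => ?_
    rw [LinearMap.sum_apply, Finset.sum_eq_single k]
    · simp [L]
    · intro j _ hj
      simp [L, Finsupp.single_eq_of_ne hj]
    · simp
  rw [← homAverage_of_mem hφ, h2, map_sum]
  exact sum_mem fun j _ => h1 j _

theorem isCompl_hilbertIdeal_harmonics :
    IsCompl (harmonics ρ) ((hilbertIdeal ρ).restrictScalars ℂ) := by
  refine IsCompl.of_eq ?_ ?_
  · rw [eq_bot_iff]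
    rintro f ⟨h, h'⟩
    exact eq_zero_of_mem_harmonics_of_mem_hilbertIdeal h h'
  · rw [eq_top_iff]
    intro f _
    obtain ⟨c, hc, n, hn⟩ := exists_harmonics_sub_mem ρ f
    rw [← add_sub_cancel (∑ d ∈ Finset.range n, c d) f]
    exact Submodule.add_mem_sup (Submodule.sum_mem _ fun d _ => (hc d).1) hn

omit [FiniteDimensional ℂ P] in
-- Modulo the Hilbert ideal an invariant acts through its constant term, so projecting to the
-- harmonics turns generators over R into generators over ℂ.
theorem HasRankGenerators.finrank_le (h : HasRankGenerators ρ τ) :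
    FiniteDimensional ℂ (harmonicEquivariants ρ τ) ∧
      finrank ℂ (harmonicEquivariants ρ τ) ≤ finrank ℂ P := by
  obtain ⟨v, hv, hspan⟩ := h
  let π : PolyRing V →ₗ[ℂ] PolyRing V :=
    (harmonics ρ).subtype ∘ₗ
      Submodule.projectionOnto _ _ (isCompl_hilbertIdeal_harmonics (ρ := ρ))
  have hπC : ∀ f ∈ harmonics ρ, π f = f := fun f hf =>
    congrArg Subtype.val (Submodule.projectionOnto_apply_left
      (isCompl_hilbertIdeal_harmonics (ρ := ρ)) ⟨f, hf⟩)
  have hπI : ∀ f ∈ hilbertIdeal ρ, π f = 0 := fun f hf =>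
    congrArg Subtype.val (Submodule.projectionOnto_apply_right
      (isCompl_hilbertIdeal_harmonics (ρ := ρ)) ⟨f, hf⟩)
  have hπr : ∀ r : polyInvariants ρ, ∀ f, π (r • f) = constTerm (r : PolyRing V) • π f := by
    intro r f
    have h1 : r • f = constTerm (r : PolyRing V) • f +
        ((r : PolyRing V) - algebraMap ℂ _ (constTerm (r : PolyRing V))) * f := by
      rw [sub_mul, ← Algebra.smul_def, add_sub_cancel]
      rfl
    rw [h1, map_add, map_smul, hπI _ (Ideal.mul_mem_right _ _ (mem_hilbertIdeal_of_mem
      (sub_mem r.2 (Subalgebra.algebraMap_mem _ _)) ?_)), add_zero]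
    rw [map_sub, SymmetricAlgebra.algebraMap_leftInverse (R := ℂ) (Dual ℂ V), sub_self]
  have hle : harmonicEquivariants ρ τ ≤ Submodule.span ℂ (Set.range fun i => π ∘ₗ v i) := by
    intro φ hφ
    have h1 : φ = π ∘ₗ φ := LinearMap.ext fun x => (hπC _ (hφ.2 x)).symm
    rw [h1]
    have hφs := hspan φ hφ.1
    clear hφ h1
    induction hφs using Submodule.span_induction with
    | mem ψ hψ =>
      obtain ⟨i, rfl⟩ := hψ
      exact Submodule.subset_span ⟨i, rfl⟩
    | zero => rw [LinearMap.comp_zero]; exact zero_mem _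
    | add x y _ _ hx hy => rw [LinearMap.comp_add]; exact add_mem hx hy
    | smul r x _ hx =>
      have : π ∘ₗ (r • x) = constTerm (r : PolyRing V) • (π ∘ₗ x) :=
        LinearMap.ext fun y => hπr r (x y)
      rw [this]
      exact Submodule.smul_mem _ _ hx
  have hfd : FiniteDimensional ℂ (Submodule.span ℂ (Set.range fun i => π ∘ₗ v i)) :=
    FiniteDimensional.span_of_finite ℂ (Set.finite_range _)
  refine ⟨Submodule.finiteDimensional_of_le hle, (Submodule.finrank_mono hle).trans ?_⟩
  exact (finrank_range_le_card _).trans (by simp)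

theorem mem_span_of_basis {κ : Type*} (u : Basis κ ℂ (harmonicEquivariants ρ τ))
    {φ : P →ₗ[ℂ] PolyRing V} (hφ : φ ∈ equivariants ρ τ) :
    φ ∈ Submodule.span (polyInvariants ρ)
      (Set.range fun i => (u i : P →ₗ[ℂ] PolyRing V)) := by
  refine Submodule.span_le.mpr ?_ (mem_span_harmonicEquivariants hφ)
  intro ψ hψ
  have h1 : (⟨ψ, hψ⟩ : harmonicEquivariants ρ τ) ∈ Submodule.span ℂ (Set.range u) := by
    rw [u.span_eq]; trivial
  have h2 := Submodule.mem_map_of_mem (f := (harmonicEquivariants ρ τ).subtype) h1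
  rw [Submodule.map_span, ← Set.range_comp] at h2
  exact Submodule.span_le_restrictScalars ℂ (polyInvariants ρ) _ h2

/-- Zeros are appended so that the family has a prescribed length and its value matrix can be
square; the zero rows later contradict a nonvanishing determinant. -/
theorem exists_padded_generators [FiniteDimensional ℂ (harmonicEquivariants ρ τ)] {n : ℕ}
    (h : finrank ℂ (harmonicEquivariants ρ τ) ≤ n) :
    ∃ u : Fin n → P →ₗ[ℂ] PolyRing V, (∀ i, u i ∈ equivariants ρ τ) ∧
      (∀ φ ∈ equivariants ρ τ, φ ∈ Submodule.span (polyInvariants ρ) (Set.range u)) ∧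
      ∀ i : Fin n, finrank ℂ (harmonicEquivariants ρ τ) ≤ i → u i = 0 := by
  let c := finBasis ℂ (harmonicEquivariants ρ τ)
  let u : Fin n → P →ₗ[ℂ] PolyRing V := fun i =>
    if hi : (i : ℕ) < finrank ℂ (harmonicEquivariants ρ τ) then
      (c ⟨i, hi⟩ : P →ₗ[ℂ] PolyRing V) else 0
  refine ⟨u, fun i => ?_, fun φ hφ => ?_, fun i hi => dif_neg (not_lt.mpr hi)⟩
  · simp only [u]
    split_ifs
    · exact (c _).2.1
    · exact zero_mem _
  · refine Submodule.span_mono ?_ (mem_span_of_basis c hφ)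
    rintro _ ⟨i, rfl⟩
    exact ⟨⟨i, i.2.trans_le h⟩, dif_pos i.2⟩

theorem hasRankGenerators_of_finrank_le [FiniteDimensional ℂ (harmonicEquivariants ρ τ)]
    (h : finrank ℂ (harmonicEquivariants ρ τ) ≤ finrank ℂ P) : HasRankGenerators ρ τ := by
  obtain ⟨u, hu, hspan, -⟩ := exists_padded_generators h
  exact ⟨u, hu, hspan⟩

/-- Harmonic equivariants independent over ℂ are independent over R by Chevalley, then over S by
Dedekind, hence at most dim P in number. -/
theorem HasRankGenerators.of_generatedByReflections (hf : IsFaithfulOnPoly ρ)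
    (hρ : GeneratedByReflections ρ) (τ : Representation ℂ Γ P) : HasRankGenerators ρ τ := by
  obtain ⟨hfd, hle⟩ := finite_of_card_le (harmonicEquivariants ρ τ) (finrank ℂ P) fun s hs => by
    have hs' : LinearIndependent ℂ
        (fun i : s => (((i : harmonicEquivariants ρ τ) : P →ₗ[ℂ] PolyRing V) : P → PolyRing V)) :=
      hs.map' (LinearMap.ltoFun ℂ P (PolyRing V) ℂ) (LinearMap.ker_eq_bot.mpr
        fun a b hab => LinearMap.ext fun x => congrFun hab x)
    have h1 := card_le_of_independent (κ := s) (finBasis ℂ P)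
      (u := fun i => ((i : harmonicEquivariants ρ τ) : P →ₗ[ℂ] PolyRing V)) fun c hc =>
        eq_zero_of_equivariant_relation (τ := τ) hf (fun i => i.1.2.1) (fun t ht hrel =>
          eq_zero_of_harmonic_relation hρ (fun i x => i.1.2.2 x) hs' ht hrel) hc
    simpa using h1
  exact hasRankGenerators_of_finrank_le hle

/-- With fewer than dim P harmonic generators the padded value matrix would have a zero row. Only
the number of generators enters, not reflections, so this also serves G/N acting on E. -/
theorem HasRankGenerators.finrank_eq (h : HasRankGenerators ρ τ) (hf : IsFaithfulOnPoly ρ) :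
    finrank ℂ (harmonicEquivariants ρ τ) = finrank ℂ P := by
  obtain ⟨hfd, hle⟩ := h.finrank_le
  refine le_antisymm hle ?_
  by_contra! hlt
  obtain ⟨u, -, hspan, hzero⟩ := exists_padded_generators hle
  refine det_valueMatrix_ne_zero (τ := τ) hf (finBasis ℂ P) (u := u) hspan
    (Matrix.det_eq_zero_of_row_eq_zero ⟨_, hlt⟩ fun j => ?_)
  rw [valueMatrix, Matrix.of_apply, hzero _ le_rfl, LinearMap.zero_apply]

end Rank

end Equivariants

/-! ### Tensor invariants and equivariant maps -/

section TensorBridge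

variable {Γ : Type*} [Group Γ] {V : Type*} [AddCommGroup V] [Module ℂ V]
  {P : Type*} [AddCommGroup P] [Module ℂ P]

/-- The map sending `f ⊗ ξ` to the linear map `x ↦ ξ(x) f`. -/
def tensorToHom (K : Submodule ℂ (PolyRing V)) :
    K ⊗[ℂ] Dual ℂ P →ₗ[ℂ] (P →ₗ[ℂ] PolyRing V) :=
  LinearMap.llcomp ℂ P K (PolyRing V) K.subtype ∘ₗ dualTensorHom ℂ P K ∘ₗ
    (TensorProduct.comm ℂ K (Dual ℂ P)).toLinearMap

theorem tensorToHom_tmul (K : Submodule ℂ (PolyRing V)) (f : K) (ξ : Dual ℂ P) (x : P) :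
    tensorToHom K (f ⊗ₜ ξ) x = ξ x • (f : PolyRing V) := by
  simp [tensorToHom]

theorem tensorToHom_mem (K : Submodule ℂ (PolyRing V)) (t : K ⊗[ℂ] Dual ℂ P) (x : P) :
    tensorToHom K t x ∈ K :=
  (dualTensorHom ℂ P K (TensorProduct.comm ℂ K (Dual ℂ P) t) x).2

variable [FiniteDimensional ℂ P]

theorem tensorToHom_injective (K : Submodule ℂ (PolyRing V)) :
    Function.Injective (tensorToHom (P := P) K) := by
  intro s t h
  apply (TensorProduct.comm ℂ K (Dual ℂ P)).injective
  apply dualTensorHom_bijective.injective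
  exact LinearMap.ext fun x => Subtype.ext (DFunLike.congr_fun h x)

theorem exists_tensorToHom_eq (K : Submodule ℂ (PolyRing V)) {φ : P →ₗ[ℂ] PolyRing V}
    (hφ : ∀ x, φ x ∈ K) : ∃ t, tensorToHom K t = φ := by
  obtain ⟨s, hs⟩ := (dualTensorHom_bijective (R := ℂ) (M := P) (N := K)).surjective
    (φ.codRestrict K hφ)
  refine ⟨(TensorProduct.comm ℂ K (Dual ℂ P)).symm s, LinearMap.ext fun x => ?_⟩
  have h1 := DFunLike.congr_fun hs x
  have h2 : tensorToHom K ((TensorProduct.comm ℂ K (Dual ℂ P)).symm s) x =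
      (dualTensorHom ℂ P K s x : PolyRing V) := by
    change ((dualTensorHom ℂ P K ((TensorProduct.comm ℂ K (Dual ℂ P))
      ((TensorProduct.comm ℂ K (Dual ℂ P)).symm s)) x : K) : PolyRing V) = _
    rw [LinearEquiv.apply_symm_apply]
  rw [h2, h1]
  rfl

omit [FiniteDimensional ℂ P] in
theorem tensorToHom_tprod (ρ : Representation ℂ Γ V) (τ : Representation ℂ Γ P)
    {K : Submodule ℂ (PolyRing V)} (σ : Representation ℂ Γ K)
    (hσ : ∀ g (a : K), ((σ g a : K) : PolyRing V) = polyAct ρ g a) (g : Γ)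
    (t : K ⊗[ℂ] Dual ℂ P) (x : P) :
    tensorToHom K (σ.tprod τ.dual g t) x = polyAct ρ g (tensorToHom K t (τ g⁻¹ x)) := by
  induction t using TensorProduct.induction_on with
  | zero => simp
  | tmul f ξ =>
    rw [Representation.tprod_apply, TensorProduct.map_tmul, tensorToHom_tmul, tensorToHom_tmul,
      hσ, map_smul]
    rfl
  | add s t hs ht => simp only [map_add, LinearMap.add_apply, hs, ht]

/-- Stated for any stable space K of polynomials, to cover both the graded harmonics defining
exponents and the N-harmonics defining the Orlik-Solomon space. -/
theorem map_tensorToHom_invariants (ρ : Representation ℂ Γ V) (τ : Representation ℂ Γ P)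
    {K : Submodule ℂ (PolyRing V)} (σ : Representation ℂ Γ K)
    (hσ : ∀ g (a : K), ((σ g a : K) : PolyRing V) = polyAct ρ g a) (φ : P →ₗ[ℂ] PolyRing V) :
    φ ∈ (Representation.invariants (V := K ⊗[ℂ] Dual ℂ P) (σ.tprod τ.dual)).map
      (tensorToHom K) ↔ φ ∈ equivariants ρ τ ∧ ∀ x, φ x ∈ K := by
  constructor
  · rintro ⟨t, ht, rfl⟩
    refine ⟨fun g x => ?_, tensorToHom_mem K t⟩
    have h1 := tensorToHom_tprod ρ τ σ hσ g t (τ g x)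
    rw [ht g, ← Module.End.mul_apply, ← map_mul, inv_mul_cancel, map_one] at h1
    exact h1
  · rintro ⟨hφ, hK⟩
    obtain ⟨t, rfl⟩ := exists_tensorToHom_eq K hK
    refine ⟨t, fun g => tensorToHom_injective K (LinearMap.ext fun x => ?_), rfl⟩
    rw [tensorToHom_tprod ρ τ σ hσ, ← hφ g, ← Module.End.mul_apply, ← map_mul, mul_inv_cancel,
      map_one]
    rfl

variable (ρ : Representation ℂ Γ V) (τ : Representation ℂ Γ P)

variable (V P) in
/-- The linear maps from `P` to the homogeneous polynomials of degree `d`. -/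
def homogeneousHom (d : ℕ) : Submodule ℂ (P →ₗ[ℂ] PolyRing V) where
  carrier := {φ | ∀ x, φ x ∈ homogeneousPart V d}
  zero_mem' _ := Submodule.zero_mem _
  add_mem' ha hb x := Submodule.add_mem _ (ha x) (hb x)
  smul_mem' c _ ha x := Submodule.smul_mem _ c (ha x)

theorem coeff_fakeDegree (d : ℕ) : PowerSeries.coeff d (fakeDegree ρ τ) =
    finrank ℂ ↥(harmonicEquivariants ρ τ ⊓ homogeneousHom V P d) := by
  rw [fakeDegree, PowerSeries.coeff_mk]
  have h1 : (Representation.invariants (V := harmonicPart ρ d ⊗[ℂ] Dual ℂ P)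
      ((harmonicPartRep ρ d).tprod τ.dual)).map (tensorToHom (harmonicPart ρ d)) =
        harmonicEquivariants ρ τ ⊓ homogeneousHom V P d := by
    ext φ
    rw [map_tensorToHom_invariants ρ τ (harmonicPartRep ρ d) (fun _ _ => rfl)]
    constructor
    · rintro ⟨h, h'⟩
      exact ⟨⟨h, fun x => (h' x).1⟩, fun x => (h' x).2⟩
    · rintro ⟨⟨h, h'⟩, h''⟩
      exact ⟨h, fun x => ⟨h' x, h'' x⟩⟩
  rw [← h1]
  exact (Submodule.equivMapOfInjective _ (tensorToHom_injective _) _).finrank_eq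

theorem areExponents_iff {ι : Type*} [Fintype ι] (e : ι → ℕ) : AreExponents ρ τ e ↔
    ∀ d, finrank ℂ ↥(harmonicEquivariants ρ τ ⊓ homogeneousHom V P d) =
      Nat.card {i // e i = d} := by
  rw [AreExponents, PowerSeries.ext_iff]
  refine forall_congr' fun d => ?_
  rw [coeff_fakeDegree, map_sum]
  simp_rw [PowerSeries.coeff_X_pow]
  rw [Finset.sum_boole, Nat.card_eq_fintype_card, Fintype.card_subtype]
  simp_rw [eq_comm (a := d)]
  rfl

end TensorBridge

/-! ### Bases adapted to a grading -/

section GradedBases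

variable {F : Type*} [AddCommGroup F] [Module ℂ F] {K : Submodule ℂ F} {A : ℕ → Submodule ℂ F}

/-- The projections separate the degrees and the last hypothesis supplies spanning, so the ambient
space needs no decomposition of its own. -/
theorem isInternal_of_projections {pr : ℕ → F →ₗ[ℂ] F} (hpr : ∀ d, ∀ x ∈ A d, pr d x = x)
    (hpr' : ∀ d e, d ≠ e → ∀ x ∈ A d, pr e x = 0) (hK : ∀ x ∈ K, x ∈ ⨆ d, K ⊓ A d) :
    DirectSum.IsInternal fun d => (A d).comap K.subtype := by
  refine DirectSum.isInternal_submodule_of_iSupIndep_of_iSup_eq_top ?_ ?_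
  · rw [iSupIndep_def]
    intro d
    rw [Submodule.disjoint_def]
    intro x hx hx'
    have h1 : (⨆ e, ⨆ (_ : e ≠ d), (A e).comap K.subtype) ≤
        LinearMap.ker (pr d ∘ₗ K.subtype) :=
      iSup₂_le fun e he y hy => hpr' e d he y hy
    have h2 : pr d x = 0 := h1 hx'
    rw [hpr d x hx] at h2
    exact Subtype.ext h2
  · rw [eq_top_iff]
    intro x _
    have h1 : (⨆ d, K ⊓ A d) ≤ (⨆ d, (A d).comap K.subtype).map K.subtype := by
      refine iSup_le fun d y hy => ?_
      exact ⟨⟨y, hy.1⟩, Submodule.mem_iSup_of_mem d hy.2, rfl⟩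
    obtain ⟨y, hy, hyx⟩ := h1 (hK x x.2)
    rwa [show y = x from Subtype.ext hyx] at hy

theorem finrank_comap_subtype (d : ℕ) :
    finrank ℂ ((A d).comap K.subtype) = finrank ℂ ↥(K ⊓ A d) := by
  rw [← Submodule.map_comap_subtype]
  exact (Submodule.equivMapOfInjective _ K.injective_subtype _).finrank_eq

variable [FiniteDimensional ℂ K]

theorem exists_degrees (h : DirectSum.IsInternal fun d => (A d).comap K.subtype) :
    ∃ e : Fin (finrank ℂ K) → ℕ, ∀ d,
      finrank ℂ ↥(K ⊓ A d) = Nat.card {i // e i = d} := by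
  classical
  let B := h.collectedBasis fun d => finBasis ℂ ((A d).comap K.subtype)
  let _ := FiniteDimensional.fintypeBasisIndex B
  let ε : Fin (finrank ℂ K) ≃ Σ d, Fin (finrank ℂ ((A d).comap K.subtype)) :=
    Fintype.equivOfCardEq (by rw [Fintype.card_fin, finrank_eq_card_basis B])
  refine ⟨fun i => (ε i).1, fun d => ?_⟩
  rw [← finrank_comap_subtype, ← Nat.card_fin (finrank ℂ ((A d).comap K.subtype))]
  exact Nat.card_congr ((ε.subtypeEquiv fun i => Iff.rfl).trans (Equiv.sigmaSubtype d)).symm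

theorem exists_basis_of_degrees (h : DirectSum.IsInternal fun d => (A d).comap K.subtype)
    {ι : Type*} [Fintype ι] {e : ι → ℕ}
    (he : ∀ d, finrank ℂ ↥(K ⊓ A d) = Nat.card {i // e i = d}) :
    ∃ u : Basis ι ℂ K, ∀ i, (u i : F) ∈ A (e i) := by
  classical
  have hc : ∀ d, finrank ℂ ((A d).comap K.subtype) = Fintype.card {i // e i = d} := fun d => by
    rw [finrank_comap_subtype, he, Nat.card_eq_fintype_card]
  let B := h.collectedBasis fun d => (finBasis ℂ ((A d).comap K.subtype)).reindex
    (Fintype.equivOfCardEq (by rw [Fintype.card_fin, hc]) : _ ≃ {i // e i = d})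
  refine ⟨B.reindex (Equiv.sigmaFiberEquiv e), fun i => ?_⟩
  rw [Basis.reindex_apply]
  have h1 : (B ((Equiv.sigmaFiberEquiv e).symm i) : F) ∈
      A ((Equiv.sigmaFiberEquiv e).symm i).1 := h.collectedBasis_mem _ _
  exact h1

end GradedBases

/-! ### Homogeneous bases of harmonic equivariants realizing the exponents -/

section HarmonicBases

variable {Γ : Type*} [Group Γ] [Finite Γ] {V : Type*} [AddCommGroup V] [Module ℂ V]
  [FiniteDimensional ℂ V] {P : Type*} [AddCommGroup P] [Module ℂ P] [FiniteDimensional ℂ P]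
  (ρ : Representation ℂ Γ V) (τ : Representation ℂ Γ P)

theorem mem_iSup_harmonicEquivariants {φ : P →ₗ[ℂ] PolyRing V}
    (hφ : φ ∈ harmonicEquivariants ρ τ) :
    φ ∈ ⨆ d, harmonicEquivariants ρ τ ⊓ homogeneousHom V P d := by
  let b := finBasis ℂ P
  choose n hn using fun j => exists_sum_homComp (φ (b j))
  -- The values on a finite basis have degrees below a common bound.
  have h1 : φ = ∑ d ∈ Finset.range (Finset.univ.sup n), homComp d ∘ₗ φ := by
    refine b.ext fun j => ?_
    rw [LinearMap.sum_apply]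
    conv_lhs => rw [hn j]
    refine Finset.sum_subset (Finset.range_mono (Finset.le_sup (Finset.mem_univ j)))
      fun d _ hd => ?_
    change homComp d (φ (b j)) = 0
    rw [hn j, map_sum]
    refine Finset.sum_eq_zero fun i hi => homComp_ne (homComp_mem i _) ?_
    rintro rfl
    exact hd hi
  rw [h1]
  refine Submodule.sum_mem _ fun d _ => Submodule.mem_iSup_of_mem d ⟨⟨fun g x => ?_, fun x => ?_⟩,
    fun x => homComp_mem d _⟩
  · rw [LinearMap.comp_apply, LinearMap.comp_apply, hφ.1 g x, homComp_polyAct]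
  · exact homComp_mem_harmonics (hφ.2 x) d

variable {ρ τ}

theorem isInternal_harmonicEquivariants : DirectSum.IsInternal fun d =>
    (homogeneousHom V P d).comap (harmonicEquivariants ρ τ).subtype :=
  isInternal_of_projections (pr := fun d => LinearMap.llcomp ℂ P (PolyRing V) (PolyRing V)
      (homComp d))
    (fun _ _ hφ => LinearMap.ext fun x => homComp_self (hφ x))
    (fun _ _ hde _ hφ => LinearMap.ext fun x => homComp_ne (hφ x) hde)
    (fun _ hφ => mem_iSup_harmonicEquivariants ρ τ hφ)

theorem exists_areExponents [FiniteDimensional ℂ (harmonicEquivariants ρ τ)] :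
    ∃ e : Fin (finrank ℂ (harmonicEquivariants ρ τ)) → ℕ, AreExponents ρ τ e := by
  simp_rw [areExponents_iff]
  exact exists_degrees isInternal_harmonicEquivariants

theorem AreExponents.exists_basis [FiniteDimensional ℂ (harmonicEquivariants ρ τ)]
    {ι : Type*} [Fintype ι] {e : ι → ℕ} (he : AreExponents ρ τ e) :
    ∃ u : Basis ι ℂ (harmonicEquivariants ρ τ),
      ∀ i x, (u i : P →ₗ[ℂ] PolyRing V) x ∈ homogeneousPart V (e i) :=
  exists_basis_of_degrees isInternal_harmonicEquivariants ((areExponents_iff ρ τ e).mp he)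

end HarmonicBases

/-! ### Semi-invariants and the determinant criterion for amenability -/

section Determinants

variable {Γ : Type*} [Group Γ] {V : Type*} [AddCommGroup V] [Module ℂ V]
  {P : Type*} [AddCommGroup P] [Module ℂ P]
  (ρ : Representation ℂ Γ V) (τ : Representation ℂ Γ P)

/-- The polynomials on which the group acts through the determinant of `P`. -/
def detSemiinvariants : Submodule ℂ (PolyRing V) where
  carrier := {f | ∀ g, polyAct ρ g f = LinearMap.det (τ g) • f}
  zero_mem' g := by simp
  add_mem' ha hb g := by rw [map_add, ha g, hb g, smul_add]
  smul_mem' c a ha g := by rw [map_smul, ha g, smul_comm]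

variable {ρ τ}

/-- By equivariance, acting on the entries amounts to right multiplication by the constant matrix of
τ g. -/
theorem det_valueMatrix_mem {ι : Type*} [Fintype ι] [DecidableEq ι] (b : Basis ι ℂ P)
    {u : ι → P →ₗ[ℂ] PolyRing V} (hu : ∀ i, u i ∈ equivariants ρ τ) :
    (valueMatrix b u).det ∈ detSemiinvariants ρ τ := by
  intro g
  have h1 : (valueMatrix b u).map (polyAct ρ g) =
      valueMatrix b u * (LinearMap.toMatrix b b (τ g)).map (algebraMap ℂ (PolyRing V)) := by
    ext i j
    rw [Matrix.map_apply, valueMatrix, Matrix.of_apply, ← hu i g, Matrix.mul_apply,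
      ← b.sum_repr (τ g (b j)), map_sum]
    refine Finset.sum_congr rfl fun k _ => ?_
    rw [map_smul, Matrix.of_apply, Matrix.map_apply, LinearMap.toMatrix_apply, Algebra.smul_def,
      mul_comm]
  have h2 : polyAct ρ g (valueMatrix b u).det = ((valueMatrix b u).map (polyAct ρ g)).det :=
    AlgHom.map_det (polyAct ρ g) (valueMatrix b u)
  have h3 : ((LinearMap.toMatrix b b (τ g)).map (algebraMap ℂ (PolyRing V))).det =
      algebraMap ℂ (PolyRing V) (LinearMap.toMatrix b b (τ g)).det :=
    (RingHom.map_det (algebraMap ℂ (PolyRing V)) _).symm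
  rw [h2, h1, Matrix.det_mul, h3, LinearMap.det_toMatrix, mul_comm, ← Algebra.smul_def]

theorem det_valueMatrix_mem_homogeneousPart {ι : Type*} [Fintype ι] [DecidableEq ι] (b : ι → P)
    {u : ι → P →ₗ[ℂ] PolyRing V} {e : ι → ℕ} (hu : ∀ i x, u i x ∈ homogeneousPart V (e i)) :
    (valueMatrix b u).det ∈ homogeneousPart V (∑ i, e i) := by
  rw [Matrix.det_apply]
  refine Submodule.sum_mem _ fun σ _ => ?_
  rw [Units.smul_def]
  refine zsmul_mem ?_ _
  rw [← Equiv.sum_comp σ e]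
  exact homogeneousPart_prod_mem _ fun i _ => hu (σ i) (b i)

/-- The values of a family in the span of another one factor through a matrix of invariants. -/
theorem exists_valueMatrix_eq_mul {ι κ : Type*} [Fintype κ] {b : ι → P}
    {u v : κ → P →ₗ[ℂ] PolyRing V} (R : Subalgebra ℂ (PolyRing V))
    (h : ∀ i, u i ∈ Submodule.span R (Set.range v)) :
    ∃ a : Matrix κ κ (PolyRing V), (∀ i j, a i j ∈ R) ∧ valueMatrix b u = a * valueMatrix b v := by
  choose a ha using fun i => (Submodule.mem_span_range_iff_exists_fun _).mp (h i)
  refine ⟨Matrix.of fun i j => (a i j : PolyRing V), fun i j => (a i j).2, ?_⟩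
  ext i j
  rw [valueMatrix, Matrix.of_apply, ← ha i, Matrix.mul_apply, LinearMap.sum_apply]
  rfl

theorem det_mem_subalgebra {κ : Type*} [Fintype κ] [DecidableEq κ] (R : Subalgebra ℂ (PolyRing V))
    {a : Matrix κ κ (PolyRing V)} (ha : ∀ i j, a i j ∈ R) : a.det ∈ R := by
  rw [Matrix.det_apply]
  refine sum_mem fun σ _ => ?_
  rw [Units.smul_def]
  exact zsmul_mem (prod_mem fun i _ => ha _ _) _

variable (ρ τ) in
/-- The semi-invariants for the determinant of `P` are generated over the invariants by the
determinant of a family of equivariant maps. -/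
def HasDetGenerator {ι : Type*} [Fintype ι] [DecidableEq ι] (b : ι → P) : Prop :=
  ∃ u : ι → P →ₗ[ℂ] PolyRing V, (∀ i, u i ∈ equivariants ρ τ) ∧
    ∀ f ∈ detSemiinvariants ρ τ, ∃ r ∈ polyInvariants ρ, f = r * (valueMatrix b u).det

/-- Any equivariant family is an invariant matrix times a spanning one, so the determinant of the
spanning family divides the generator with invariant quotient. -/
theorem HasDetGenerator.of_span {ι : Type*} [Fintype ι] [DecidableEq ι] {b : ι → P}
    (h : HasDetGenerator ρ τ b) {v : ι → P →ₗ[ℂ] PolyRing V}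
    (hv : ∀ φ ∈ equivariants ρ τ, φ ∈ Submodule.span (polyInvariants ρ) (Set.range v)) :
    ∀ f ∈ detSemiinvariants ρ τ, ∃ r ∈ polyInvariants ρ, f = r * (valueMatrix b v).det := by
  obtain ⟨u, hu, hgen⟩ := h
  obtain ⟨a, ha, hau⟩ := exists_valueMatrix_eq_mul (b := b) (polyInvariants ρ)
    fun i => hv _ (hu i)
  intro f hf
  obtain ⟨r, hr, rfl⟩ := hgen f hf
  refine ⟨r * a.det, mul_mem hr (det_mem_subalgebra _ ha), ?_⟩
  rw [hau, Matrix.det_mul, mul_assoc]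

end Determinants

/-! ### Semi-invariants as equivariants of the top exterior power; the determinant criterion -/

section TopExteriorPower

theorem homComp_mul_of_lt' {V : Type*} [AddCommGroup V] [Module ℂ V] {f : PolyRing V} {j d : ℕ}
    (hf : f ∈ homogeneousPart V j) (r : PolyRing V) (h : d < j) : homComp d (r * f) = 0 := by
  rw [mul_comm, homComp_mul_of_lt hf _ h]

variable {Γ : Type*} [Group Γ] {V : Type*} [AddCommGroup V] [Module ℂ V]
  {P : Type*} [AddCommGroup P] [Module ℂ P] [FiniteDimensional ℂ P]
  {ρ : Representation ℂ Γ V} {τ : Representation ℂ Γ P}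

theorem finrank_topExteriorPower : finrank ℂ (⋀[ℂ]^(finrank ℂ P) P) = 1 := by
  rw [exteriorPower.finrank_eq, Nat.choose_self]

variable (P) in
/-- A linear coordinate on the top exterior power. -/
def volumeForm : ⋀[ℂ]^(finrank ℂ P) P →ₗ[ℂ] ℂ :=
  exteriorPower.alternatingMapLinearEquiv (finBasis ℂ P).det

variable (P) in
/-- A generator of the top exterior power. -/
def volumeElement : ⋀[ℂ]^(finrank ℂ P) P := exteriorPower.ιMulti ℂ _ (finBasis ℂ P)

theorem volumeForm_volumeElement : volumeForm P (volumeElement P) = 1 := by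
  rw [volumeForm, volumeElement, exteriorPower.alternatingMapLinearEquiv_apply_ιMulti,
    Basis.det_self]

theorem eq_smul_volumeElement (x : ⋀[ℂ]^(finrank ℂ P) P) :
    x = volumeForm P x • volumeElement P := by
  have h0 : volumeElement P ≠ 0 := fun h => by
    have := volumeForm_volumeElement (P := P)
    rw [h, map_zero] at this
    exact zero_ne_one this
  obtain ⟨c, hc⟩ := (finrank_eq_one_iff_of_nonzero' _ h0).mp finrank_topExteriorPower x
  rw [← hc, map_smul, volumeForm_volumeElement, smul_eq_mul, mul_one]

theorem extPow_volumeElement (g : Γ) : extPow (finrank ℂ P) τ g (volumeElement P) =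
    LinearMap.det (τ g) • volumeElement P := by
  rw [eq_smul_volumeElement (extPow (finrank ℂ P) τ g (volumeElement P))]
  congr 1
  change volumeForm P (exteriorPower.map _ (τ g) _) = _
  rw [volumeElement, exteriorPower.map_apply_ιMulti, volumeForm,
    exteriorPower.alternatingMapLinearEquiv_apply_ιMulti, Basis.det_comp, Basis.det_self, mul_one]

theorem apply_volumeElement_mem {φ : ⋀[ℂ]^(finrank ℂ P) P →ₗ[ℂ] PolyRing V}
    (hφ : φ ∈ equivariants ρ (extPow (finrank ℂ P) τ)) :
    φ (volumeElement P) ∈ detSemiinvariants ρ τ := fun g => by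
  rw [← hφ g, extPow_volumeElement, map_smul]

/-- Evaluation at the volume element identifies equivariant maps from the top exterior power with
semi-invariants; this is surjectivity. -/
theorem exists_equivariant_of_mem {f : PolyRing V} (hf : f ∈ detSemiinvariants ρ τ) :
    ∃ φ ∈ equivariants ρ (extPow (finrank ℂ P) τ), φ (volumeElement P) = f := by
  refine ⟨(volumeForm P).smulRight f, fun g x => ?_, ?_⟩
  · rw [LinearMap.smulRight_apply, LinearMap.smulRight_apply, map_smul, hf g]
    conv_lhs => rw [eq_smul_volumeElement x]
    rw [map_smul, extPow_volumeElement, map_smul, map_smul, volumeForm_volumeElement, smul_smul,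
      smul_eq_mul, mul_one, mul_smul]
  · rw [LinearMap.smulRight_apply, volumeForm_volumeElement, one_smul]

variable [Finite Γ] [FiniteDimensional ℂ V]

/-- A single exponent means that one homogeneous harmonic equivariant map spans over ℂ, hence
generates over R; w is its value at the volume element. -/
theorem AreExponents.exists_semiinvariant
    [FiniteDimensional ℂ (harmonicEquivariants ρ (extPow (finrank ℂ P) τ))]
    {e : ℕ} (he : AreExponents ρ (extPow (finrank ℂ P) τ) (fun _ : Fin 1 => e)) :
    ∃ w ∈ detSemiinvariants ρ τ, w ≠ 0 ∧ w ∈ homogeneousPart V e ∧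
      ∀ f ∈ detSemiinvariants ρ τ, ∃ r ∈ polyInvariants ρ, f = r * w := by
  obtain ⟨u, hu⟩ := he.exists_basis
  refine ⟨(u 0 : _ →ₗ[ℂ] PolyRing V) (volumeElement P), apply_volumeElement_mem (u 0).2.1, ?_,
    hu 0 _, fun f hf => ?_⟩
  · intro h0
    apply u.ne_zero 0
    refine Subtype.ext (LinearMap.ext fun x => ?_)
    rw [eq_smul_volumeElement x, map_smul, h0, smul_zero]
    rfl
  · obtain ⟨φ, hφ, rfl⟩ := exists_equivariant_of_mem hf
    obtain ⟨r, hr⟩ := (Submodule.mem_span_range_iff_exists_fun _).mp (mem_span_of_basis u hφ)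
    refine ⟨r 0, (r 0).2, ?_⟩
    rw [← hr, Fin.sum_univ_one]
    rfl

theorem exists_areExponents_of_finrank_eq [FiniteDimensional ℂ (harmonicEquivariants ρ τ)] {n : ℕ}
    (hn : finrank ℂ (harmonicEquivariants ρ τ) = n) : ∃ e : Fin n → ℕ, AreExponents ρ τ e := by
  subst hn
  exact exists_areExponents

theorem AreExponents.exists_generators [FiniteDimensional ℂ (harmonicEquivariants ρ τ)]
    {e : Fin (finrank ℂ P) → ℕ} (he : AreExponents ρ τ e) {ι : Type*} [Fintype ι] [DecidableEq ι]
    (b : Basis ι ℂ P) : ∃ v : ι → P →ₗ[ℂ] PolyRing V, (∀ i, v i ∈ equivariants ρ τ) ∧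
      (∀ φ ∈ equivariants ρ τ, φ ∈ Submodule.span (polyInvariants ρ) (Set.range v)) ∧
      (valueMatrix b v).det ∈ homogeneousPart V (∑ i, e i) := by
  let ε : Fin (finrank ℂ P) ≃ ι :=
    Fintype.equivOfCardEq (by rw [Fintype.card_fin, finrank_eq_card_basis b])
  obtain ⟨u, hu⟩ := he.exists_basis
  refine ⟨fun i => u (ε.symm i), fun i => (u _).2.1, fun φ hφ => ?_, ?_⟩
  · have h1 := mem_span_of_basis (u.reindex ε) hφ
    simpa only [Basis.reindex_apply] using h1
  · have h1 := det_valueMatrix_mem_homogeneousPart (b := b)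
      (u := fun i => ((u (ε.symm i) : harmonicEquivariants ρ τ) : P →ₗ[ℂ] PolyRing V))
      (e := fun i => e (ε.symm i)) fun i x => hu _ x
    rwa [Equiv.sum_comp ε.symm e] at h1

/-- Amenability means that the semi-invariants for the determinant are generated by the
determinant of a family of equivariant maps. -/
theorem isAmenable_iff_hasDetGenerator (hf : IsFaithfulOnPoly ρ) (hτ : HasRankGenerators ρ τ)
    (hext : HasRankGenerators ρ (extPow (finrank ℂ P) τ)) {ι : Type*} [Fintype ι] [DecidableEq ι]
    (b : Basis ι ℂ P) : IsAmenable ρ τ ↔ HasDetGenerator ρ τ b := by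
  have hfd := hτ.finrank_le.1
  have hfd' := hext.finrank_le.1
  constructor
  · rintro ⟨e, e', he, he', hsum⟩
    obtain ⟨v, hv, hvspan, hdeg⟩ := he.exists_generators b
    rw [hsum] at hdeg
    obtain ⟨w, -, hw0, hwe, hw⟩ := he'.exists_semiinvariant
    have hne := det_valueMatrix_ne_zero hf b hvspan
    obtain ⟨r, hr, hD⟩ := hw _ (det_valueMatrix_mem b hv)
    -- Amenability gives both determinants the same degree, so the invariant quotient may be
    -- replaced by its constant term.
    have hDw : (valueMatrix b v).det = constTerm r • w := by
      rw [← homComp_self hdeg, hD, homComp_self_mul hwe]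
    have hc : constTerm r ≠ 0 := fun h0 => hne (by rw [hDw, h0, zero_smul])
    refine ⟨v, hv, fun f hf' => ?_⟩
    obtain ⟨r', hr', rfl⟩ := hw f hf'
    refine ⟨(constTerm r)⁻¹ • r', Subalgebra.smul_mem _ hr' _, ?_⟩
    rw [hDw, smul_mul_smul_comm, inv_mul_cancel₀ hc, one_smul]
  · intro hgen
    obtain ⟨e, he⟩ := exists_areExponents_of_finrank_eq (hτ.finrank_eq hf)
    obtain ⟨e', he'⟩ := exists_areExponents_of_finrank_eq
      ((hext.finrank_eq hf).trans finrank_topExteriorPower)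
    have he1 : e' = fun _ => e' 0 := funext fun i => congrArg e' (Subsingleton.elim i 0)
    rw [he1] at he'
    refine ⟨e, e' 0, he, he', ?_⟩
    obtain ⟨v, hv, hvspan, hdeg⟩ := he.exists_generators b
    obtain ⟨w, hw', hw0, hwe, hw⟩ := he'.exists_semiinvariant
    have hne := det_valueMatrix_ne_zero hf b hvspan
    obtain ⟨r, hr, hD⟩ := hw _ (det_valueMatrix_mem b hv)
    obtain ⟨r', hr', hwD⟩ := hgen.of_span hvspan w hw'
    -- Both D and w are nonzero and each is a multiple of the other, so neither has the larger
    -- degree.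
    refine le_antisymm (not_lt.mp fun hlt => hw0 ?_) (not_lt.mp fun hlt => hne ?_)
    · rw [← homComp_self hwe, hwD, homComp_mul_of_lt' hdeg _ hlt]
    · rw [← homComp_self hdeg, hD, homComp_mul_of_lt' hwe _ hlt]

end TopExteriorPower

/-! ### The Orlik-Solomon space -/

section DualBases

variable {R A W : Type*} [CommRing R] [CommRing A] [Algebra R A] [AddCommMonoid W] [Module R W]
  {ι : Type*} [Fintype ι] [DecidableEq ι]

/-- Invariance of the canonical element ∑ y_k* ⊗ y_k: an endomorphism of one factor moves to its
transpose on the other. -/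
theorem sum_dualBasis_mul_apply (y : Basis ι R W) (φ : Dual R W →ₗ[R] A) (ψ : W →ₗ[R] A)
    (T : W →ₗ[R] W) : ∑ k, φ (y.dualBasis k) * ψ (T (y k)) =
      ∑ j, φ (T.dualMap (y.dualBasis j)) * ψ (y j) := by
  have h1 : ∀ k, ψ (T (y k)) = ∑ j, y.dualBasis j (T (y k)) • ψ (y j) := fun k => by
    conv_lhs => rw [← y.sum_repr (T (y k))]
    rw [map_sum]
    refine Finset.sum_congr rfl fun j _ => ?_
    rw [map_smul, y.dualBasis_apply]
  have h2 : ∀ j, φ (T.dualMap (y.dualBasis j)) =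
      ∑ k, y.dualBasis j (T (y k)) • φ (y.dualBasis k) := fun j => by
    have h3 : T.dualMap (y.dualBasis j) = ∑ k, y.dualBasis j (T (y k)) • y.dualBasis k := by
      refine y.ext fun i => ?_
      rw [LinearMap.sum_apply]
      simp only [LinearMap.smul_apply, y.dualBasis_apply_self, LinearMap.dualMap_apply]
      simp
    rw [h3, map_sum]
    exact Finset.sum_congr rfl fun k _ => map_smul _ _ _
  simp_rw [h1, h2, Finset.mul_sum, Finset.sum_mul, mul_smul_comm, smul_mul_assoc]
  exact Finset.sum_comm

theorem toMatrix_dualMap (y : Basis ι R W) (T : W →ₗ[R] W) :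
    LinearMap.toMatrix y.dualBasis y.dualBasis T.dualMap =
      (LinearMap.toMatrix y y T).transpose := by
  ext i j
  simp only [LinearMap.toMatrix_apply, LinearMap.dualMap_apply, y.dualBasis_repr, y.dualBasis_apply,
    Matrix.transpose_apply]

theorem det_bilinear_map {L : Type*} [AddCommGroup L] [Module R L] (B : W →ₗ[R] L →ₗ[R] A)
    (y : Basis ι R W) (b : Basis ι R L) (T : W →ₗ[R] W) (S : L →ₗ[R] L) :
    (Matrix.of fun i j => B (T (y i)) (S (b j))).det =
      ((LinearMap.toMatrix y y T).det * LinearMap.det S) •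
        (Matrix.of fun i j => B (y i) (b j)).det := by
  have h1 : Matrix.of (fun i j => B (T (y i)) (S (b j))) =
      (LinearMap.toMatrix y y T).transpose.map (algebraMap R A) *
        Matrix.of (fun i j => B (y i) (b j)) * (LinearMap.toMatrix b b S).map (algebraMap R A) := by
    ext i j
    rw [Matrix.of_apply, ← b.sum_repr (S (b j)), map_sum, Matrix.mul_apply]
    refine Finset.sum_congr rfl fun k _ => ?_
    rw [map_smul, ← y.sum_repr (T (y i)), map_sum, LinearMap.sum_apply, Matrix.mul_apply,
      Matrix.map_apply, LinearMap.toMatrix_apply, mul_comm, ← Algebra.smul_def]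
    congr 1
    refine Finset.sum_congr rfl fun l _ => ?_
    rw [map_smul, LinearMap.smul_apply, Matrix.map_apply, Matrix.transpose_apply,
      LinearMap.toMatrix_apply, ← Algebra.smul_def]
    rfl
  have h3 : ∀ C : Matrix ι ι R, (C.map (algebraMap R A)).det = algebraMap R A C.det := fun C =>
    (RingHom.map_det _ C).symm
  rw [h1, Matrix.det_mul, Matrix.det_mul, h3, h3, Matrix.det_transpose, LinearMap.det_toMatrix,
    Algebra.smul_def, map_mul]
  ring

end DualBases

/-! ### The Orlik-Solomon determinant J and the transfer of the criterion between M and U -/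

section OrlikSolomon

variable {G : Type*} [Group G] {V : Type*} [AddCommGroup V] [Module ℂ V]
  {M : Type*} [AddCommGroup M] [Module ℂ M]
  (ρ : Representation ℂ G V) (N : Subgroup G) [N.Normal] (τ : Representation ℂ G M)

/-- The elements of the dual Orlik-Solomon space, as maps from `M` to `S(V*)`. -/
def osHom : OSDual ρ N τ →ₗ[ℂ] (M →ₗ[ℂ] PolyRing V) :=
  tensorToHom (harmonics (ρ.comp N.subtype)) ∘ₗ
    (tensorInvariants (harmonicRep ρ N) τ.dual N).subtype

theorem osHom_injective [FiniteDimensional ℂ M] : Function.Injective (osHom ρ N τ) :=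
  (tensorToHom_injective _).comp Subtype.val_injective

theorem range_osHom [FiniteDimensional ℂ M] : LinearMap.range (osHom ρ N τ) =
    harmonicEquivariants (ρ.comp N.subtype) (τ.comp N.subtype) := by
  ext φ
  rw [osHom, LinearMap.range_comp, Submodule.range_subtype]
  exact map_tensorToHom_invariants (ρ.comp N.subtype) (τ.comp N.subtype)
    ((harmonicRep ρ N).comp N.subtype) (fun _ _ => rfl) φ

/-- The dual Orlik-Solomon space is the space of `N`-equivariant maps from `M` to the
`N`-harmonic polynomials. -/
def osEquiv [FiniteDimensional ℂ M] :
    OSDual ρ N τ ≃ₗ[ℂ] harmonicEquivariants (ρ.comp N.subtype) (τ.comp N.subtype) :=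
  (LinearEquiv.ofInjective _ (osHom_injective ρ N τ)).trans
    (LinearEquiv.ofEq _ _ (range_osHom ρ N τ))

theorem coe_osEquiv [FiniteDimensional ℂ M] (y : OSDual ρ N τ) :
    (osEquiv ρ N τ y : M →ₗ[ℂ] PolyRing V) = osHom ρ N τ y :=
  rfl

theorem osHom_rep (g : G) (y : OSDual ρ N τ) (x : M) :
    osHom ρ N τ (tensorInvariantsRep (harmonicRep ρ N) τ.dual N g y) x =
      polyAct ρ g (osHom ρ N τ y (τ g⁻¹ x)) :=
  tensorToHom_tprod ρ τ (harmonicRep ρ N) (fun _ _ => rfl) g y x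

variable {ι : Type*} [Fintype ι] [DecidableEq ι] (y : Basis ι ℂ (OSDual ρ N τ))

theorem osRep_eq (g : G) : osRep ρ N τ g =
    (tensorInvariantsRep (harmonicRep ρ N) τ.dual N g⁻¹).dualMap := rfl

theorem det_osRep (g : G) : LinearMap.det (osRep ρ N τ g) =
    (LinearMap.toMatrix y y (tensorInvariantsRep (harmonicRep ρ N) τ.dual N g⁻¹)).det := by
  rw [← LinearMap.det_toMatrix y.dualBasis, osRep_eq, toMatrix_dualMap, Matrix.det_transpose]

/-- U and U* are contragredient, so their determinants are inverse; the product form avoids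
division. -/
theorem det_osRep_mul (g : G) :
    LinearMap.det (osRep ρ N τ g) *
      (LinearMap.toMatrix y y (tensorInvariantsRep (harmonicRep ρ N) τ.dual N g)).det = 1 := by
  rw [det_osRep ρ N τ y, ← Matrix.det_mul, ← LinearMap.toMatrix_mul y, ← map_mul,
    inv_mul_cancel, map_one]
  exact (congrArg Matrix.det (LinearMap.toMatrix_id y)).trans Matrix.det_one

/-- The value matrix of a basis of the dual Orlik-Solomon space. -/
def osMatrix {κ : Type*} (b : κ → M) : Matrix ι κ (PolyRing V) :=
  valueMatrix b fun k => osHom ρ N τ (y k)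

variable {ρ N τ}

/-- J has weight det_M / det_U: moving g through the values changes the basis of M by τ g and the
basis of U* by the action of g there. -/
theorem polyAct_det_osMatrix (b : Basis ι ℂ M) (g : G) :
    LinearMap.det (osRep ρ N τ g) • polyAct ρ g (osMatrix ρ N τ y b).det =
      LinearMap.det (τ g) • (osMatrix ρ N τ y b).det := by
  have h1 : (osMatrix ρ N τ y b).map (polyAct ρ g) = Matrix.of fun i j =>
      osHom ρ N τ (tensorInvariantsRep (harmonicRep ρ N) τ.dual N g (y i)) (τ g (b j)) := by
    ext i j
    rw [Matrix.of_apply, osHom_rep, ← Module.End.mul_apply, ← map_mul, inv_mul_cancel, map_one]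
    rfl
  have h2 : polyAct ρ g (osMatrix ρ N τ y b).det = ((osMatrix ρ N τ y b).map (polyAct ρ g)).det :=
    AlgHom.map_det (polyAct ρ g) _
  rw [h2, h1, det_bilinear_map, smul_smul, ← mul_assoc, det_osRep_mul, one_mul]
  rfl

theorem eq_zero_of_sum_mul_osHom (b : Basis ι ℂ M) (hJ : (osMatrix ρ N τ y b).det ≠ 0)
    {c : ι → PolyRing V} (hc : ∀ x, ∑ k, c k * osHom ρ N τ (y k) x = 0) : c = 0 :=
  Matrix.eq_zero_of_vecMul_eq_zero hJ (funext fun j => hc (b j))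

/-- A map from the Orlik-Solomon space to polynomials, contracted with the dual Orlik-Solomon
space. -/
def osLift (φ : OSSpace ρ N τ →ₗ[ℂ] PolyRing V) : M →ₗ[ℂ] PolyRing V :=
  ∑ k, LinearMap.mulLeft ℂ (φ (y.dualBasis k)) ∘ₗ osHom ρ N τ (y k)

theorem osLift_apply (φ : OSSpace ρ N τ →ₗ[ℂ] PolyRing V) (x : M) :
    osLift y φ x = ∑ k, φ (y.dualBasis k) * osHom ρ N τ (y k) x := by
  rw [osLift, LinearMap.sum_apply]
  rfl

theorem polyAct_osLift (φ : OSSpace ρ N τ →ₗ[ℂ] PolyRing V) (g : G) (x : M) :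
    polyAct ρ g (osLift y φ x) =
      ∑ k, polyAct ρ g (φ (osRep ρ N τ g⁻¹ (y.dualBasis k))) * osHom ρ N τ (y k) (τ g x) := by
  have h1 := sum_dualBasis_mul_apply y ((polyAct ρ g).toLinearMap ∘ₗ φ)
    (LinearMap.applyₗ (τ g x) ∘ₗ osHom ρ N τ) (tensorInvariantsRep (harmonicRep ρ N) τ.dual N g)
  rw [osLift_apply, map_sum]
  refine Eq.trans (Finset.sum_congr rfl fun k _ => ?_)
    (h1.trans (Finset.sum_congr rfl fun k _ => ?_))
  · rw [map_mul]
    congr 1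
    change _ = osHom ρ N τ (tensorInvariantsRep (harmonicRep ρ N) τ.dual N g (y k)) (τ g x)
    rw [osHom_rep, ← Module.End.mul_apply, ← map_mul, inv_mul_cancel, map_one]
    rfl
  · rw [osRep_eq, inv_inv]
    rfl

theorem osLift_mem {φ : OSSpace ρ N τ →ₗ[ℂ] PolyRing V} (hφ : φ ∈ equivariants ρ (osRep ρ N τ)) :
    osLift y φ ∈ equivariants ρ τ := fun g x => by
  rw [polyAct_osLift, osLift_apply]
  refine Finset.sum_congr rfl fun k _ => ?_
  rw [hφ g⁻¹, polyAct_self_inv]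

/-- As J is nonzero, the y_k are independent over S, so the coefficients of a lift are unique and
inherit its equivariance. -/
theorem mem_equivariants_of_osLift_mem (b : Basis ι ℂ M) (hJ : (osMatrix ρ N τ y b).det ≠ 0)
    {φ : OSSpace ρ N τ →ₗ[ℂ] PolyRing V} (hφ : osLift y φ ∈ equivariants ρ τ) :
    φ ∈ equivariants ρ (osRep ρ N τ) := by
  have key : ∀ g k, polyAct ρ g (φ (osRep ρ N τ g⁻¹ (y.dualBasis k))) = φ (y.dualBasis k) := by
    intro g
    refine congrFun (sub_eq_zero.mp (eq_zero_of_sum_mul_osHom y b hJ fun x => ?_))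
    have h1 := hφ g (τ g⁻¹ x)
    rw [polyAct_osLift, osLift_apply, ← Module.End.mul_apply, ← map_mul, mul_inv_cancel, map_one,
      Module.End.one_apply] at h1
    simp only [Pi.sub_apply, sub_mul, Finset.sum_sub_distrib]
    rw [h1, sub_self]
  intro g
  have h2 : φ ∘ₗ osRep ρ N τ g = (polyAct ρ g).toLinearMap ∘ₗ φ := y.dualBasis.ext fun k => by
    have h3 := congrArg (polyAct ρ g) (key g⁻¹ k)
    rw [polyAct_self_inv, inv_inv] at h3
    exact h3
  exact fun x => LinearMap.congr_fun h2 x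

theorem valueMatrix_osLift (b : ι → M) (φ : ι → OSSpace ρ N τ →ₗ[ℂ] PolyRing V) :
    valueMatrix b (fun i => osLift y (φ i)) =
      valueMatrix y.dualBasis φ * osMatrix ρ N τ y b := by
  ext i j
  rw [valueMatrix, Matrix.of_apply, osLift_apply, Matrix.mul_apply]
  rfl

/-- If f has weight det_U then f J has weight det_M, hence is an invariant times D_M = D_U J;
cancelling J shows that D_U generates. -/
theorem HasDetGenerator.osRep (b : Basis ι ℂ M) (hJ : (osMatrix ρ N τ y b).det ≠ 0)
    (hspan : ∀ φ ∈ equivariants (ρ.comp N.subtype) (τ.comp N.subtype),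
      φ ∈ Submodule.span (polyInvariants (ρ.comp N.subtype))
        (Set.range fun k => osHom ρ N τ (y k)))
    (h : HasDetGenerator ρ τ b) : HasDetGenerator ρ (osRep ρ N τ) y.dualBasis := by
  obtain ⟨u, hu, hgen⟩ := h
  choose a ha using fun i => (Submodule.mem_span_range_iff_exists_fun _).mp
    (hspan (u i) fun n x => hu i n x)
  -- The coefficients of u i over the y_k, read as values on the dual basis of U, give a map whose
  -- lift is u i.
  let φ : ι → OSSpace ρ N τ →ₗ[ℂ] PolyRing V := fun i =>
    y.dualBasis.constr ℂ fun k => (a i k : PolyRing V)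
  have hφ : ∀ i, osLift y (φ i) = u i := fun i => LinearMap.ext fun x => by
    rw [osLift_apply, ← ha i, LinearMap.sum_apply]
    refine Finset.sum_congr rfl fun k _ => ?_
    rw [Basis.constr_basis]
    rfl
  refine ⟨φ, fun i => mem_equivariants_of_osLift_mem y b hJ ((hφ i).symm ▸ hu i), fun f hf => ?_⟩
  have h1 : f * (osMatrix ρ N τ y b).det ∈ detSemiinvariants ρ τ := fun g => by
    rw [map_mul, hf g, smul_mul_assoc, ← mul_smul_comm, polyAct_det_osMatrix, mul_smul_comm]
  obtain ⟨r, hr, h2⟩ := hgen _ h1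
  refine ⟨r, hr, mul_right_cancel₀ hJ ?_⟩
  rw [h2, ← funext hφ, valueMatrix_osLift, Matrix.det_mul, mul_assoc]

/-- The criterion for N makes every det_M-semi-invariant of G equal to r J; then r has weight det_U,
so it is an invariant times D_U, and D_U J is the determinant of the lifted family. -/
theorem HasDetGenerator.of_osRep (b : Basis ι ℂ M) (hJ : (osMatrix ρ N τ y b).det ≠ 0)
    (hspan : ∀ φ ∈ equivariants (ρ.comp N.subtype) (τ.comp N.subtype),
      φ ∈ Submodule.span (polyInvariants (ρ.comp N.subtype))
        (Set.range fun k => osHom ρ N τ (y k)))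
    (hN : HasDetGenerator (ρ.comp N.subtype) (τ.comp N.subtype) b)
    (h : HasDetGenerator ρ (ReflectionInvariants.osRep ρ N τ) y.dualBasis) :
    HasDetGenerator ρ τ b := by
  obtain ⟨φ, hφ, hgen⟩ := h
  refine ⟨fun i => osLift y (φ i), fun i => osLift_mem y (hφ i), fun f hf => ?_⟩
  obtain ⟨r, hr, h1⟩ := hN.of_span hspan f fun n => hf n
  have h2 : r ∈ detSemiinvariants ρ (ReflectionInvariants.osRep ρ N τ) := fun g => by
    -- The weight of r is read off from those of f and J after cancelling the translate g J.
    have h3 : polyAct ρ g (osMatrix ρ N τ y b).det ≠ 0 := fun h0 => hJ <| by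
      rw [← polyAct_inv_self ρ g (osMatrix ρ N τ y b).det, h0, map_zero]
    have h4 : f = r * (osMatrix ρ N τ y b).det := h1
    refine mul_right_cancel₀ h3 ?_
    rw [← map_mul, ← h4, hf g, h4, ← mul_smul_comm, ← polyAct_det_osMatrix, mul_smul_comm,
      smul_mul_assoc]
  obtain ⟨s, hs, rfl⟩ := hgen r h2
  refine ⟨s, hs, ?_⟩
  rw [valueMatrix_osLift, Matrix.det_mul, ← mul_assoc]
  exact h1

theorem exists_osBasis [Finite G] [FiniteDimensional ℂ V] [FiniteDimensional ℂ M]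
    (hf : IsFaithfulOnPoly (ρ.comp N.subtype))
    (hN : HasRankGenerators (ρ.comp N.subtype) (τ.comp N.subtype)) (b : Basis ι ℂ M) :
    ∃ y : Basis ι ℂ (OSDual ρ N τ), (osMatrix ρ N τ y b).det ≠ 0 ∧
      ∀ φ ∈ equivariants (ρ.comp N.subtype) (τ.comp N.subtype),
        φ ∈ Submodule.span (polyInvariants (ρ.comp N.subtype))
          (Set.range fun k => osHom ρ N τ (y k)) := by
  have hfd := hN.finrank_le.1
  let z := (finBasis ℂ (harmonicEquivariants (ρ.comp N.subtype) (τ.comp N.subtype))).reindex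
    (Fintype.equivOfCardEq (β := ι)
      (by rw [Fintype.card_fin, hN.finrank_eq hf, finrank_eq_card_basis b]))
  let y := z.map (osEquiv ρ N τ).symm
  have hy : ∀ k, osHom ρ N τ (y k) = z k := fun k => by
    rw [← coe_osEquiv, Basis.map_apply, LinearEquiv.apply_symm_apply]
  have hspan : ∀ φ ∈ equivariants (ρ.comp N.subtype) (τ.comp N.subtype),
      φ ∈ Submodule.span (polyInvariants (ρ.comp N.subtype))
        (Set.range fun k => osHom ρ N τ (y k)) := fun φ hφ => by
    rw [funext hy]
    exact mem_span_of_basis z hφ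
  exact ⟨y, det_valueMatrix_ne_zero hf b hspan, hspan⟩

end OrlikSolomon

/-! ### Descent to the quotient -/

section Descent

variable {G : Type*} [Group G] {N : Subgroup G} [N.Normal]
  {V : Type*} [AddCommGroup V] [Module ℂ V] {W : Type*} [AddCommGroup W] [Module ℂ W]
  {P : Type*} [AddCommGroup P] [Module ℂ P]
  {ρ : Representation ℂ G V} {σ : Representation ℂ (G ⧸ N) W} {π : Representation ℂ (G ⧸ N) P}

/-- An identification of the polynomials on `W` with the `N`-invariant polynomials on `V`. -/
structure IsDescent (ρ : Representation ℂ G V) (σ : Representation ℂ (G ⧸ N) W)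
    (Φ : PolyRing W →ₐ[ℂ] PolyRing V) : Prop where
  injective : Function.Injective Φ
  range_eq : Φ.range = polyInvariants (ρ.comp N.subtype)
  map_polyAct : ∀ (g : G) x, Φ (polyAct σ (g : G ⧸ N) x) = polyAct ρ g (Φ x)

namespace IsDescent

variable {Φ : PolyRing W →ₐ[ℂ] PolyRing V} (hΦ : IsDescent ρ σ Φ)
include hΦ

theorem exists_eq {f : PolyRing V} (hf : ∀ n : N, polyAct ρ (n : G) f = f) : ∃ x, Φ x = f := by
  have h1 : f ∈ Φ.range := hΦ.range_eq ▸ hf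
  exact h1

theorem mem_polyInvariants_iff {x : PolyRing W} :
    Φ x ∈ polyInvariants ρ ↔ x ∈ polyInvariants σ := by
  constructor
  · intro h g
    obtain ⟨g, rfl⟩ := QuotientGroup.mk_surjective g
    exact hΦ.injective ((hΦ.map_polyAct g x).trans (h g))
  · intro h g
    rw [← hΦ.map_polyAct, h]

theorem comp_mem_equivariants_iff {ψ : P →ₗ[ℂ] PolyRing W} :
    Φ.toLinearMap ∘ₗ ψ ∈ equivariants ρ (π.comp (QuotientGroup.mk' N)) ↔
      ψ ∈ equivariants σ π := by
  constructor
  · intro h g x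
    obtain ⟨g, rfl⟩ := QuotientGroup.mk_surjective g
    exact hΦ.injective ((h g x).trans (hΦ.map_polyAct g (ψ x)).symm)
  · intro h g x
    exact (congrArg Φ (h g x)).trans (hΦ.map_polyAct g (ψ x))

theorem mem_detSemiinvariants_iff {x : PolyRing W} :
    Φ x ∈ detSemiinvariants ρ (π.comp (QuotientGroup.mk' N)) ↔ x ∈ detSemiinvariants σ π := by
  constructor
  · intro h g
    obtain ⟨g, rfl⟩ := QuotientGroup.mk_surjective g
    exact hΦ.injective ((hΦ.map_polyAct g x).trans ((h g).trans (map_smul Φ _ _).symm))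
  · intro h g
    exact (hΦ.map_polyAct g x).symm.trans ((congrArg Φ (h g)).trans (map_smul Φ _ _))

/-- N acts trivially on P, so an equivariant map takes N-invariant values, which are exactly the
image of Φ. -/
theorem exists_comp_eq {φ : P →ₗ[ℂ] PolyRing V}
    (hφ : φ ∈ equivariants ρ (π.comp (QuotientGroup.mk' N))) :
    ∃ ψ ∈ equivariants σ π, Φ.toLinearMap ∘ₗ ψ = φ := by
  have h1 : ∀ x, φ x ∈ LinearMap.range Φ.toLinearMap := fun x => by
    refine hΦ.exists_eq fun n => ?_
    rw [← hφ]
    change φ (π ((n : G) : G ⧸ N) x) = φ x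
    rw [(QuotientGroup.eq_one_iff (n : G)).mpr n.2, map_one, Module.End.one_apply]
  let ψ : P →ₗ[ℂ] PolyRing W :=
    (LinearEquiv.ofInjective Φ.toLinearMap hΦ.injective).symm.toLinearMap ∘ₗ φ.codRestrict _ h1
  have h2 : Φ.toLinearMap ∘ₗ ψ = φ := LinearMap.ext fun x =>
    congrArg Subtype.val ((LinearEquiv.ofInjective Φ.toLinearMap hΦ.injective).apply_symm_apply
      ⟨φ x, h1 x⟩)
  exact ⟨ψ, hΦ.comp_mem_equivariants_iff.mp (h2.symm ▸ hφ), h2⟩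

omit hΦ in
theorem det_valueMatrix_comp {ι : Type*} [Fintype ι] [DecidableEq ι] (b : ι → P)
    (ψ : ι → P →ₗ[ℂ] PolyRing W) :
    (valueMatrix b fun i => Φ.toLinearMap ∘ₗ ψ i).det = Φ (valueMatrix b ψ).det :=
  (AlgHom.map_det Φ (valueMatrix b ψ)).symm

/-- Equivariants, semi-invariants, invariants and determinants all correspond under Φ, so both
criteria are the same statement inside S^N. -/
theorem hasDetGenerator_iff {ι : Type*} [Fintype ι] [DecidableEq ι] (b : ι → P) :
    HasDetGenerator ρ (π.comp (QuotientGroup.mk' N)) b ↔ HasDetGenerator σ π b := by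
  constructor
  · rintro ⟨u, hu, hgen⟩
    choose ψ hψ hψu using fun i => hΦ.exists_comp_eq (hu i)
    obtain rfl : (fun i => Φ.toLinearMap ∘ₗ ψ i) = u := funext hψu
    refine ⟨ψ, hψ, fun x hx => ?_⟩
    obtain ⟨r, hr, h1⟩ := hgen _ (hΦ.mem_detSemiinvariants_iff.mpr hx)
    obtain ⟨s, rfl⟩ := hΦ.exists_eq fun n => hr n
    refine ⟨s, hΦ.mem_polyInvariants_iff.mp hr, hΦ.injective ?_⟩
    rw [h1, det_valueMatrix_comp, map_mul]
  · rintro ⟨ψ, hψ, hgen⟩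
    refine ⟨fun i => Φ.toLinearMap ∘ₗ ψ i, fun i => hΦ.comp_mem_equivariants_iff.mpr (hψ i),
      fun f hf => ?_⟩
    obtain ⟨x, rfl⟩ : ∃ x, Φ x = f := hΦ.exists_eq fun n => by
      rw [hf]
      change LinearMap.det (π ((n : G) : G ⧸ N)) • f = f
      rw [(QuotientGroup.eq_one_iff (n : G)).mpr n.2, map_one, map_one, one_smul]
    obtain ⟨r, hr, rfl⟩ := hgen x (hΦ.mem_detSemiinvariants_iff.mp hf)
    exact ⟨Φ r, hΦ.mem_polyInvariants_iff.mpr hr, by rw [det_valueMatrix_comp, map_mul]⟩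

/-- Generators for G descend, together with their invariant coefficients. This replaces proving that
G/N is generated by reflections on W. -/
theorem hasRankGenerators (h : HasRankGenerators ρ (π.comp (QuotientGroup.mk' N))) :
    HasRankGenerators σ π := by
  obtain ⟨v, hv, hspan⟩ := h
  choose ψ hψ hψv using fun i => hΦ.exists_comp_eq (hv i)
  refine ⟨ψ, hψ, fun φ hφ => ?_⟩
  obtain ⟨c, hc⟩ := (Submodule.mem_span_range_iff_exists_fun _).mp
    (hspan _ (hΦ.comp_mem_equivariants_iff.mpr hφ))
  choose s hs using fun i => hΦ.exists_eq fun n => (c i).2 (n : G)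
  have hs' : ∀ i, s i ∈ polyInvariants σ := fun i =>
    hΦ.mem_polyInvariants_iff.mp (by rw [hs]; exact (c i).2)
  refine (Submodule.mem_span_range_iff_exists_fun _).mpr ⟨fun i => ⟨s i, hs' i⟩, ?_⟩
  refine LinearMap.ext fun x => hΦ.injective ?_
  have h1 := LinearMap.congr_fun hc x
  rw [LinearMap.sum_apply] at h1 ⊢
  rw [map_sum]
  refine (Finset.sum_congr rfl fun i _ => ?_).trans h1
  rw [← hψv i]
  change Φ (s i * ψ i x) = (c i : PolyRing V) * Φ (ψ i x)
  rw [map_mul, hs]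

/-- If g and h agree on N-invariants, they agree after averaging over N, which compares sums over
the cosets gN and hN. Dedekind for G then forces the cosets to coincide. -/
theorem isFaithfulOnPoly [Finite G] (hρ : IsFaithfulOnPoly ρ) : IsFaithfulOnPoly σ := by
  classical
  have := Fintype.ofFinite G
  intro g h hgh
  obtain ⟨g, rfl⟩ := QuotientGroup.mk_surjective g
  obtain ⟨h, rfl⟩ := QuotientGroup.mk_surjective h
  have h1 : ∀ f, polyAct ρ g (polyAverage (ρ.comp N.subtype) f) =
      polyAct ρ h (polyAverage (ρ.comp N.subtype) f) := fun f => by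
    obtain ⟨x, hx⟩ := hΦ.exists_eq (polyAverage_mem (ρ.comp N.subtype) f)
    rw [← hx, ← hΦ.map_polyAct, ← hΦ.map_polyAct]
    exact congrArg (fun T => Φ (T x)) hgh
  -- The sum over gN is written over all of G with indicator coefficients, the shape required by
  -- Dedekind's theorem.
  have h2 : ∀ (g : G) f, polyAct ρ g (polyAverage (ρ.comp N.subtype) f) =
      (Nat.card N : ℂ)⁻¹ • ∑ x : G, (if g⁻¹ * x ∈ N then (1 : PolyRing V) else 0) *
        polyAct ρ x f := fun g f => by
    rw [polyAverage_apply, map_smul, map_sum]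
    congr 1
    rw [← Equiv.sum_comp (Equiv.mulLeft g)]
    change ∑ n : N, polyAct ρ g (polyAct ρ (n : G) f) = _
    rw [← Finset.sum_subtype (Finset.univ.filter (· ∈ N)) (by simp)
      (fun x => polyAct ρ g (polyAct ρ x f)), Finset.sum_filter]
    refine Finset.sum_congr rfl fun x _ => ?_
    rw [Equiv.coe_mulLeft, inv_mul_cancel_left, polyAct_mul, ite_mul, one_mul, zero_mul]
    rfl
  have h3 := hρ.eq_zero_of_sum (a := fun x => (if g⁻¹ * x ∈ N then (1 : PolyRing V) else 0) -
    (if h⁻¹ * x ∈ N then (1 : PolyRing V) else 0)) fun f => by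
      have h4 := h1 f
      rw [h2, h2] at h4
      have h5 := smul_right_injective (PolyRing V)
        (inv_ne_zero (Nat.cast_ne_zero.mpr (Nat.card_pos (α := N)).ne')) h4
      simp only [sub_mul, Finset.sum_sub_distrib]
      rw [sub_eq_zero]
      exact h5
  have h4 := congrFun h3 g
  simp only [inv_mul_cancel, one_mem, if_true, Pi.zero_apply] at h4
  by_cases h5 : h⁻¹ * g ∈ N
  · exact (QuotientGroup.eq.mpr h5).symm
  · rw [if_neg h5, sub_zero] at h4
    exact absurd h4 one_ne_zero

end IsDescent

end Descent

theorem dual_dual_evalEquiv {H K : Type*} [Group H] [AddCommMonoid K] [Module ℂ K]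
    [Module.IsReflexive ℂ K] (σ : Representation ℂ H K) (h : H) (c : K) :
    σ.dual.dual h (evalEquiv ℂ K c) = evalEquiv ℂ K (σ h c) := by
  refine LinearMap.ext fun η => ?_
  change η (σ h⁻¹⁻¹ c) = η (σ h c)
  rw [inv_inv]

/-! ### Polynomials on E = V/N as N-invariant polynomials on V -/

namespace LinearQuotient

variable {G : Type*} [Group G] {V : Type*} [AddCommGroup V] [Module ℂ V]
  {ρ : Representation ℂ G V} {N : Subgroup G} (E : LinearQuotient ρ N)

theorem exists_basis : ∃ b : Basis (Fin (finrank ℂ V)) ℂ E.coords,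
    AlgebraicIndependent ℂ (fun i => (b i : PolyRing V)) ∧
      Algebra.adjoin ℂ (Set.range fun i => (b i : PolyRing V)) =
        polyInvariants (ρ.comp N.subtype) := by
  obtain ⟨f, -, hf, hadj, hspan⟩ := E.exists_generators
  let b := (Basis.span hf.linearIndependent).map (LinearEquiv.ofEq _ _ hspan)
  have hb : (fun i => (b i : PolyRing V)) = f := funext fun i => by
    rw [Basis.map_apply, LinearEquiv.coe_ofEq_apply, Basis.span_apply]
  refine ⟨b, hb.symm ▸ hf, ?_⟩
  rw [hb]
  exact SetLike.ext fun x => SetLike.ext_iff.mp hadj x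

instance : Module.Finite ℂ E.coords :=
  Module.Finite.of_basis E.exists_basis.choose

instance : Module.IsReflexive ℂ E.coords := by
  have h : Module.Projective ℂ E.coords := Module.Projective.of_basis E.exists_basis.choose
  infer_instance

/-- The identification of the polynomials on `E` with invariant polynomials on `V`. -/
def toPolyRing : PolyRing (Dual ℂ E.coords) →ₐ[ℂ] PolyRing V :=
  SymmetricAlgebra.lift (E.coords.subtype ∘ₗ (evalEquiv ℂ E.coords).symm.toLinearMap)

theorem toPolyRing_ι (ξ : Dual ℂ (Dual ℂ E.coords)) :
    E.toPolyRing (SymmetricAlgebra.ι ℂ _ ξ) = ((evalEquiv ℂ E.coords).symm ξ : PolyRing V) := by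
  simp [toPolyRing]

theorem toPolyRing_polyAct [N.Normal] (g : G) (x : PolyRing (Dual ℂ E.coords)) :
    E.toPolyRing (polyAct E.rep (g : G ⧸ N) x) = polyAct ρ g (E.toPolyRing x) := by
  induction x using SymmetricAlgebra.induction with
  | algebraMap r => simp only [AlgHom.commutes]
  | ι ξ =>
    obtain ⟨c, rfl⟩ := (evalEquiv ℂ E.coords).surjective ξ
    have h1 : E.rep.dual (g : G ⧸ N) (evalEquiv ℂ E.coords c) =
        evalEquiv ℂ E.coords (E.coordsRep (g : G ⧸ N) c) := dual_dual_evalEquiv E.coordsRep _ c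
    rw [polyAct_ι, h1, toPolyRing_ι, toPolyRing_ι, LinearEquiv.symm_apply_apply,
      LinearEquiv.symm_apply_apply]
    rfl
  | mul a b ha hb => simp only [map_mul, ha, hb]
  | add a b ha hb => simp only [map_add, ha, hb]

/-- In a basis of E* made of generators, the map evaluates polynomials at those generators:
algebraic independence gives injectivity, and generation of the invariant ring gives the image. -/
theorem isDescent [N.Normal] : IsDescent ρ E.rep E.toPolyRing := by
  obtain ⟨b, hb, hadj⟩ := E.exists_basis
  let e := SymmetricAlgebra.equivMvPolynomial (b.map (evalEquiv ℂ E.coords))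
  have h1 : E.toPolyRing = (MvPolynomial.aeval fun i => (b i : PolyRing V)).comp e.toAlgHom := by
    apply SymmetricAlgebra.algHom_ext
    refine (b.map (evalEquiv ℂ E.coords)).ext fun i => ?_
    change E.toPolyRing (SymmetricAlgebra.ι ℂ _ _) =
      MvPolynomial.aeval _ (e (SymmetricAlgebra.ι ℂ _ _))
    rw [toPolyRing_ι, SymmetricAlgebra.equivMvPolynomial_ι_apply, MvPolynomial.aeval_X,
      Basis.map_apply, LinearEquiv.symm_apply_apply]
  refine ⟨?_, ?_, fun g x => ?_⟩
  · rw [h1]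
    exact (show Function.Injective (MvPolynomial.aeval _) from hb).comp e.injective
  · rw [← hadj, Algebra.adjoin_range_eq_range_aeval, h1, AlgHom.range_comp]
    have h2 : e.toAlgHom.range = ⊤ := (AlgHom.range_eq_top _).mpr e.surjective
    exact (congrArg (Subalgebra.map _) h2).trans (Algebra.map_top _)
  · exact E.toPolyRing_polyAct g x
end LinearQuotient

/-! ### Complex reflection groups -/

section ReflectionGroups

variable {V : Type*} [AddCommGroup V] [Module ℂ V]

theorem isFaithfulOnPoly_of_injective {Γ : Type*} [Group Γ] {ρ : Representation ℂ Γ V}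
    (hρ : Function.Injective ρ) : IsFaithfulOnPoly ρ := by
  intro g h hgh
  have h1 : ∀ ξ, ρ.dual g ξ = ρ.dual h ξ := fun ξ => by
    have h2 := DFunLike.congr_fun hgh (SymmetricAlgebra.ι ℂ (Dual ℂ V) ξ)
    rw [polyAct_ι, polyAct_ι, ← sub_eq_zero, ← map_sub] at h2
    by_contra h3
    exact ι_ne_zero (sub_ne_zero.mpr h3) h2
  refine inv_injective (hρ (LinearMap.ext fun v => ?_))
  exact sub_eq_zero.mp ((Module.forall_dual_apply_eq_zero_iff ℂ _).mp fun ξ => by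
    rw [map_sub, sub_eq_zero]
    exact LinearMap.congr_fun (h1 ξ) v)

/-- A linear form and its translate agree on the fixed hyperplane, and the forms vanishing there
make up a line, spanned by l. -/
theorem IsReflection.fixesHyperplane [FiniteDimensional ℂ V] {Γ : Type*} [Group Γ]
    {ρ : Representation ℂ Γ V} {x : Γ} {g : LinearMap.GeneralLinearGroup ℂ V}
    (hg : IsReflection g) (hx : ρ x = (g : V →ₗ[ℂ] V)) : FixesHyperplane ρ x := by
  obtain ⟨-, W, hW, hfix⟩ := hg
  have h1 : finrank ℂ W.dualAnnihilator = 1 := by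
    have := Subspace.finrank_add_finrank_dualAnnihilator_eq W
    omega
  obtain ⟨⟨l, hl⟩, hl0, hspan⟩ := finrank_eq_one_iff'.mp h1
  refine ⟨l, fun h => hl0 (Subtype.ext h), fun ξ => ?_⟩
  have h2 : ρ.dual x ξ - ξ ∈ W.dualAnnihilator := by
    rw [Submodule.mem_dualAnnihilator]
    intro w hw
    have h3 : ρ x⁻¹ w = w := by
      conv_lhs => rw [← hfix w hw, ← hx, ← Module.End.mul_apply, ← map_mul, inv_mul_cancel, map_one]
      rfl
    change ξ (ρ x⁻¹ w) - ξ w = 0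
    rw [h3, sub_self]
  obtain ⟨c, hc⟩ := hspan ⟨_, h2⟩
  refine ⟨c, ?_⟩
  exact sub_eq_iff_eq_add'.mp (congrArg Subtype.val hc).symm

/-- Turns generation inside the ambient group into generation of the subgroup as a group in its own
right. -/
theorem closure_preimage_eq_top {Γ : Type*} [Group Γ] (S : Subgroup Γ) {p : Γ → Prop}
    (h : Subgroup.closure {g | g ∈ S ∧ p g} = S) : Subgroup.closure {x : S | p x} = ⊤ := by
  apply Subgroup.map_injective S.subtype_injective
  rw [MonoidHom.map_closure, ← MonoidHom.range_eq_map, Subgroup.range_subtype]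
  convert h using 2
  ext g
  constructor
  · rintro ⟨x, hx, rfl⟩
    exact ⟨x.2, hx⟩
  · rintro ⟨hS, hp⟩
    exact ⟨⟨g, hS⟩, hp, rfl⟩

variable {G : Subgroup (LinearMap.GeneralLinearGroup ℂ V)}

theorem naturalRep_injective : Function.Injective (naturalRep G) :=
  Units.val_injective.comp Subtype.val_injective

variable [FiniteDimensional ℂ V]

theorem IsComplexReflectionGroup.generatedByReflections (hG : IsComplexReflectionGroup G) :
    GeneratedByReflections (naturalRep G) := by
  refine top_le_iff.mp ?_
  rw [← closure_preimage_eq_top G hG.2]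
  exact Subgroup.closure_mono fun x hx => hx.fixesHyperplane rfl

theorem IsReflectionSubgroup.generatedByReflections {N : Subgroup G} (hN : IsReflectionSubgroup N) :
    GeneratedByReflections ((naturalRep G).comp N.subtype) := by
  refine top_le_iff.mp ?_
  rw [← closure_preimage_eq_top N
    (p := fun n => IsReflection (n : LinearMap.GeneralLinearGroup ℂ V)) hN]
  exact Subgroup.closure_mono fun x hx => IsReflection.fixesHyperplane hx rfl

end ReflectionGroups

/-! ### Amenability for reflection groups and for the quotient acting on E -/

section Amenability

variable {V M : Type*} [AddCommGroup V] [Module ℂ V] [FiniteDimensional ℂ V]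
  [AddCommGroup M] [Module ℂ M] [FiniteDimensional ℂ M]

theorem isAmenable_iff_of_generatedByReflections {Γ : Type*} [Group Γ] [Finite Γ]
    {ρ : Representation ℂ Γ V} (hf : IsFaithfulOnPoly ρ) (hρ : GeneratedByReflections ρ)
    (τ : Representation ℂ Γ M) {ι : Type*} [Fintype ι] [DecidableEq ι] (b : Basis ι ℂ M) :
    IsAmenable ρ τ ↔ HasDetGenerator ρ τ b :=
  isAmenable_iff_hasDetGenerator hf (.of_generatedByReflections hf hρ τ)
    (.of_generatedByReflections hf hρ _) b

theorem LinearQuotient.isAmenable_iff {G : Type*} [Group G] [Finite G]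
    {ρ : Representation ℂ G V} (hf : IsFaithfulOnPoly ρ) (hρ : GeneratedByReflections ρ)
    {N : Subgroup G} [N.Normal] (E : LinearQuotient ρ N) (π : Representation ℂ (G ⧸ N) M) :
    IsAmenable E.rep π ↔ IsAmenable ρ (π.comp (QuotientGroup.mk' N)) := by
  rw [isAmenable_iff_of_generatedByReflections hf hρ _ (finBasis ℂ M),
    isAmenable_iff_hasDetGenerator (E.isDescent.isFaithfulOnPoly hf)
      (E.isDescent.hasRankGenerators (.of_generatedByReflections hf hρ _))
      (E.isDescent.hasRankGenerators
        (π := extPow _ π) (.of_generatedByReflections hf hρ _)) (finBasis ℂ M)]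
  exact (E.isDescent.hasDetGenerator_iff _).symm

end Amenability

end ReflectionInvariants

end

open ReflectionInvariants in
theorem mainTheorem5 {V M : Type*}
    [AddCommGroup V] [Module ℂ V] [FiniteDimensional ℂ V]
    [AddCommGroup M] [Module ℂ M] [FiniteDimensional ℂ M]
    (G : Subgroup (LinearMap.GeneralLinearGroup ℂ V)) (hG : IsComplexReflectionGroup G)
    (N : Subgroup G) [N.Normal] (hN : IsReflectionSubgroup N)
    (τ : Representation ℂ G M) :
    (IsAmenable (naturalRep G) τ →
      IsAmenable (naturalRep G) (osRep (naturalRep G) N τ) ∧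
      ∀ E : LinearQuotient (naturalRep G) N,
        IsAmenable E.rep (osRepQuotient (naturalRep G) N τ)) ∧
    (IsAmenable ((naturalRep G).comp N.subtype) (τ.comp N.subtype) →
      (IsAmenable (naturalRep G) (osRep (naturalRep G) N τ) ∨
        ∃ E : LinearQuotient (naturalRep G) N,
          IsAmenable E.rep (osRepQuotient (naturalRep G) N τ)) →
      IsAmenable (naturalRep G) τ) := by
  have hfin := hG.1
  have hfG : IsFaithfulOnPoly (naturalRep G) := isFaithfulOnPoly_of_injective naturalRep_injective
  have hfN : IsFaithfulOnPoly ((naturalRep G).comp N.subtype) :=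
    isFaithfulOnPoly_of_injective (naturalRep_injective.comp Subtype.val_injective)
  have hrG := hG.generatedByReflections
  have hrN := hN.generatedByReflections
  let b := finBasis ℂ M
  obtain ⟨y, hJ, hspan⟩ := exists_osBasis hfN (.of_generatedByReflections hfN hrN _) b
  have hU : FiniteDimensional ℂ (OSSpace (naturalRep G) N τ) := Module.Finite.of_basis y.dualBasis
  -- Inflating the G/N-action on U along G → G/N gives back the G-action by definition, so
  -- amenability over H does not depend on E.
  have hE : ∀ E : LinearQuotient (naturalRep G) N,
      IsAmenable E.rep (osRepQuotient (naturalRep G) N τ) ↔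
        IsAmenable (naturalRep G) (osRep (naturalRep G) N τ) := fun E =>
    E.isAmenable_iff hfG hrG (osRepQuotient (naturalRep G) N τ)
  have h1 := isAmenable_iff_of_generatedByReflections hfG hrG τ b
  have h2 := isAmenable_iff_of_generatedByReflections hfN hrN (τ.comp N.subtype) b
  have h3 := isAmenable_iff_of_generatedByReflections hfG hrG (osRep (naturalRep G) N τ) y.dualBasis
  have hi : IsAmenable (naturalRep G) τ → IsAmenable (naturalRep G) (osRep (naturalRep G) N τ) :=
    fun h => h3.mpr (HasDetGenerator.osRep y b hJ hspan (h1.mp h))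
  refine ⟨fun h => ⟨hi h, fun E => (hE E).mpr (hi h)⟩, fun hMN hor => ?_⟩
  have hU : IsAmenable (naturalRep G) (osRep (naturalRep G) N τ) :=
    hor.elim id fun ⟨E, h⟩ => (hE E).mp h
  exact h1.mpr (HasDetGenerator.of_osRep y b hJ hspan (h2.mp hMN) (h3.mp hU))
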